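/- **Setting.** Let $(\mathcal S,\preceq)$ be a totally ordered set with least element $\bot$ and an associative operation $\otimes$ that is monotone in both arguments (so $\otimes$ distributes over $\oplus=\max$). Let the elements of $\mathcal S$ be represented by distinct binary words so that $\otimes$ and the comparison $\preceq$ are computable in time (hence also space) polynomial in the lengths of the operands. Let $\Sigma$ be a finite alphabet and $Q=\{1,\dots,r\}$ a finite set of DP states, with a nonempty set $F\subseteq Q$ of final states ($r=1$ is the plain alignment grid; several states per cell give affine-gap variants). *Alignment DP.* For $A\in\Sigma^m$, $B\in\Sigma^n$ the grid DAG has vertices $(i,j,q)$, $0\le i\le m$, $0\le j\le n$, $q\in Q$, and an edge into $(i,j,q)$ from each $(i-1,j,p)$, $(i,j-1,p)$, $(i-1,j-1,p)$ in the grid, with weight $\mathrm{del}_{p,q}(A_i)$, $\mathrm{ins}_{p,q}(B_j)$, $\mathrm{sub}_{p,q}(A_i,B_j)$ in $\mathcal S$, respectively. A scoring scheme consists of these tables and of initial values $a_q\in\mathcal S$ of the sources $(0,0,q)$. The DP values are $x_{(0,0,q)}=a_q$ and $x_v=\max_{(u,v)}x_u\otimes w_{u,v}$ otherwise. An alignment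 is a path from a source to some $(m,n,q)$ with $q\in F$; its value is $a_{v_0}\otimes w_{v_0,v_1}\otimes\cdots\otimes w_{v_{k-1},v_k}$, and it is optimal if no alignment has a larger value. *Tie-breaking.* Fix, for each state $q$, a strict order on the kinds of edges (move, previous state) entering state $q$. The witness predecessor of a non-source vertex $v$ is the $u$ for which $(u,v)$ is the first edge with $x_u\otimes w_{u,v}=x_v$. The canonical alignment is obtained by following witness predecessors back from $(m,n,q)$ to a source, where $q$ is the least state of $F$ that maximizes $x_{(m,n,q)}$. *Machines.* Algorithms are deterministic multitape Turing machines with a two-way read-only input tape (holding the score tables, $A$ and $B$), a write-only output tape and finitely many work tapes over a fixed finite alphabet. Space is the number of work-tape cells scanned. **Corollary (Asymmetric alignment).** For all $\mathcal S$ with its encoding, $\Sigma$, $Q$, $F$ and tie-breaking rule as above there is one such deterministic machine with the following property. For every $\kappa$ there are constants $C,c$ such that for all $1\le m\le n$, all $A\in\Sigma^m$, $B\in\Sigma^n$ and every scoring scheme for which all scores and all DP values have representations of length at most $\kappa\lfloor\log_2 T\rfloor$, where $T=(m+1)(n+1)$, the machine - halts with the canonical alignment of $A$ and $B$, listed as its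 sequence of vertices, on its output tape, and this alignment is optimal; - runs for at most $C\,(mn)^c$ steps; - uses at most $C\,\bigl(m\,L+L^c\bigr)$ work-tape cells, where $L=\lfloor\log_2(mn)\rfloor+1$; that is, space $O(m\log(mn)+\mathrm{polylog}(mn))$. -/

import Mathlib

/-! ### Dynamic programs on directed acyclic graphs -/

/-- A dynamic program on a directed acyclic graph, over a structure `S` in which `max` plays
the role of semiring addition and `*` the role of semiring multiplication.  `preds v` is the set of
in-neighbours of `v`; `height` increases along edges (so the graph is acyclic); source vertices have
in-degree zero; `edgeRank u v` is the position of the edge `(u, v)` in the tie-breaking order (only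
comparisons between edges into a common vertex are ever used, so only these have to be distinct). -/
structure DPDag (V S : Type*) where
  preds : V → Finset V
  height : V → ℕ
  height_lt : ∀ u v, u ∈ preds v → height u < height v
  src : Finset V
  src_preds : ∀ v ∈ src, preds v = ∅
  init : V → S
  weight : V → V → S
  edgeRank : V → V → ℕ
  edgeRank_inj : ∀ v, ∀ u ∈ preds v, ∀ u' ∈ preds v, edgeRank u v = edgeRank u' v → u = u'

namespace DPDag

variable {V S : Type*} [DecidableEq V] [LinearOrder S] [OrderBot S] [Mul S]

/-- The DP value of a vertex: `init v` at a source, and otherwise the maximum of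
`value u * weight u v` over all edges `(u, v)`. -/
def value (G : DPDag V S) (v : V) : S :=
  if v ∈ G.src then G.init v
  else (G.preds v).attach.sup fun u => value G u.1 * G.weight u.1 v
termination_by G.height v
decreasing_by exact G.height_lt _ _ u.2

theorem value_eq (G : DPDag V S) (v : V) :
    G.value v = if v ∈ G.src then G.init v
      else (G.preds v).sup fun u => G.value u * G.weight u v := by
  rw [value, Finset.sup_attach (G.preds v) (fun u => G.value u * G.weight u v)]

/-- `u` is the witness predecessor of `v`: the edge `(u, v)` attains the value of `v`, and it is the
first edge into `v` in the tie-breaking order that does so. -/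
def IsWitnessPred (G : DPDag V S) (u v : V) : Prop :=
  v ∉ G.src ∧ u ∈ G.preds v ∧ G.value u * G.weight u v = G.value v ∧
    ∀ u' ∈ G.preds v, G.value u' * G.weight u' v = G.value v →
      G.edgeRank u v ≤ G.edgeRank u' v

/-- `P` is a directed path from some source to `t`, listed from the source to `t`. -/
def IsSourcePath (G : DPDag V S) (P : List V) (t : V) : Prop :=
  (∃ v ∈ G.src, P.head? = some v) ∧ P.IsChain (fun u v => u ∈ G.preds v) ∧ P.getLast? = some t

/-- `P` is the canonical witness path to `t`: it starts in a source, ends in `t`, and each of its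
vertices is the witness predecessor of the next one. -/
def IsCanonicalPath (G : DPDag V S) (P : List V) (t : V) : Prop :=
  (∃ v ∈ G.src, P.head? = some v) ∧ P.IsChain G.IsWitnessPred ∧ P.getLast? = some t

/-- The product of `x` with the weights along the path that starts in `u` and continues with the
given list of vertices. -/
def extendValue (G : DPDag V S) : S → V → List V → S
  | x, _, [] => x
  | x, u, v :: l => extendValue G (x * G.weight u v) v l

/-- The value `init v₀ * weight v₀ v₁ * ⋯ * weight vₖ₋₁ vₖ` of a path `[v₀, …, vₖ]`. -/
def pathValue (G : DPDag V S) : List V → S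
  | [] => ⊥
  | v :: l => G.extendValue (G.init v) v l

end DPDag

/-! ### Global alignment on a grid -/

/-- The three moves of an alignment: `del` consumes a letter of the first string only, `ins` a letter
of the second string only, and `sub` one letter of each (match or mismatch). -/
inductive AlignMove where
  | del
  | ins
  | sub

/-- The scores of an alignment DP over an alphabet with `s` letters and with `r` DP states per grid
cell.  `r = 1` is the plain `(m + 1) × (n + 1)` grid (longest common subsequence, edit distance,
Needleman-Wunsch); several states per cell give affine-gap variants.  In `del p q a` and so on, `p` is
the state that is left and `q` the state that is entered. A forbidden transition gets weight `⊥`. -/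
structure ScoringScheme (s r : ℕ) (S : Type*) where
  init : Fin r → S
  del : Fin r → Fin r → Fin s → S
  ins : Fin r → Fin r → Fin s → S
  sub : Fin r → Fin r → Fin s → Fin s → S

/-- A deterministic tie-breaking rule: for every state `q` a strict ranking of the kinds of edges
(move, state it comes from) that enter state `q`. Smaller rank is preferred. -/
structure TieBreak (r : ℕ) where
  rank : Fin r → AlignMove → Fin r → ℕ
  rank_inj : ∀ q d p d' p', rank q d p = rank q d' p' → d = d' ∧ p = p'

/-- A vertex `(i, j, q)`: the first `i` and `j` letters have been aligned, the state is `q`. -/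
abbrev GridVertex (m n r : ℕ) := Fin (m + 1) × Fin (n + 1) × Fin r

/-- `(u, v)` is an edge of the grid: a vertical, a horizontal or a diagonal step. -/
def GridEdge {m n r : ℕ} (u v : GridVertex m n r) : Prop :=
  (u.1.val + 1 = v.1.val ∧ u.2.1.val = v.2.1.val) ∨
  (u.1.val = v.1.val ∧ u.2.1.val + 1 = v.2.1.val) ∨
  (u.1.val + 1 = v.1.val ∧ u.2.1.val + 1 = v.2.1.val)

instance {m n r : ℕ} (u v : GridVertex m n r) : Decidable (GridEdge u v) := by
  unfold GridEdge; infer_instance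

/-- The kind of a grid edge. -/
def edgeMove {m n r : ℕ} (u v : GridVertex m n r) : AlignMove :=
  if u.1.val < v.1.val then (if u.2.1.val < v.2.1.val then .sub else .del) else .ins

/-- The weight of a grid edge (and a dummy value on pairs that are not edges). -/
def edgeWeight {s r m n : ℕ} {S : Type*} [LinearOrder S] [OrderBot S] (W : ScoringScheme s r S)
    (A : Fin m → Fin s) (B : Fin n → Fin s) (u v : GridVertex m n r) : S :=
  if hi : u.1.val < v.1.val then
    if hj : u.2.1.val < v.2.1.val then
      W.sub u.2.2 v.2.2 (A ⟨u.1.val, by omega⟩) (B ⟨u.2.1.val, by omega⟩)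
    else W.del u.2.2 v.2.2 (A ⟨u.1.val, by omega⟩)
  else if hj : u.2.1.val < v.2.1.val then W.ins u.2.2 v.2.2 (B ⟨u.2.1.val, by omega⟩)
  else ⊥

/-- The vertices with an edge into `v`. -/
def gridPreds {m n r : ℕ} (v : GridVertex m n r) : Finset (GridVertex m n r) :=
  Finset.univ.filter fun u => GridEdge u v

theorem mem_gridPreds {m n r : ℕ} (u v : GridVertex m n r) : u ∈ gridPreds v ↔ GridEdge u v := by
  simp [gridPreds]

/-- The source vertices `(0, 0, q)`. -/
def gridSources (m n r : ℕ) : Finset (GridVertex m n r) :=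
  Finset.univ.filter fun v => v.1.val = 0 ∧ v.2.1.val = 0

theorem mem_gridSources {m n r : ℕ} (v : GridVertex m n r) :
    v ∈ gridSources m n r ↔ v.1.val = 0 ∧ v.2.1.val = 0 := by
  simp only [gridSources, Finset.mem_filter, Finset.mem_univ, true_and]

/-- The global alignment DP of the strings `A` and `B`. -/
def alignDag {s r m n : ℕ} {S : Type*} [LinearOrder S] [OrderBot S] (W : ScoringScheme s r S)
    (tie : TieBreak r) (A : Fin m → Fin s) (B : Fin n → Fin s) : DPDag (GridVertex m n r) S where
  preds := gridPreds
  height v := v.1.val + v.2.1.val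
  height_lt u v h := by
    rw [mem_gridPreds, GridEdge] at h
    omega
  src := gridSources m n r
  src_preds v hv := by
    rw [mem_gridSources] at hv
    ext u
    rw [mem_gridPreds, GridEdge]
    simp only [Finset.notMem_empty, iff_false]
    omega
  init v := W.init v.2.2
  weight := edgeWeight W A B
  edgeRank u v := tie.rank v.2.2 (edgeMove u v) u.2.2
  edgeRank_inj v u hu u' hu' h := by
    rw [mem_gridPreds, GridEdge] at hu hu'
    obtain ⟨h1, h2⟩ := tie.rank_inj _ _ _ _ _ h
    unfold edgeMove at h1
    have hij : u.1.val = u'.1.val ∧ u.2.1.val = u'.2.1.val := by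
      split_ifs at h1 <;> omega
    exact Prod.ext (Fin.ext hij.1) (Prod.ext (Fin.ext hij.2) h2)

/-- The vertex `(m, n, q)`. -/
def sinkVertex (m n : ℕ) {r : ℕ} (q : Fin r) : GridVertex m n r := (Fin.last m, Fin.last n, q)

/-- `P` is an optimal alignment: a path from a source to a vertex `(m, n, q)` with `q` a final state,
whose value is the DP value of its endpoint and at least the value of every other such path. -/
def IsOptimalAlignment {s r m n : ℕ} {S : Type*} [LinearOrder S] [OrderBot S] [Mul S]
    (W : ScoringScheme s r S) (tie : TieBreak r) (F : Finset (Fin r))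
    (A : Fin m → Fin s) (B : Fin n → Fin s) (P : List (GridVertex m n r)) : Prop :=
  (∃ q ∈ F, (alignDag W tie A B).IsSourcePath P (sinkVertex m n q) ∧
    (alignDag W tie A B).pathValue P = (alignDag W tie A B).value (sinkVertex m n q)) ∧
  ∀ q ∈ F, ∀ P' : List (GridVertex m n r),
    (alignDag W tie A B).IsSourcePath P' (sinkVertex m n q) →
      (alignDag W tie A B).pathValue P' ≤ (alignDag W tie A B).pathValue P

/-- `P` is the alignment selected by the tie-breaking rule: the canonical witness path to
`(m, n, q)`, where `q` is the first final state for which the DP value of `(m, n, q)` is maximal. -/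
def IsCanonicalAlignment {s r m n : ℕ} {S : Type*} [LinearOrder S] [OrderBot S] [Mul S]
    (W : ScoringScheme s r S) (tie : TieBreak r) (F : Finset (Fin r))
    (A : Fin m → Fin s) (B : Fin n → Fin s) (P : List (GridVertex m n r)) : Prop :=
  ∃ q ∈ F,
    (∀ q' ∈ F, (alignDag W tie A B).value (sinkVertex m n q') ≤
      (alignDag W tie A B).value (sinkVertex m n q)) ∧
    (∀ q' ∈ F, (alignDag W tie A B).value (sinkVertex m n q') =
      (alignDag W tie A B).value (sinkVertex m n q) → q ≤ q') ∧
    (alignDag W tie A B).IsCanonicalPath P (sinkVertex m n q)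

/-! ### Deterministic multitape Turing machines with separate input and output tapes -/

/-- A head movement. -/
inductive HeadMove where
  | left
  | stay
  | right

/-- What the input head sees: an end marker or a letter of the input word. -/
inductive InputRead (α : Type) where
  | leftEnd
  | letter (a : α)
  | rightEnd

/-- The effect of one step of a machine with states `Q`, work alphabet `Γ`, output alphabet `β` and
`k` work tapes. -/
structure TMAction (Q Γ β : Type) (k : ℕ) where
  next : Q
  inputMove : HeadMove
  write : Fin k → Γ
  workMove : Fin k → HeadMove
  output : Option β

/-- A deterministic multitape Turing machine with a two-way read-only input tape over `α`, a
write-only output tape over `β`, and finitely many two-way infinite work tapes over a finite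
alphabet.  The machine halts where `trans` is `none`. -/
structure OfflineTM (α β : Type) where
  State : Type
  Work : Type
  state_finite : Finite State
  work_finite : Finite Work
  blank : Work
  numTapes : ℕ
  start : State
  trans : State → InputRead α → (Fin numTapes → Work) → Option (TMAction State Work β numTapes)

namespace OfflineTM

variable {α β : Type}

/-- A configuration.  Input cell `0` holds the left end marker, cells `1, …, |x|` the input word `x`,
and cell `|x| + 1` the right end marker. -/
structure Cfg (M : OfflineTM α β) where
  state : M.State
  inputPos : ℕ
  workPos : Fin M.numTapes → ℤ
  tape : Fin M.numTapes → ℤ → M.Work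
  output : List β

/-- The symbol in input cell `p`. -/
def readInput (x : List α) : ℕ → InputRead α
  | 0 => .leftEnd
  | p + 1 => match x[p]? with
    | some a => .letter a
    | none => .rightEnd

/-- Movement of the input head, which never leaves the cells `0, …, |x| + 1`. -/
def moveInput (x : List α) : HeadMove → ℕ → ℕ
  | .left, p => p - 1
  | .stay, p => p
  | .right, p => min (p + 1) (x.length + 1)

/-- Movement of a work head. -/
def moveWork : HeadMove → ℤ → ℤ
  | .left, p => p - 1
  | .stay, p => p
  | .right, p => p + 1

/-- The initial configuration: blank work tapes and empty output. -/
def initCfg (M : OfflineTM α β) : M.Cfg where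
  state := M.start
  inputPos := 0
  workPos _ := 0
  tape _ _ := M.blank
  output := []

/-- One step on input `x`; `none` if the machine halts. -/
def step (M : OfflineTM α β) (x : List α) (c : M.Cfg) : Option M.Cfg :=
  (M.trans c.state (readInput x c.inputPos) fun k => c.tape k (c.workPos k)).map fun a =>
    { state := a.next
      inputPos := moveInput x a.inputMove c.inputPos
      workPos := fun k => moveWork (a.workMove k) (c.workPos k)
      tape := fun k => Function.update (c.tape k) (c.workPos k) (a.write k)
      output := c.output ++ a.output.toList }

/-- The configuration after `t` steps on input `x` (a halted machine stays where it is). -/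
def cfgAt (M : OfflineTM α β) (x : List α) : ℕ → M.Cfg
  | 0 => M.initCfg
  | t + 1 => (M.step x (M.cfgAt x t)).getD (M.cfgAt x t)

/-- On input `x` the machine halts after at most `t` steps, with `y` on its output tape. -/
def OutputsWithin (M : OfflineTM α β) (x : List α) (y : List β) (t : ℕ) : Prop :=
  M.step x (M.cfgAt x t) = none ∧ (M.cfgAt x t).output = y

/-- The number of work-tape cells scanned during the first `t` steps on input `x`, over all work
tapes. -/
def spaceWithin (M : OfflineTM α β) (x : List α) (t : ℕ) : ℕ :=
  ∑ k : Fin M.numTapes, ((Finset.range (t + 1)).image fun i => (M.cfgAt x i).workPos k).card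

end OfflineTM

/-! ### Encodings -/

/-- The word presenting a pair of code words to a machine, with `none` as separator. -/
def pairWord (x y : List Bool) : List (Option Bool) := x.map some ++ none :: y.map some

/-- The elements of `S` are represented by distinct binary words in such a way that multiplication
and comparison take time (hence also space) polynomial in the lengths of the operands. -/
structure IsEfficientCode {S : Type*} [LinearOrder S] [Mul S] (code : S → List Bool) : Prop where
  injective : Function.Injective code
  mul : ∃ (M : OfflineTM (Option Bool) Bool) (d : ℕ), ∀ x y : S,
    M.OutputsWithin (pairWord (code x) (code y)) (code (x * y))
      (d * ((code x).length + (code y).length + 1) ^ d)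
  le : ∃ (M : OfflineTM (Option Bool) Bool) (d : ℕ), ∀ x y : S,
    M.OutputsWithin (pairWord (code x) (code y)) [decide (x ≤ y)]
      (d * ((code x).length + (code y).length + 1) ^ d)

/-- Input symbols: bits, a separator, and the letters of the strings. -/
inductive AlignSym (s : ℕ) where
  | bit (b : Bool)
  | sep
  | letter (a : Fin s)

/-- A code word followed by a separator. -/
def field {s : ℕ} (x : List Bool) : List (AlignSym s) := x.map .bit ++ [.sep]

/-- The input word: the table of scores, the string `A`, a separator, the string `B`. -/
def instanceWord {s r m n : ℕ} {S : Type*} (code : S → List Bool) (W : ScoringScheme s r S)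
    (A : Fin m → Fin s) (B : Fin n → Fin s) : List (AlignSym s) :=
  ((List.finRange r).flatMap fun q => field (code (W.init q))) ++
  ((List.finRange r).flatMap fun p => (List.finRange r).flatMap fun q =>
    ((List.finRange s).flatMap fun a => field (code (W.del p q a))) ++
    ((List.finRange s).flatMap fun b => field (code (W.ins p q b))) ++
    ((List.finRange s).flatMap fun a => (List.finRange s).flatMap fun b =>
      field (code (W.sub p q a b)))) ++
  (List.ofFn A).map .letter ++ .sep :: (List.ofFn B).map .letter

/-- All scores and all DP values of the instance have code words of length at most `κ * log₂ T`,
where `T = (m + 1) * (n + 1)` is the number of cells of the grid. -/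
structure HasLogSizeValues {s r m n : ℕ} {S : Type*} [LinearOrder S] [OrderBot S] [Mul S]
    (code : S → List Bool) (κ : ℕ) (W : ScoringScheme s r S) (tie : TieBreak r)
    (A : Fin m → Fin s) (B : Fin n → Fin s) : Prop where
  init : ∀ q, (code (W.init q)).length ≤ κ * Nat.log 2 ((m + 1) * (n + 1))
  del : ∀ p q a, (code (W.del p q a)).length ≤ κ * Nat.log 2 ((m + 1) * (n + 1))
  ins : ∀ p q b, (code (W.ins p q b)).length ≤ κ * Nat.log 2 ((m + 1) * (n + 1))
  sub : ∀ p q a b, (code (W.sub p q a b)).length ≤ κ * Nat.log 2 ((m + 1) * (n + 1))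
  value : ∀ v, (code ((alignDag W tie A B).value v)).length ≤ κ * Nat.log 2 ((m + 1) * (n + 1))

/-- Output symbols: bits, a separator, and the DP states. -/
inductive PathSym (r : ℕ) where
  | bit (b : Bool)
  | sep
  | state (q : Fin r)

/-- A vertex `(i, j, q)` is written as `i` and `j` in binary (least significant bit first), each
followed by a separator, and then `q`. -/
def vertexWord {m n r : ℕ} (v : GridVertex m n r) : List (PathSym r) :=
  (Nat.bits v.1.val).map .bit ++ .sep :: (Nat.bits v.2.1.val).map .bit ++ [.sep, .state v.2.2]

/-- A path is written as the sequence of its vertices. -/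
def pathWord {m n r : ℕ} (P : List (GridVertex m n r)) : List (PathSym r) :=
  P.flatMap vertexWord

/-!
# Global alignment in space `m * log (m * n)`

The obstacle is space: the value of a cell has `O(log (m * n))` bits, so the machine can keep about
two columns of the grid, but not the witness predecessors of all cells. It trades time for space and
runs the whole dynamic program once for every *target* cell `(i, j)` of the grid. During such a run
every value carries a tag of constant size, the state in which the witness path of the value passes
through the target cell, or `none` if it avoids the cell. A tag is inherited from the witness
predecessor, and is set at the target cell itself, so it is computed along with the values. At the
end of the run, the tag of the best final value says whether the canonical path meets the target
cell, and in which state; if so, the machine writes that vertex. The targets are taken column by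
column. The position of a cell in this order increases along every edge of the grid, so a path meets
a cell at most once, and the vertices are written in the order of the path (`flatMap_lastWithKey`,
`flatMap_tagWord`). There are `(m + 1) * (n + 1)` runs, each of polynomial time, and two columns of
values with tags take `O(m * log (m * n))` cells. The subroutines for products and comparisons take
time, and therefore space, polynomial in `log (m * n)`.

That the tags are right is `gridRun_rec`: the first best candidate in the tie-breaking order is the
one given by the witness predecessor (`bestOf_eq`), and the last vertex of the witness path in the
target cell is either the end of the path or the one of the path to the witness predecessor. The
reported path is canonical, and its value is the value of its end
(`DPDag.canonical_witnessPath`); no path has a larger value than its end, since multiplication is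
monotone (`DPDag.pathValue_le`).

The machine itself is written in a small language of structured programs (`Cmd`) for a device with
finitely many stacks, whose operations act on all stacks in parallel. `Cmd.exists_machine` turns such
a program into a Turing machine with one work tape for each stack; the space used is linear in the
largest height of a stack. Values, scores and counters are binary words with a terminator, and the
machines that multiply and compare are simulated with three stacks for each of their tapes
(`SimData`).

For the space bound it is not enough to bound heights by time. But a stack grows by at most one
symbol per step, so a part of the program that runs for a time within the space bound needs no
further analysis (`Runs.of_fast`). This covers loading the input, the treatment of one cell
(`DPData.fast_cell`), the change of columns, and a report. Heights have to be controlled by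
invariants only for the loops over rows, columns and targets (`DPData.runs_column`,
`DPData.runs_dpPass`, `runs_allRounds`), where `DPData.colMem` describes the stacks between two
cells. The estimates are collected in `exists_resource_bounds`; its space bound rests on
`progHeight_le`, which keeps the factor `m` away from the time of the subroutines.
-/

/-! ### A language for machines with stacks -/

/-- What a stack program sees: the scanned input symbol and the top of every stack. -/
structure View (α K Γ : Type) where
  inp : InputRead α
  top : K → Option Γ

/-- What can be done to one stack in one operation.  `repl` replaces the top symbol, and pushes the
symbol if the stack is empty. -/
inductive StackOp (Γ : Type) where
  | keep
  | pop
  | push (a : Γ)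
  | repl (a : Γ)

/-- The effect of a stack operation. -/
def StackOp.app {Γ : Type} : StackOp Γ → List Γ → List Γ
  | .keep, l => l
  | .pop, l => l.tail
  | .push a, l => a :: l
  | .repl a, l => a :: l.tail

/-- One operation of a stack program: it acts on all stacks in parallel. -/
structure Act (β K Γ : Type) where
  move : HeadMove := .stay
  stk : K → StackOp Γ
  out : Option β := none

/-- The memory of a stack program: position of the input head, stacks (top first), output. -/
@[ext] structure Store (β K Γ : Type) where
  pos : ℕ
  stk : K → List Γ
  out : List β

/-- Structured programs for machines with stacks indexed by `K` over the alphabet `Γ`: `case`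
branches on a value computed from the view, and `loop b p` repeats `p` while the test `b` holds. -/
inductive Cmd (α β K Γ : Type) : Type 1 where
  | op (f : View α K Γ → Act β K Γ)
  | seq (p q : Cmd α β K Γ)
  | case (ι : Type) (hι : Finite ι) (f : View α K Γ → ι) (p : ι → Cmd α β K Γ)
  | loop (b : View α K Γ → Bool) (p : Cmd α β K Γ)

section Language

variable {α β K Γ : Type}

/-- The view of a store. -/
def Store.view (x : List α) (s : Store β K Γ) : View α K Γ :=
  ⟨OfflineTM.readInput x s.pos, fun k => (s.stk k).head?⟩

/-- The effect of an operation. -/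
def Act.app (x : List α) (a : Act β K Γ) (s : Store β K Γ) : Store β K Γ :=
  ⟨OfflineTM.moveInput x a.move s.pos, fun k => (a.stk k).app (s.stk k), s.out ++ a.out.toList⟩

/-- `Exec x P c s s' t`: on input `x` the program `c` turns the store `s` into `s'`, its machine
takes `t` steps for that, and `P` holds of every store that an operation produces on the way. The
charges are those of the machine `Cmd.toTM`: two steps for an operation, one for a test. -/
inductive Exec (x : List α) (P : Store β K Γ → Prop) :
    Cmd α β K Γ → Store β K Γ → Store β K Γ → ℕ → Prop
  | op {f s} (h : P ((f (s.view x)).app x s)) : Exec x P (.op f) s ((f (s.view x)).app x s) 2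
  | seq {p q s s₁ s' t₁ t₂} (h₁ : Exec x P p s s₁ t₁) (h₂ : Exec x P q s₁ s' t₂) :
      Exec x P (.seq p q) s s' (t₁ + t₂)
  | case {ι hι f p s s' t} (h : Exec x P (p (f (s.view x))) s s' t) :
      Exec x P (.case ι hι f p) s s' (1 + t)
  | done {b p s} (hb : b (s.view x) = false) : Exec x P (.loop b p) s s 1
  | more {b p s s₁ s' t₁ t₂} (hb : b (s.view x) = true) (h₁ : Exec x P p s s₁ t₁)
      (h₂ : Exec x P (.loop b p) s₁ s' t₂) : Exec x P (.loop b p) s s' (1 + (t₁ + t₂))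

/-- All stacks have height at most `h`. -/
def Store.HeightLE (h : ℕ) (s : Store β K Γ) : Prop := ∀ k, (s.stk k).length ≤ h

theorem Store.HeightLE.mono {h h' : ℕ} {s : Store β K Γ} (hs : s.HeightLE h) (hh : h ≤ h') :
    s.HeightLE h' := fun k => (hs k).trans hh

theorem StackOp.length_app_le (o : StackOp Γ) (l : List Γ) : (o.app l).length ≤ l.length + 1 := by
  cases o <;> simp [StackOp.app]; omega

theorem Exec.weaken {x : List α} {P Q : Store β K Γ → Prop} {c : Cmd α β K Γ} {s s' : Store β K Γ}
    {t : ℕ} (hx : Exec x P c s s' t) (hPQ : ∀ s, P s → Q s) : Exec x Q c s s' t := by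
  induction hx with
  | op h => exact .op (hPQ _ h)
  | seq _ _ ih₁ ih₂ => exact .seq ih₁ ih₂
  | case _ ih => exact .case ih
  | done hb => exact .done hb
  | more hb _ _ ih₁ ih₂ => exact .more hb ih₁ ih₂

/-- Heights grow by at most one per step, so a short run stays low. -/
theorem Exec.bounded {x : List α} {P : Store β K Γ → Prop} {c : Cmd α β K Γ} {s s' : Store β K Γ}
    {t : ℕ} (hx : Exec x P c s s' t) :
    ∀ h₀ h, s.HeightLE h₀ → h₀ + t ≤ h →
      Exec x (Store.HeightLE h) c s s' t ∧ s'.HeightLE (h₀ + t) := by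
  induction hx with
  | @op f s _ =>
    intro h₀ h hs hh
    have key : Store.HeightLE (h₀ + 1) ((f (s.view x)).app x s) := fun k =>
      (StackOp.length_app_le _ _).trans (Nat.succ_le_succ (hs k))
    exact ⟨.op (key.mono (by omega)), key.mono (by omega)⟩
  | seq _ _ ih₁ ih₂ =>
    intro h₀ h hs hh
    obtain ⟨e₁, b₁⟩ := ih₁ h₀ h hs (by omega)
    obtain ⟨e₂, b₂⟩ := ih₂ _ h b₁ (by omega)
    exact ⟨.seq e₁ e₂, b₂.mono (by omega)⟩
  | case _ ih =>
    intro h₀ h hs hh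
    obtain ⟨e₁, b₁⟩ := ih h₀ h hs (by omega)
    exact ⟨.case e₁, b₁.mono (by omega)⟩
  | done hb =>
    intro h₀ h hs hh
    exact ⟨.done hb, hs.mono (by omega)⟩
  | more hb _ _ ih₁ ih₂ =>
    intro h₀ h hs hh
    obtain ⟨e₁, b₁⟩ := ih₁ h₀ h hs (by omega)
    obtain ⟨e₂, b₂⟩ := ih₂ _ h b₁ (by omega)
    exact ⟨.more hb e₁ e₂, b₂.mono (by omega)⟩

/-! ### From stack programs to Turing machines -/

/-- Control states of the machine of a program. An operation has an initial state `none` and a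
state `some w` in which the symbols `w` remain to be written: a head stands on the top symbol of its
stack, so a push has to move the head first and write afterwards. The tests of `case` and `loop` have
the state `none`. -/
def Cmd.Ctl : Cmd α β K Γ → Type
  | .op _ => Option (K → Option Γ)
  | .seq p q => p.Ctl ⊕ q.Ctl
  | .case ι _ _ p => Option (Σ i : ι, (p i).Ctl)
  | .loop _ p => Option p.Ctl

/-- The initial control state. -/
def Cmd.start : (c : Cmd α β K Γ) → c.Ctl
  | .op _ => (none : Option (K → Option Γ))
  | .seq p _ => Sum.inl p.start
  | .case ι _ _ p => (none : Option (Σ i : ι, (p i).Ctl))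
  | .loop _ p => (none : Option p.Ctl)

theorem Cmd.finite_ctl [Finite K] [Finite Γ] : (c : Cmd α β K Γ) → Finite c.Ctl
  | .op _ => inferInstanceAs (Finite (Option (K → Option Γ)))
  | .seq p q =>
    have := p.finite_ctl
    have := q.finite_ctl
    inferInstanceAs (Finite (p.Ctl ⊕ q.Ctl))
  | .case ι _ _ p =>
    have := fun i => (p i).finite_ctl
    inferInstanceAs (Finite (Option (Σ i : ι, (p i).Ctl)))
  | .loop _ p =>
    have := p.finite_ctl
    inferInstanceAs (Finite (Option p.Ctl))

/-- A machine action on tapes indexed by `K`, without the next state. -/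
structure TapeAct (β K Γ : Type) where
  move : HeadMove
  write : K → Option Γ
  wmove : K → HeadMove
  out : Option β

/-- What is on the tapes and where the heads are. -/
structure Tapes (β K Γ : Type) where
  pos : ℕ
  wpos : K → ℤ
  tape : K → ℤ → Option Γ
  out : List β

/-- The effect of a machine action. -/
def TapeAct.app (x : List α) (a : TapeAct β K Γ) (T : Tapes β K Γ) : Tapes β K Γ where
  pos := OfflineTM.moveInput x a.move T.pos
  wpos k := OfflineTM.moveWork (a.wmove k) (T.wpos k)
  tape k := Function.update (T.tape k) (T.wpos k) (a.write k)
  out := T.out ++ a.out.toList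

/-- The action that leaves everything as it is. -/
def TapeAct.idle (v : View α K Γ) : TapeAct β K Γ := ⟨.stay, v.top, fun _ => .stay, none⟩

/-- First half of a stack operation, given the symbol at the top: the symbol written there, the head
movement, and the symbol to be written in the second half. -/
def StackOp.split : StackOp Γ → Option Γ → Option Γ × HeadMove × Option Γ
  | .keep, r => (r, .stay, none)
  | .pop, none => (none, .stay, none)
  | .pop, some _ => (none, .left, none)
  | .push a, r => (r, .right, some a)
  | .repl a, none => (none, .right, some a)
  | .repl a, some _ => (some a, .stay, none)

/-- The transition function of the machine of a program; the next state is `none` when the program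
is finished. -/
def Cmd.trans : (c : Cmd α β K Γ) → c.Ctl → View α K Γ → Option c.Ctl × TapeAct β K Γ
  | .op f, (none : Option (K → Option Γ)), v =>
    let a := f v
    (some (some fun k => ((a.stk k).split (v.top k)).2.2),
      ⟨a.move, fun k => ((a.stk k).split (v.top k)).1,
        fun k => ((a.stk k).split (v.top k)).2.1, a.out⟩)
  | .op _, some w, v => (none, ⟨.stay, fun k => (w k).or (v.top k), fun _ => .stay, none⟩)
  | .seq p q, .inl c, v =>
    match p.trans c v with
    | (some c', a) => (some (.inl c'), a)
    | (none, a) => (some (.inr q.start), a)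
  | .seq _ q, .inr c, v =>
    match q.trans c v with
    | (some c', a) => (some (.inr c'), a)
    | (none, a) => (none, a)
  | .case _ _ f p, (none : Option (Σ i, (p i).Ctl)), v =>
    (some (some ⟨f v, (p (f v)).start⟩), .idle v)
  | .case _ _ _ p, some ⟨i, c⟩, v =>
    match (p i).trans c v with
    | (some c', a) => (some (some ⟨i, c'⟩), a)
    | (none, a) => (none, a)
  | .loop b p, (none : Option p.Ctl), v =>
    if b v then (some (some p.start), .idle v) else (none, .idle v)
  | .loop _ p, some c, v =>
    match p.trans c v with
    | (some c', a) => (some (some c'), a)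
    | (none, a) => (some none, a)

/-- What the machine sees. -/
def Tapes.view (x : List α) (T : Tapes β K Γ) : View α K Γ :=
  ⟨OfflineTM.readInput x T.pos, fun k => T.tape k (T.wpos k)⟩

/-- The tape that holds a stack: bottom in cell `1`, blank outside the stack. -/
def stackTape (l : List Γ) (z : ℤ) : Option Γ := if z < 1 then none else l.reverse[z.toNat - 1]?

/-- The tapes that hold the stacks of a store, each head on the top symbol, or in cell `0` if the
stack is empty. -/
def Store.tapes (s : Store β K Γ) : Tapes β K Γ where
  pos := s.pos
  wpos k := (s.stk k).length
  tape k := stackTape (s.stk k)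
  out := s.out

theorem stackTape_top (l : List Γ) : stackTape l l.length = l.head? := by
  cases l with
  | nil => simp [stackTape]
  | cons a l =>
    rw [stackTape, if_neg (by simp)]
    simp

theorem update_stackTape_push (a : Γ) (l : List Γ) :
    Function.update (stackTape l) (l.length + 1) (some a) = stackTape (a :: l) := by
  funext z
  rcases lt_trichotomy z (l.length + 1) with h | h | h
  · rw [Function.update_of_ne h.ne]
    unfold stackTape
    split_ifs with hz
    · rfl
    · rw [List.reverse_cons, List.getElem?_append_left]
      rw [List.length_reverse]; omega
  · subst h
    rw [Function.update_self, ← List.head?_cons (a := a) (l := l), ← stackTape_top]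
    simp
  · rw [Function.update_of_ne h.ne']
    unfold stackTape
    rw [if_neg (by omega), if_neg (by omega), List.getElem?_eq_none, List.getElem?_eq_none]
    · simp; omega
    · simp; omega

theorem stackTape_length (l : List Γ) : stackTape l (l.length + 1) = none := by
  rw [stackTape, if_neg (by omega), List.getElem?_eq_none]
  simp

theorem update_stackTape_pop (a : Γ) (l : List Γ) :
    Function.update (stackTape (a :: l)) (l.length + 1) none = stackTape l := by
  rw [← update_stackTape_push, Function.update_idem, ← stackTape_length l,
    Function.update_eq_self]

theorem update_stackTape_repl (a b : Γ) (l : List Γ) :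
    Function.update (stackTape (a :: l)) (l.length + 1) (some b) = stackTape (b :: l) := by
  rw [← update_stackTape_push a, Function.update_idem, update_stackTape_push]

theorem stackTape_nil : stackTape ([] : List Γ) = fun _ => none := by
  funext z; simp [stackTape]

/-- The two halves of a stack operation perform it on the tape. -/
theorem StackOp.split_spec (o : StackOp Γ) (l : List Γ) :
    let r := o.split l.head?
    let p := OfflineTM.moveWork r.2.1 (l.length : ℤ)
    let T := Function.update (stackTape l) l.length r.1
    p = (o.app l).length ∧ Function.update T p (r.2.2.or (T p)) = stackTape (o.app l) := by
  have h0 : Function.update (stackTape l) l.length l.head? = stackTape l := by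
    rw [← stackTape_top, Function.update_eq_self]
  cases o with
  | keep => simp [StackOp.split, StackOp.app, OfflineTM.moveWork, h0]
  | push a =>
    simp [StackOp.split, StackOp.app, OfflineTM.moveWork, h0, update_stackTape_push]
  | pop =>
    cases l with
    | nil => simpa [StackOp.split, StackOp.app, OfflineTM.moveWork] using h0
    | cons b l =>
      have h1 := congrFun (update_stackTape_pop b l) l.length
      rw [Function.update_of_ne (by omega)] at h1
      simp [StackOp.split, StackOp.app, OfflineTM.moveWork, update_stackTape_pop, h1,
        stackTape_top]
  | repl a =>
    cases l with
    | nil =>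
      have h1 := update_stackTape_push a ([] : List Γ)
      have h2 : Function.update (stackTape ([] : List Γ)) 0 none = stackTape [] := by
        funext z; simp [stackTape_nil, Function.update_apply]
      simp only [List.length_nil, Nat.cast_zero, zero_add] at h1
      simp [StackOp.split, StackOp.app, OfflineTM.moveWork, h1, h2]
    | cons b l =>
      simp [StackOp.split, StackOp.app, OfflineTM.moveWork, update_stackTape_repl]

/-- The machine of `c`, started in the control state `q` on tapes `T`, finishes after `t` steps with
tapes `T'`, and `P` holds of the tapes after each step. -/
inductive Reach (x : List α) (P : Tapes β K Γ → Prop) (c : Cmd α β K Γ) :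
    c.Ctl → Tapes β K Γ → ℕ → Tapes β K Γ → Prop
  | last {q T a} (h : c.trans q (T.view x) = (none, a)) (hP : P (a.app x T)) :
      Reach x P c q T 1 (a.app x T)
  | more {q q' T a t T'} (h : c.trans q (T.view x) = (some q', a)) (hP : P (a.app x T))
      (hr : Reach x P c q' (a.app x T) t T') : Reach x P c q T (1 + t) T'

theorem TapeAct.idle_app (x : List α) (T : Tapes β K Γ) :
    (TapeAct.idle (T.view x)).app x T = T := by
  simp [TapeAct.idle, TapeAct.app, Tapes.view, OfflineTM.moveInput, OfflineTM.moveWork]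

theorem Store.view_tapes (x : List α) (s : Store β K Γ) : s.tapes.view x = s.view x := by
  simp [Store.tapes, Tapes.view, Store.view, stackTape_top]

theorem Reach.seq_right {x : List α} {P : Tapes β K Γ → Prop} (p : Cmd α β K Γ)
    {q : Cmd α β K Γ} {c T t T'} (h : Reach x P q c T t T') :
    Reach x P (.seq p q) (.inr c) T t T' := by
  induction h with
  | last h hP => exact .last (by simp [Cmd.trans, h]) hP
  | @more _ q' _ a _ _ h hP _ ih =>
    exact .more (c := .seq p q) (q' := (.inr q' : p.Ctl ⊕ q.Ctl)) (by simp [Cmd.trans, h]) hP ih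

theorem Reach.seq_left {x : List α} {P : Tapes β K Γ → Prop} {p q : Cmd α β K Γ} {c T t₁ T₁ t₂ T'}
    (h : Reach x P p c T t₁ T₁) (h₂ : Reach x P q q.start T₁ t₂ T') :
    Reach x P (.seq p q) (.inl c) T (t₁ + t₂) T' := by
  induction h with
  | @last _ _ a h hP =>
    exact .more (c := .seq p q) (q' := (.inr q.start : p.Ctl ⊕ q.Ctl)) (by simp [Cmd.trans, h]) hP (h₂.seq_right p)
  | @more _ q' _ a _ _ h hP _ ih =>
    rw [add_assoc]
    exact .more (c := .seq p q) (q' := (.inl q' : p.Ctl ⊕ q.Ctl)) (by simp [Cmd.trans, h]) hP (ih h₂)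

theorem Reach.case_branch {x : List α} {P : Tapes β K Γ → Prop} {ι : Type} {hι : Finite ι} {f}
    {p : ι → Cmd α β K Γ} {i : ι} {c T t T'} (h : Reach x P (p i) c T t T') :
    Reach x P (.case ι hι f p) (some ⟨i, c⟩) T t T' := by
  induction h with
  | last h hP => exact .last (by simp [Cmd.trans, h]) hP
  | @more _ q' _ a _ _ h hP _ ih =>
    exact .more (c := .case ι hι f p)
      (q' := (some ⟨i, q'⟩ : Option (Σ i : ι, (p i).Ctl))) (by simp [Cmd.trans, h]) hP ih

theorem Reach.loop_body {x : List α} {P : Tapes β K Γ → Prop} {b} {p : Cmd α β K Γ}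
    {c T t₁ T₁ t₂ T'} (h : Reach x P p c T t₁ T₁)
    (h₂ : Reach x P (.loop b p) (none : Option p.Ctl) T₁ t₂ T') :
    Reach x P (.loop b p) (some c) T (t₁ + t₂) T' := by
  induction h with
  | @last _ _ a h hP =>
    exact .more (c := .loop b p) (q' := (none : Option p.Ctl)) (by simp [Cmd.trans, h]) hP h₂
  | @more _ q' _ a _ _ h hP _ ih =>
    rw [add_assoc]
    exact .more (c := .loop b p) (q' := (some q' : Option p.Ctl)) (by simp [Cmd.trans, h]) hP (ih h₂)

/-- All work heads are in cells `0, …, h`. -/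
def Tapes.Within (h : ℕ) (T : Tapes β K Γ) : Prop := ∀ k, 0 ≤ T.wpos k ∧ T.wpos k ≤ h

theorem Store.within_tapes {h : ℕ} {s : Store β K Γ} (hs : s.HeightLE h) : s.tapes.Within h :=
  fun k => by have := hs k; simp only [Store.tapes]; omega

/-- The machine follows the execution of a program. After each of its steps the heads are where they
are in some store of the execution, hence not above the bound for the heights. -/
theorem Exec.reach {x : List α} {h : ℕ} {c : Cmd α β K Γ} {s s' : Store β K Γ} {t : ℕ}
    (hx : Exec x (Store.HeightLE h) c s s' t) (hs : s.HeightLE h) :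
    Reach x (Tapes.Within h) c c.start s.tapes t s'.tapes ∧ s'.HeightLE h := by
  induction hx with
  | @op f s hP =>
    -- The first step moves the heads to their final places, so both tapes along the way are bounded
    -- by the final store.
    refine ⟨?_, hP⟩
    set a := f (s.view x) with ha
    have key := fun k => StackOp.split_spec (a.stk k) (s.stk k)
    let w : K → Option Γ := fun k => ((a.stk k).split (s.stk k).head?).2.2
    let a₁ : TapeAct β K Γ := ⟨a.move, fun k => ((a.stk k).split (s.stk k).head?).1,
        fun k => ((a.stk k).split (s.stk k).head?).2.1, a.out⟩
    have hpos : (a₁.app x s.tapes).wpos = (a.app x s).tapes.wpos := by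
      funext k
      exact (key k).1
    have h₁ : (Cmd.op (α := α) f).trans (none : Option (K → Option Γ)) (s.tapes.view x) =
        (some (some w), a₁) := by
      rw [Store.view_tapes]; rfl
    have hW : (a₁.app x s.tapes).Within h := by
      intro k
      rw [hpos]
      exact Store.within_tapes hP k
    let a₂ : TapeAct β K Γ :=
      ⟨.stay, fun k => (w k).or (((a₁.app x s.tapes).view x).top k), fun _ => .stay, none⟩
    have h₂ : (Cmd.op (α := α) f).trans (some w) ((a₁.app x s.tapes).view x) =
        (none, a₂) := rfl
    have hfin : a₂.app x (a₁.app x s.tapes) = (a.app x s).tapes := by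
      have e1 : ∀ T T' : Tapes β K Γ, T.pos = T'.pos → T.wpos = T'.wpos → T.tape = T'.tape →
          T.out = T'.out → T = T' := by
        rintro ⟨⟩ ⟨⟩ h1 h2 h3 h4
        cases h1; cases h2; cases h3; cases h4; rfl
      apply e1
      · rfl
      · exact hpos
      · funext k
        exact (key k).2
      · simp [a₂, a₁, TapeAct.app, Store.tapes, Act.app]
    refine .more (T := s.tapes) (t := 1) h₁ hW ?_
    rw [← hfin]
    exact .last h₂ (by rw [hfin]; exact Store.within_tapes hP)
  | seq _ _ ih₁ ih₂ =>
    obtain ⟨r₁, b₁⟩ := ih₁ hs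
    obtain ⟨r₂, b₂⟩ := ih₂ b₁
    exact ⟨r₁.seq_left r₂, b₂⟩
  | @case ι hι f p s s' t _ ih =>
    obtain ⟨r, b⟩ := ih hs
    refine ⟨.more (c := .case ι hι f p) (a := .idle (s.tapes.view x))
      (q' := (some ⟨f (s.tapes.view x), (p (f (s.tapes.view x))).start⟩ :
        Option (Σ i : ι, (p i).Ctl))) rfl ?_ ?_, b⟩
    · rw [TapeAct.idle_app]; exact Store.within_tapes hs
    · rw [TapeAct.idle_app, Store.view_tapes]; exact r.case_branch
  | @done b p s hb =>
    refine ⟨?_, hs⟩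
    have := Reach.last (x := x) (P := Tapes.Within h) (c := .loop b p)
      (q := (none : Option p.Ctl)) (T := s.tapes) (a := .idle (s.tapes.view x))
      (by rw [← Store.view_tapes] at hb; simp [Cmd.trans, hb])
      (by rw [TapeAct.idle_app]; exact Store.within_tapes hs)
    rwa [TapeAct.idle_app] at this
  | @more b p s s₁ s' t₁ t₂ hb _ _ ih₁ ih₂ =>
    obtain ⟨r₁, b₁⟩ := ih₁ hs
    obtain ⟨r₂, b₂⟩ := ih₂ b₁
    refine ⟨.more (c := .loop b p) (a := .idle (s.tapes.view x))
      (q' := (some p.start : Option p.Ctl)) ?_ ?_ ?_, b₂⟩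
    · rw [← Store.view_tapes] at hb; simp [Cmd.trans, Cmd.start, hb]
    · rw [TapeAct.idle_app]; exact Store.within_tapes hs
    · rw [TapeAct.idle_app]; exact r₁.loop_body r₂

/-- The Turing machine of a program; `e` numbers the stacks. -/
def Cmd.toTM [Finite K] [Finite Γ] {n : ℕ} (e : Fin n ≃ K) (c : Cmd α β K Γ) : OfflineTM α β where
  State := Option c.Ctl
  Work := Option Γ
  state_finite := have := c.finite_ctl; inferInstance
  work_finite := inferInstance
  blank := none
  numTapes := n
  start := some c.start
  trans q i w := q.map fun q =>
    let r := c.trans q ⟨i, fun k => w (e.symm k)⟩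
    ⟨r.1, r.2.move, fun k => r.2.write (e k), fun k => r.2.wmove (e k), r.2.out⟩

/-- The configuration with given control state and tapes. -/
def Tapes.cfg [Finite K] [Finite Γ] {n : ℕ} (e : Fin n ≃ K) (c : Cmd α β K Γ) (q : Option c.Ctl)
    (T : Tapes β K Γ) : (c.toTM e).Cfg where
  state := q
  inputPos := T.pos
  workPos k := T.wpos (e k)
  tape k := T.tape (e k)
  output := T.out

theorem Cmd.step_cfg [Finite K] [Finite Γ] {n : ℕ} (e : Fin n ≃ K) (c : Cmd α β K Γ) (x : List α)
    (q : c.Ctl) (T : Tapes β K Γ) :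
    (c.toTM e).step x (T.cfg e c (some q)) =
      some (((c.trans q (T.view x)).2.app x T).cfg e c (c.trans q (T.view x)).1) := by
  have hv : (⟨OfflineTM.readInput x T.pos, fun k => T.tape (e (e.symm k)) (T.wpos (e (e.symm k)))⟩ :
      View α K Γ) = T.view x := by
    simp [Tapes.view]
  simp only [OfflineTM.step, Cmd.toTM, Tapes.cfg, Option.map_some, TapeAct.app, hv]

/-- The configurations of `Cmd.toTM` along a run, starting from the one at time `i₀`. -/
theorem Reach.machine [Finite K] [Finite Γ] {n : ℕ} (e : Fin n ≃ K) {c : Cmd α β K Γ} {x : List α}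
    {P : Tapes β K Γ → Prop} {q : c.Ctl} {T T' : Tapes β K Γ} {t : ℕ} (h : Reach x P c q T t T') :
    ∀ i₀, (c.toTM e).cfgAt x i₀ = T.cfg e c (some q) →
      (c.toTM e).cfgAt x (i₀ + t) = T'.cfg e c none ∧
      ∀ i, i₀ < i → i ≤ i₀ + t → ∃ T₁ q₁, P T₁ ∧ (c.toTM e).cfgAt x i = T₁.cfg e c q₁ := by
  induction h with
  | @last q T a h hP =>
    intro i₀ hi
    have h1 : (c.toTM e).cfgAt x (i₀ + 1) = (a.app x T).cfg e c none := by
      rw [OfflineTM.cfgAt, hi, Cmd.step_cfg, h]; rfl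
    refine ⟨h1, fun i hi1 hi2 => ⟨_, none, hP, ?_⟩⟩
    rw [show i = i₀ + 1 by omega]; exact h1
  | @more q q' T a t T' h hP _ ih =>
    intro i₀ hi
    have h1 : (c.toTM e).cfgAt x (i₀ + 1) = (a.app x T).cfg e c (some q') := by
      rw [OfflineTM.cfgAt, hi, Cmd.step_cfg, h]; rfl
    obtain ⟨h2, h3⟩ := ih _ h1
    refine ⟨by rw [← add_assoc]; exact h2, fun i hi1 hi2 => ?_⟩
    rcases Nat.lt_or_ge (i₀ + 1) i with hlt | hge
    · exact h3 i hlt (by omega)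
    · rw [show i = i₀ + 1 by omega]; exact ⟨_, _, hP, h1⟩

/-- The store in which a program is started. -/
def Store.empty : Store β K Γ := ⟨0, fun _ => [], []⟩

/-- A stack program is run by a Turing machine whose space is linear in the stack heights. -/
theorem Cmd.exists_machine [Finite K] [Finite Γ] (c : Cmd α β K Γ) :
    ∃ (M : OfflineTM α β) (N : ℕ), ∀ (x : List α) (h : ℕ) (s : Store β K Γ) (t : ℕ),
      Exec x (Store.HeightLE h) c .empty s t →
        M.OutputsWithin x s.out t ∧ M.spaceWithin x t ≤ N * (h + 1) := by
  obtain ⟨n, ⟨e⟩⟩ := Finite.exists_equiv_fin K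
  refine ⟨c.toTM e.symm, n, fun x h s t hx => ?_⟩
  have h0 : (Store.empty : Store β K Γ).HeightLE h := fun k => by simp [Store.empty]
  obtain ⟨hr, -⟩ := hx.reach h0
  have hinit : (c.toTM e.symm).cfgAt x 0 =
      (Store.empty : Store β K Γ).tapes.cfg e.symm c (some c.start) := by
    simp [OfflineTM.cfgAt, OfflineTM.initCfg, Tapes.cfg, Store.tapes, Store.empty, stackTape_nil,
      Cmd.toTM]
  obtain ⟨h1, h2⟩ := hr.machine e.symm 0 hinit
  rw [zero_add] at h1 h2
  refine ⟨⟨?_, ?_⟩, ?_⟩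
  · rw [h1]; rfl
  · rw [h1]; rfl
  · have hcard : ∀ k : Fin n, ((Finset.range (t + 1)).image fun i =>
        ((c.toTM e.symm).cfgAt x i).workPos k).card ≤ h + 1 := by
      intro k
      have hsub : ((Finset.range (t + 1)).image fun i =>
          ((c.toTM e.symm).cfgAt x i).workPos k) ⊆ Finset.Icc (0 : ℤ) h := by
        intro z hz
        obtain ⟨i, hi, rfl⟩ := Finset.mem_image.1 hz
        rw [Finset.mem_range] at hi
        rw [Finset.mem_Icc]
        rcases Nat.eq_zero_or_pos i with rfl | hpos
        · rw [hinit]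
          have := Store.within_tapes h0 (e.symm k)
          simp only [Tapes.cfg]; omega
        · obtain ⟨T₁, q₁, hT, he⟩ := h2 i hpos (by omega)
          have := hT (e.symm k)
          rw [he]; simp only [Tapes.cfg]; omega
      refine (Finset.card_le_card hsub).trans ?_
      rw [Int.card_Icc]; omega
    refine (Finset.sum_le_card_nsmul Finset.univ _ (h + 1) fun k _ => hcard k).trans ?_
    change (Finset.univ : Finset (Fin n)).card • (h + 1) ≤ _
    rw [Finset.card_univ, Fintype.card_fin, smul_eq_mul]

end Language

/-! ### Running stack programs -/

section Running

variable {α β K Γ : Type}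

/-- As `Exec`, with an upper bound on the number of steps. -/
def Runs (x : List α) (P : Store β K Γ → Prop) (c : Cmd α β K Γ) (s s' : Store β K Γ) (T : ℕ) : Prop :=
  ∃ t ≤ T, Exec x P c s s' t

/-- `Runs` without a condition on the intermediate stores. By `Runs.of_fast` no such condition is
needed for programs whose running time may be added to the bound for the heights. -/
abbrev Fast (x : List α) (c : Cmd α β K Γ) (s s' : Store β K Γ) (T : ℕ) : Prop :=
  Runs x (fun _ => True) c s s' T

namespace Runs

variable {x : List α} {P : Store β K Γ → Prop}

theorem mono {c : Cmd α β K Γ} {s s' : Store β K Γ} {T T' : ℕ} (h : Runs x P c s s' T)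
    (hT : T ≤ T') : Runs x P c s s' T' :=
  let ⟨t, ht, e⟩ := h; ⟨t, ht.trans hT, e⟩

theorem seq {p q : Cmd α β K Γ} {s s₁ s' : Store β K Γ} {T₁ T₂ : ℕ} (h₁ : Runs x P p s s₁ T₁)
    (h₂ : Runs x P q s₁ s' T₂) : Runs x P (.seq p q) s s' (T₁ + T₂) :=
  let ⟨_, ht₁, e₁⟩ := h₁
  let ⟨_, ht₂, e₂⟩ := h₂
  ⟨_, Nat.add_le_add ht₁ ht₂, .seq e₁ e₂⟩

theorem case {ι : Type} {hι : Finite ι} {f : View α K Γ → ι} {p : ι → Cmd α β K Γ}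
    {s s' : Store β K Γ} {T : ℕ} (i : ι) (hi : f (s.view x) = i) (h : Runs x P (p i) s s' T) :
    Runs x P (.case ι hι f p) s s' (1 + T) := by
  subst hi
  obtain ⟨t, ht, e⟩ := h
  exact ⟨1 + t, by omega, .case e⟩

theorem loop_done {b : View α K Γ → Bool} {p : Cmd α β K Γ} {s : Store β K Γ}
    (hb : b (s.view x) = false) : Runs x P (.loop b p) s s 1 := ⟨1, le_rfl, .done hb⟩

theorem loop_more {b : View α K Γ → Bool} {p : Cmd α β K Γ} {s s₁ s' : Store β K Γ} {T₁ T₂ : ℕ}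
    (hb : b (s.view x) = true) (h₁ : Runs x P p s s₁ T₁) (h₂ : Runs x P (.loop b p) s₁ s' T₂) :
    Runs x P (.loop b p) s s' (1 + (T₁ + T₂)) :=
  let ⟨_, ht₁, e₁⟩ := h₁
  let ⟨_, ht₂, e₂⟩ := h₂
  ⟨_, by omega, .more hb e₁ e₂⟩

theorem finish {c : Cmd α β K Γ} {s s₁ s' : Store β K Γ} {T T' : ℕ} (h : Runs x P c s s₁ T)
    (hs : s₁ = s') (hT : T ≤ T') : Runs x P c s s' T' := hs ▸ h.mono hT

/-- A loop that passes through the stores `σ 0, …, σ N`. -/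
theorem loop_iterate {b : View α K Γ → Bool} {p : Cmd α β K Γ} (σ : ℕ → Store β K Γ) (N T : ℕ)
    (hb : ∀ i < N, b ((σ i).view x) = true) (hN : b ((σ N).view x) = false)
    (h : ∀ i < N, Runs x P p (σ i) (σ (i + 1)) T) :
    Runs x P (.loop b p) (σ 0) (σ N) (N * (T + 1) + 1) := by
  induction N generalizing σ with
  | zero => exact (loop_done hN).mono (by omega)
  | succ N ih =>
    refine (loop_more (hb 0 (by omega)) (h 0 (by omega)) (ih (fun i => σ (i + 1))
      (fun i hi => hb _ (by omega)) hN fun i hi => h _ (by omega))).mono ?_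
    rw [Nat.add_mul]; omega

/-- A short run stays low. -/
theorem of_fast {c : Cmd α β K Γ} {s s' : Store β K Γ} {T h₀ h : ℕ} (hr : Fast x c s s' T)
    (hs : s.HeightLE h₀) (hh : h₀ + T ≤ h) : Runs x (Store.HeightLE h) c s s' T := by
  obtain ⟨t, ht, e⟩ := hr
  exact ⟨t, ht, (e.bounded h₀ h hs (by omega)).1⟩

end Runs

theorem Fast.op {x : List α} (f : View α K Γ → Act β K Γ) (s : Store β K Γ) :
    Fast x (.op f) s ((f (s.view x)).app x s) 2 := ⟨2, le_rfl, .op trivial⟩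

/-- Replaces the contents of all stacks. -/
abbrev Store.put (s : Store β K Γ) (f : K → List Γ) : Store β K Γ := ⟨s.pos, f, s.out⟩

/-- An operation on the stacks only. -/
def Cmd.act (f : View α K Γ → K → StackOp Γ) : Cmd α β K Γ := .op fun v => { stk := f v }

theorem Fast.act {x : List α} (f : View α K Γ → K → StackOp Γ) (s : Store β K Γ) :
    Fast x (.act f) s (s.put (fun k => (f (s.view x) k).app (s.stk k))) 2 := by
  have := Fast.op (x := x) (β := β) (fun v => { stk := f v }) s
  simp only [Act.app, OfflineTM.moveInput, Option.toList_none, List.append_nil] at this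
  exact this

/-- The program that does nothing. -/
def Cmd.skip : Cmd α β K Γ := .act fun _ _ => .keep

theorem Fast.skip (x : List α) (s : Store β K Γ) : Fast x .skip s s 2 := Fast.act _ s

/-- The programs `f i`, one after the other, for `i` in a fixed list. -/
def Cmd.forAll {ι : Type} (f : ι → Cmd α β K Γ) : List ι → Cmd α β K Γ
  | [] => .skip
  | i :: l => .seq (f i) (Cmd.forAll f l)

/-- A bounded iteration; `σ l` is the store when the indices `l` have been treated. -/
theorem Fast.forAll {x : List α} {ι : Type} {f : ι → Cmd α β K Γ} {l : List ι}
    (σ : List ι → Store β K Γ) (T : ℕ)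
    (h : ∀ l₁ i l₂, l = l₁ ++ i :: l₂ → Fast x (f i) (σ l₁) (σ (l₁ ++ [i])) T) :
    Fast x (.forAll f l) (σ []) (σ l) (l.length * T + 2) := by
  induction l generalizing σ with
  | nil => exact (Fast.skip x _).mono (by simp)
  | cons i l ih =>
    refine ((h [] i l rfl).seq (ih (fun l => σ (i :: l)) fun l₁ j l₂ hl =>
      h (i :: l₁) j l₂ (by rw [hl]; rfl))).mono ?_
    rw [List.length_cons, Nat.add_mul]; omega

/-- Pushes the given symbol, if there is one. -/
def StackOp.push? : Option Γ → StackOp Γ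
  | none => .keep
  | some a => .push a

variable [DecidableEq K]

/-- Replaces the contents of one stack. -/
def Store.set (s : Store β K Γ) (k : K) (l : List Γ) : Store β K Γ :=
  { s with stk := Function.update s.stk k l }

@[simp] theorem Store.set_stk (s : Store β K Γ) (k : K) (l : List Γ) (k' : K) :
    (s.set k l).stk k' = if k' = k then l else s.stk k' := by
  simp [Store.set, Function.update_apply]

@[simp] theorem Store.set_pos (s : Store β K Γ) (k : K) (l : List Γ) : (s.set k l).pos = s.pos := rfl

@[simp] theorem Store.set_out (s : Store β K Γ) (k : K) (l : List Γ) : (s.set k l).out = s.out := rfl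

@[simp] theorem Store.set_set (s : Store β K Γ) (k : K) (l l' : List Γ) :
    (s.set k l).set k l' = s.set k l' := by
  simp [Store.set]

theorem Store.set_eq_self {s : Store β K Γ} {k : K} {l : List Γ} (h : s.stk k = l) :
    s.set k l = s := by
  subst h; simp [Store.set]

theorem Store.set_comm (s : Store β K Γ) {k k' : K} (h : k ≠ k') (l l' : List Γ) :
    (s.set k l).set k' l' = (s.set k' l').set k l := by
  simp [Store.set, Function.update_comm h]

/-- Moves symbols from `src` to all stacks in `D` while the top of `src` passes the test. -/
def Cmd.shift (test : Γ → Bool) (src : K) (D : K → Bool) : Cmd α β K Γ :=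
  .loop (fun v => (v.top src).any test)
    (.act fun v k => if k = src then .pop else if D k then .push? (v.top src) else .keep)

theorem Fast.shift {x : List α} {test : Γ → Bool} {src : K} (D : K → Bool) (w rest : List Γ)
    {s : Store β K Γ} (hw : ∀ a ∈ w, test a = true) (hrest : rest.head?.any test = false)
    (hs : s.stk src = w ++ rest) :
    Fast x (.shift test src D) s
      (s.put (fun k => if k = src then rest else
          if D k then w.reverse ++ s.stk k else s.stk k)) (3 * w.length + 1) := by
  induction w generalizing s with
  | nil =>
    have : (s.put (fun k => if k = src then rest else
          if D k then ([] : List Γ).reverse ++ s.stk k else s.stk k)) = s := by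
      ext1
      · rfl
      · funext k
        by_cases h : k = src
        · subst h; simpa using hs.symm
        · simp [h]
      · rfl
    rw [this]
    exact Runs.loop_done (by simpa [Store.view, hs] using hrest)
  | cons a w ih =>
    have h₁ := Fast.act (x := x) (fun v k => if k = src then .pop else
      if D k then .push? (v.top src) else .keep) s
    refine (Runs.loop_more ?_ h₁ (ih (s := _) (fun b hb => hw b (by simp [hb])) ?_)).finish
      (Store.ext rfl (funext fun k => ?_) rfl) ?_
    · simp [Store.view, hs, hw a]
    · simp [StackOp.app, hs]
    · by_cases h : k = src
      · simp [h]
      · by_cases hD : D k <;> simp [h, hD, Store.view, hs, StackOp.push?, StackOp.app]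
    · rw [List.length_cons]; omega

open scoped Classical in
/-- Empties all stacks in `D`. -/
noncomputable def Cmd.clear (D : K → Prop) : Cmd α β K Γ :=
  .loop (fun v => decide (∃ k, D k ∧ v.top k ≠ none)) (.act fun _ k => if D k then .pop else .keep)

omit [DecidableEq K] in
open scoped Classical in
theorem Fast.clear {x : List α} (D : K → Prop) (N : ℕ) {s : Store β K Γ}
    (hs : ∀ k, D k → (s.stk k).length ≤ N) :
    Fast x (.clear D) s (s.put (fun k => if D k then [] else s.stk k)) (3 * N + 1) := by
  induction N generalizing s with
  | zero =>
    have : (s.put (fun k => if D k then [] else s.stk k)) = s := by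
      ext1
      · rfl
      · funext k
        by_cases h : D k
        · have := hs k h
          simp_all
        · simp [h]
      · rfl
    rw [this]
    refine Runs.loop_done ?_
    simp only [decide_eq_false_iff_not, not_exists, not_and, not_not]
    intro k hk
    have := hs k hk
    simp_all [Store.view]
  | succ N ih =>
    by_cases hb : ∃ k, D k ∧ (s.view x).top k ≠ none
    · have h₁ := Fast.act (x := x) (fun v k => if D k then .pop else .keep) s
      refine (Runs.loop_more (by simpa using hb) h₁ (ih (s := _) fun k hk => ?_)).finish
        (Store.ext rfl (funext fun k => ?_) rfl) ?_
      · have := hs k hk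
        simp [hk, StackOp.app]; omega
      · by_cases h : D k <;> simp [h, StackOp.app]
      · omega
    · have : (s.put (fun k => if D k then [] else s.stk k)) = s := by
        ext1
        · rfl
        · funext k
          by_cases h : D k
          · simp only [not_exists, not_and, not_not] at hb
            have := hb k h
            simp_all [Store.view]
          · simp [h]
        · rfl
      rw [this]
      exact (Runs.loop_done (by simpa using hb)).mono (by omega)

end Running

/-! ### Symbols and fields -/

/-- The stack alphabet: bits, three marks, tags, letters, and further symbols `W`. -/
inductive StkSym (s r : ℕ) (W : Type) where
  | bit (b : Bool)
  | sep
  | lend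
  | rend
  | tag (o : Option (Fin r))
  | letter (a : Fin s)
  | ext (w : W)

section Fields

variable {α β K W : Type} {sg r : ℕ} [DecidableEq K] {x : List α}

local notation "Γ" => StkSym sg r W

/-- The bit that a symbol stands for. -/
def StkSym.bit? : Γ → Option Bool
  | .bit b => some b
  | _ => none

/-- Whether a symbol is a bit. -/
def StkSym.isBit (a : Γ) : Bool := a.bit?.isSome

/-- A word as a list of stack symbols. -/
def bitWord (w : List Bool) : List Γ := w.map .bit

/-- A word followed by a terminator. -/
def bitField (w : List Bool) (z : Γ) : List Γ := bitWord w ++ [z]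

theorem isBit_of_mem_bitWord {w : List Bool} : ∀ a ∈ (bitWord w : List Γ), a.isBit = true := by
  intro a ha
  obtain ⟨b, -, rfl⟩ := List.mem_map.1 ha
  rfl

@[simp] theorem length_bitWord (w : List Bool) : (bitWord w : List Γ).length = w.length := by
  simp [bitWord]

@[simp] theorem length_bitField (w : List Bool) (z : Γ) : (bitField w z).length = w.length + 1 := by
  simp [bitField]

theorem bitWord_reverse (w : List Bool) : (bitWord w : List Γ).reverse = bitWord w.reverse := by
  simp [bitWord]

/-- Moves the field on top of `src` to `dst`, where its terminator is changed by `g`. The bits go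
by way of `tmp`, which restores their order. -/
def Cmd.moveField (tmp src dst : K) (g : Γ → Γ) : Cmd α β K Γ :=
  .seq (.shift StkSym.isBit src (fun k => k = tmp))
  (.seq (.act fun v k => if k = src then .pop else if k = dst then .push? ((v.top src).map g)
    else .keep)
  (.shift StkSym.isBit tmp (fun k => k = dst)))

theorem Fast.moveField {tmp src dst : K} (g : Γ → Γ) (w : List Bool) (z : Γ)
    (rest : List Γ) {s : Store β K Γ} (h1 : tmp ≠ src) (h2 : tmp ≠ dst) (h3 : src ≠ dst)
    (hz : z.isBit = false) (ht : s.stk tmp = []) (hs : s.stk src = bitField w z ++ rest) :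
    Fast x (.moveField tmp src dst g) s
      ((s.set src rest).set dst (bitField w (g z) ++ s.stk dst)) (6 * w.length + 4) := by
  refine (Runs.seq (Fast.shift _ (bitWord w) (z :: rest) isBit_of_mem_bitWord (by simpa using hz)
    (by simp [hs, bitField])) (Runs.seq (Fast.act _ _) (Fast.shift _ (bitWord w.reverse) []
    isBit_of_mem_bitWord (by simp) ?_))).finish (Store.ext rfl (funext fun k => ?_) rfl) ?_
  · simp [h1, h2, StackOp.app, ht, bitWord_reverse]
  · simp only [Store.set_stk, Store.view]
    by_cases e1 : k = tmp
    · subst e1; simp [h1, h2, ht]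
    · by_cases e2 : k = dst
      · subst e2
        simp [e1, h3.symm, StackOp.app, StackOp.push?, bitField, bitWord_reverse]
      · by_cases e3 : k = src
        · subst e3; simp [e1, e2, StackOp.app]
        · simp [e1, e2, e3, StackOp.app]
  · simp; omega

/-- Copies the field on top of `src` to `dst`, where its terminator is changed by `g`; the
terminator is also pushed on the stacks in `D`. -/
def Cmd.copyField (tmp src dst : K) (g : Γ → Γ) (D : K → Bool) : Cmd α β K Γ :=
  .seq (.shift StkSym.isBit src (fun k => k = tmp))
  (.seq (.act fun v k => if k = dst then .push? ((v.top src).map g)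
    else if D k then .push? (v.top src) else .keep)
  (.shift StkSym.isBit tmp (fun k => k = dst || k = src)))

theorem Fast.copyField {tmp src dst : K} (g : Γ → Γ) (D : K → Bool) (w : List Bool) (z : Γ)
    (rest : List Γ) {s : Store β K Γ} (h1 : tmp ≠ src) (h2 : tmp ≠ dst) (h3 : src ≠ dst)
    (hD1 : D tmp = false) (hD2 : D src = false) (hD3 : D dst = false)
    (hz : z.isBit = false) (ht : s.stk tmp = []) (hs : s.stk src = bitField w z ++ rest) :
    Fast x (.copyField tmp src dst g D) s
      (s.put (fun k => if k = dst then bitField w (g z) ++ s.stk dst else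
          if D k then z :: s.stk k else s.stk k)) (6 * w.length + 4) := by
  refine (Runs.seq (Fast.shift _ (bitWord w) (z :: rest) isBit_of_mem_bitWord (by simpa using hz)
    (by simp [hs, bitField])) (Runs.seq (Fast.act _ _) (Fast.shift _ (bitWord w.reverse) []
    isBit_of_mem_bitWord (by simp) ?_))).finish (Store.ext rfl (funext fun k => ?_) rfl) ?_
  · simp [h1, h2, StackOp.app, ht, bitWord_reverse, hD1]
  · simp only [Store.view]
    by_cases e1 : k = tmp
    · subst e1; simp [h2, ht, hD1]
    · by_cases e2 : k = dst
      · subst e2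
        simp [e1, h3.symm, StackOp.app, StackOp.push?, bitField, bitWord_reverse]
      · by_cases e3 : k = src
        · subst e3; simp [e1, e2, StackOp.app, hD2, hs, bitField, bitWord_reverse]
        · by_cases e4 : D k <;> simp [e1, e2, e3, e4, StackOp.app, StackOp.push?]
  · simp; omega

/-- The case of no further stacks. -/
theorem Fast.copyField_set {tmp src dst : K} (g : Γ → Γ) (w : List Bool) (z : Γ)
    (rest : List Γ) {s : Store β K Γ} (h1 : tmp ≠ src) (h2 : tmp ≠ dst) (h3 : src ≠ dst)
    (hz : z.isBit = false) (ht : s.stk tmp = []) (hs : s.stk src = bitField w z ++ rest) :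
    Fast x (.copyField tmp src dst g fun _ => false) s
      (s.set dst (bitField w (g z) ++ s.stk dst)) (6 * w.length + 4) := by
  refine (Fast.copyField g _ w z rest h1 h2 h3 rfl rfl rfl hz ht hs).finish
    (Store.ext rfl (funext fun k => ?_) rfl) le_rfl
  by_cases h : k = dst <;> simp [h]

/-- Pops `flag` unless `a` and `b` hold the same bits. -/
def Cmd.eqTest (tmp a b flag : K) : Cmd α β K Γ :=
  .seq (.loop (fun v => ((v.top a).bind StkSym.bit?).isSome &&
      (v.top a).bind StkSym.bit? == (v.top b).bind StkSym.bit?)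
    (.act fun v k => if k = a ∨ k = b then .pop else if k = tmp then .push? (v.top a) else .keep))
  (.seq (.act fun v k => if k = flag ∧ (v.top a).bind StkSym.bit? ≠ (v.top b).bind StkSym.bit?
    then .pop else .keep)
  (.shift StkSym.isBit tmp (fun k => k = a || k = b)))

theorem Fast.eqTest {tmp a b flag : K} (u v : List Bool) {s : Store β K Γ}
    (h1 : tmp ≠ a) (h2 : tmp ≠ b) (h3 : a ≠ b) (h4 : flag ≠ a) (h5 : flag ≠ b) (h6 : tmp ≠ flag)
    (ht : s.stk tmp = []) (ha : s.stk a = bitWord u) (hb : s.stk b = bitWord v) :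
    Fast x (.eqTest tmp a b flag) s
      (if u = v then s else s.set flag (s.stk flag).tail) (6 * u.length + 4) := by
  -- The loop removes the longest common prefix `p`.
  have key : ∀ u v, ∀ s : Store β K Γ, s.stk a = bitWord u → s.stk b = bitWord v →
      ∃ p u' v', u = p ++ u' ∧ v = p ++ v' ∧ (u'.head? = v'.head? → u' = [] ∧ v' = []) ∧
        Fast x (.loop (fun v => ((v.top a).bind StkSym.bit?).isSome &&
          (v.top a).bind StkSym.bit? == (v.top b).bind StkSym.bit?)
          (.act fun v k => if k = a ∨ k = b then .pop else
            if k = tmp then .push? (v.top a) else .keep)) s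
          (s.put fun k => if k = a then bitWord u' else if k = b then bitWord v' else
              if k = tmp then bitWord p.reverse ++ s.stk k else s.stk k) (3 * p.length + 1) := by
    have halt : ∀ u v, ∀ s : Store β K Γ, s.stk a = bitWord u → s.stk b = bitWord v →
        (u.head? = v.head? → u = [] ∧ v = []) → Fast x (.loop (fun v =>
          ((v.top a).bind StkSym.bit?).isSome &&
          (v.top a).bind StkSym.bit? == (v.top b).bind StkSym.bit?)
          (.act fun v k => if k = a ∨ k = b then .pop else
            if k = tmp then .push? (v.top a) else .keep)) s
          (s.put fun k => if k = a then bitWord u else if k = b then bitWord v else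
              if k = tmp then bitWord ([] : List Bool).reverse ++ s.stk k else s.stk k) 1 := by
      intro u v s ha hb huv
      refine (Runs.loop_done ?_).finish (Store.ext rfl (funext fun k => ?_) rfl) le_rfl
      · simp only [Store.view, ha, hb]
        cases u <;> cases v <;> simp_all [bitWord, StkSym.bit?]
      · by_cases e1 : k = a
        · simp [e1, ha]
        · by_cases e2 : k = b
          · simp [e2, hb, h3.symm]
          · simp [e1, e2, bitWord]
    intro u
    induction u with
    | nil =>
      intro v s ha hb
      refine ⟨[], [], v, rfl, rfl, ?_, halt _ _ s ha hb ?_⟩ <;> cases v <;> simp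
    | cons c u ih =>
      intro v s ha hb
      by_cases hv : v.head? = some c
      · obtain ⟨v, rfl⟩ : ∃ v', v = c :: v' := by
          cases v <;> simp_all
        obtain ⟨p, u', v', rfl, rfl, h', hr⟩ := ih v
          (s.put fun k => if k = a then bitWord u else if k = b then bitWord v else
              if k = tmp then .bit c :: s.stk k else s.stk k) (by simp) (by simp [h3.symm])
        refine ⟨c :: p, u', v', rfl, rfl, h', (Runs.loop_more ?_ ((Fast.act _ _).finish ?_ le_rfl)
          hr).finish (Store.ext rfl (funext fun k => ?_) rfl) (by simp; omega)⟩
        · simp [Store.view, ha, hb, bitWord, StkSym.bit?]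
        · refine Store.ext rfl (funext fun k => ?_) rfl
          by_cases e1 : k = a
          · simp [e1, ha, StackOp.app, bitWord]
          · by_cases e2 : k = b
            · simp [e2, hb, StackOp.app, bitWord, h3.symm]
            · by_cases e3 : k = tmp <;>
                simp [e1, e2, e3, h1, h2, StackOp.app, StackOp.push?, Store.view, ha, bitWord]
        · by_cases e1 : k = a
          · simp [e1]
          · by_cases e2 : k = b
            · simp [e2, h3.symm]
            · by_cases e3 : k = tmp <;> simp [e1, e2, e3, h1, h2, bitWord]
      · refine ⟨[], c :: u, v, rfl, rfl, ?_, halt _ _ s ha hb ?_⟩ <;>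
        · intro h
          exact absurd h.symm hv
  obtain ⟨p, u', v', rfl, rfl, h', hr⟩ := key u v s ha hb
  -- The flag is popped if the tops differ, and the last shift puts `p` back on both stacks.
  refine (Runs.seq hr (Runs.seq (Fast.act _ _) (Fast.shift _ (bitWord p.reverse) []
    isBit_of_mem_bitWord (by simp) ?_))).finish (Store.ext ?_ (funext fun k => ?_) ?_) ?_
  · simp [h1, h2, h6, StackOp.app, ht]
  · split_ifs <;> rfl
  · have htop : ((bitWord u' : List Γ).head?.bind StkSym.bit? =
        (bitWord v' : List Γ).head?.bind StkSym.bit?) ↔ u' = v' := by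
      constructor
      · intro h
        have : u'.head? = v'.head? := by
          cases u' <;> cases v' <;> simp_all [bitWord, StkSym.bit?]
        rw [(h' this).1, (h' this).2]
      · rintro rfl; rfl
    have hbw : (bitWord p.reverse.reverse ++ bitWord u' : List Γ) = bitWord (p ++ u') ∧
        (bitWord p.reverse.reverse ++ bitWord v' : List Γ) = bitWord (p ++ v') := by
      simp [bitWord]
    simp only [Store.view, h3.symm, if_true, if_false, ne_eq, htop,
      List.append_cancel_left_eq,
      bitWord_reverse]
    by_cases e1 : k = tmp
    · subst e1
      by_cases huv : u' = v' <;> simp [huv, ht, h6]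
    · by_cases e2 : k = a
      · subst e2
        by_cases huv : u' = v'
        · subst huv; simp [e1, StackOp.app, ha, bitWord]
        · simp [e1, h4.symm, huv, StackOp.app, ha, bitWord]
      · by_cases e3 : k = b
        · subst e3
          by_cases huv : u' = v'
          · subst huv; simp [e1, e2, StackOp.app, hb, bitWord]
          · simp [e1, e2, h5.symm, huv, StackOp.app, hb, bitWord]
        · by_cases e4 : k = flag
          · subst e4
            by_cases huv : u' = v' <;> simp [e1, e2, e3, huv, StackOp.app]
          · by_cases huv : u' = v' <;> simp [e1, e2, e3, e4, huv, StackOp.app]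
  · split_ifs <;> rfl
  · simp; omega

/-! ### Binary counters -/

/-- Adds one to a binary number, least significant bit first. -/
def incBits : List Bool → List Bool
  | [] => [true]
  | false :: l => true :: l
  | true :: l => false :: incBits l

theorem bits_succ (n : ℕ) : Nat.bits (n + 1) = incBits (Nat.bits n) := by
  induction n using Nat.strong_induction_on with
  | _ n ih =>
    rcases Nat.even_or_odd' n with ⟨k, rfl | rfl⟩
    · rw [Nat.bit1_bits]
      rcases Nat.eq_zero_or_pos k with rfl | hk
      · rfl
      · rw [Nat.bit0_bits k hk.ne', incBits]
    · rw [Nat.bit1_bits, incBits, ← ih k (by omega), ← Nat.bit0_bits _ (by omega)]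
      congr 1

theorem length_bits_le_log (n : ℕ) : (Nat.bits n).length ≤ Nat.log 2 n + 1 := by
  rw [Nat.size_eq_bits_len, Nat.size_le]
  exact Nat.lt_pow_succ_log_self (by norm_num) n

/-- Increments the counter `a`. -/
def Cmd.inc (tmp a : K) : Cmd α β K Γ :=
  .seq (.loop (fun v => (v.top a).bind StkSym.bit? == some true)
    (.act fun _ k => if k = a then .pop else if k = tmp then .push (.bit false) else .keep))
  (.seq (.act fun v k => if k = a then (if ((v.top a).bind StkSym.bit?).isSome then
    .repl (.bit true) else .push (.bit true)) else .keep)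
  (.shift StkSym.isBit tmp (fun k => k = a)))

theorem Fast.inc {tmp a : K} (n : ℕ) {s : Store β K Γ} (h : tmp ≠ a) (ht : s.stk tmp = [])
    (ha : s.stk a = bitWord (Nat.bits n)) :
    Fast x (.inc tmp a) s (s.set a (bitWord (Nat.bits (n + 1)))) (6 * (Nat.bits n).length + 4) := by
  -- The loop turns the `p` trailing ones into zeros, and leaves a word `u'` that does not begin with
  -- a one.
  have key : ∀ u, ∀ s : Store β K Γ, s.stk a = bitWord u →
      ∃ p u', u.length = p + u'.length ∧ u'.head? ≠ some true ∧
        incBits u = List.replicate p false ++ incBits u' ∧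
        Fast x (.loop (fun v => (v.top a).bind StkSym.bit? == some true)
          (.act fun _ k => if k = a then .pop else if k = tmp then .push (.bit false) else .keep)) s
          (s.put fun k => if k = a then bitWord u' else
            if k = tmp then bitWord (List.replicate p false) ++ s.stk k else s.stk k)
          (3 * p + 1) := by
    intro u
    induction u with
    | nil =>
      intro s ha
      refine ⟨0, [], rfl, by simp, rfl, (Runs.loop_done ?_).finish
        (Store.ext rfl (funext fun k => ?_) rfl) le_rfl⟩
      · simp [Store.view, ha, bitWord]
      · by_cases e : k = a <;> simp [e, ha, bitWord]
    | cons c u ih =>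
      intro s ha
      cases c with
      | false =>
        refine ⟨0, false :: u, by simp, by simp, rfl, (Runs.loop_done ?_).finish
          (Store.ext rfl (funext fun k => ?_) rfl) le_rfl⟩
        · simp [Store.view, ha, bitWord, StkSym.bit?]
        · by_cases e : k = a <;> simp [e, ha, bitWord]
      | true =>
        obtain ⟨p, u', h1, h2, h3, hr⟩ := ih (s.put fun k => if k = a then bitWord u else
          if k = tmp then .bit false :: s.stk k else s.stk k) (by simp)
        refine ⟨p + 1, u', by simp [h1]; omega, h2, by simp [incBits, h3, List.replicate_succ],
          (Runs.loop_more ?_ ((Fast.act _ _).finish ?_ le_rfl)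
          hr).finish (Store.ext rfl (funext fun k => ?_) rfl) (by omega)⟩
        · simp [Store.view, ha, bitWord, StkSym.bit?]
        · refine Store.ext rfl (funext fun k => ?_) rfl
          by_cases e1 : k = a
          · simp [e1, ha, StackOp.app, bitWord]
          · by_cases e2 : k = tmp <;> simp [e1, e2, h, StackOp.app]
        · by_cases e1 : k = a
          · simp [e1]
          · by_cases e2 : k = tmp <;> simp [e1, e2, h, bitWord, List.replicate_succ']
  obtain ⟨p, u', h1, h2, h3, hr⟩ := key _ s ha
  refine (Runs.seq hr (Runs.seq (Fast.act _ _) (Fast.shift _ (bitWord (List.replicate p false)) []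
    isBit_of_mem_bitWord (by simp) ?_))).finish (Store.ext rfl (funext fun k => ?_) rfl) ?_
  · simp [h, StackOp.app, ht]
  · by_cases e1 : k = a
    · subst e1
      rw [bits_succ, h3]
      rcases u' with _ | ⟨c, u'⟩
      · simp [h.symm, Store.view, StackOp.app, bitWord, incBits]
      · cases c
        · simp [h.symm, Store.view, StackOp.app, bitWord, incBits, StkSym.bit?]
        · simp at h2
    · by_cases e2 : k = tmp <;> simp [e1, e2, h, StackOp.app, ht]
  · simp; omega

end Fields

/-! ### Running a Turing machine as a subroutine -/

theorem Exec.length_le {α β K Γ : Type} {x : List α} {P : Store β K Γ → Prop} {c : Cmd α β K Γ}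
    {s s' : Store β K Γ} {t : ℕ} (hx : Exec x P c s s' t) (k : K) :
    (s'.stk k).length ≤ (s.stk k).length + t := by
  induction hx with
  | @op f s _ =>
    exact (StackOp.length_app_le _ _).trans (by omega)
  | seq _ _ ih₁ ih₂ => omega
  | case _ ih => omega
  | done hb => omega
  | more hb _ _ ih₁ ih₂ => omega

theorem Runs.length_le {α β K Γ : Type} {x : List α} {P : Store β K Γ → Prop} {c : Cmd α β K Γ}
    {s s' : Store β K Γ} {T : ℕ} (h : Runs x P c s s' T) (k : K) :
    (s'.stk k).length ≤ (s.stk k).length + T := by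
  obtain ⟨t, ht, e⟩ := h
  have := e.length_le k
  omega

/-- The stacks used in the simulation of a machine with `n` work tapes: its input tape to the left
of the head and from the head on, its output, its state, and for each work tape the cells to the
left of the head, the scanned cell, and the cells to the right of the head. -/
inductive SimKey (n : ℕ) where
  | inl
  | inr
  | out
  | st
  | tl (t : Fin n)
  | tc (t : Fin n)
  | tr (t : Fin n)
  deriving DecidableEq

/-- How the simulation of `M` uses stacks and symbols of a larger machine. -/
structure SimData (M : OfflineTM (Option Bool) Bool) (K W : Type) where
  key : SimKey M.numTapes → K
  key_inj : Function.Injective key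
  enc : M.Work ⊕ M.State → W
  dec : W → Option (M.Work ⊕ M.State)
  dec_enc : ∀ a, dec (enc a) = some a

namespace SimData

variable {α β K W : Type} {sg r : ℕ} {x : List α} {M : OfflineTM (Option Bool) Bool}
  (D : SimData M K W)

local notation "Γ" => StkSym sg r W

/-- The stack symbol for a symbol on the input tape of `M`. -/
def inSym : Option Bool → Γ
  | some b => .bit b
  | none => .sep

/-- The input tape of `M` with its end markers. -/
def cells (w : List (Option Bool)) : List Γ := .lend :: (w.map inSym ++ [.rend])

/-- The work symbol of `M` that a stack symbol stands for. -/
def decWork : Option Γ → M.Work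
  | some (.ext w) => match D.dec w with
    | some (.inl a) => a
    | _ => M.blank
  | _ => M.blank

/-- The state of `M` that a stack symbol stands for. -/
def decState : Option Γ → Option M.State
  | some (.ext w) => match D.dec w with
    | some (.inr q) => some q
    | _ => none
  | _ => none

/-- The stack symbol for a work symbol of `M`. -/
def encWork (a : M.Work) : Γ := .ext (D.enc (.inl a))

@[simp] theorem decWork_encWork (a : M.Work) : D.decWork (some (D.encWork a : Γ)) = a := by
  simp [decWork, encWork, D.dec_enc]

@[simp] theorem decWork_none : D.decWork (none : Option Γ) = M.blank := rfl

/-- What `M` reads, given the stack symbol. -/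
def readSym : Option Γ → InputRead (Option Bool)
  | some .lend => .leftEnd
  | some (.bit b) => .letter (some b)
  | some .sep => .letter none
  | _ => .rightEnd

/-- Whether the right end marker is scanned. -/
def atEnd : Option Γ → Bool
  | some .rend => true
  | _ => false

/-- The next action of the simulated machine. -/
def action (v : View α K Γ) : Option (TMAction M.State M.Work Bool M.numTapes) :=
  (D.decState (v.top (D.key .st))).bind fun q =>
    M.trans q (readSym (v.top (D.key .inr))) fun t => D.decWork (v.top (D.key (.tc t)))

/-- The stack operations that perform an action of `M`, given the top symbols. -/
def stepOp (top : SimKey M.numTapes → Option Γ) (a : TMAction M.State M.Work Bool M.numTapes) :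
    SimKey M.numTapes → StackOp Γ
  | .inl => match a.inputMove with
    | .left => .pop
    | .stay => .keep
    | .right => if atEnd (top .inr) then .keep else .push? (top .inr)
  | .inr => match a.inputMove with
    | .left => .push? (top .inl)
    | .stay => .keep
    | .right => if atEnd (top .inr) then .keep else .pop
  | .out => .push? (a.output.map .bit)
  | .st => .repl (.ext (D.enc (.inr a.next)))
  | .tl t => match a.workMove t with
    | .left => .pop
    | .stay => .keep
    | .right => .push (D.encWork (a.write t))
  | .tc t => match a.workMove t with
    | .left => .repl ((top (.tl t)).getD (D.encWork M.blank))
    | .stay => .repl (D.encWork (a.write t))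
    | .right => .repl ((top (.tr t)).getD (D.encWork M.blank))
  | .tr t => match a.workMove t with
    | .left => .push (D.encWork (a.write t))
    | .stay => .keep
    | .right => .pop

/-- The stacks `f` hold the configuration `c` of `M` on input `w`. -/
structure Rep (w : List (Option Bool)) (c : M.Cfg) (f : SimKey M.numTapes → List Γ) : Prop where
  st : f .st = [.ext (D.enc (.inr c.state))]
  out : f .out = bitWord c.output.reverse
  pos : c.inputPos ≤ w.length + 1
  inl : f .inl = ((cells w).take c.inputPos).reverse
  inr : f .inr = (cells w).drop c.inputPos
  tl : ∀ t (i : ℕ), D.decWork (f (.tl t))[i]? = c.tape t (c.workPos t - 1 - i)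
  tc : ∀ t, D.decWork (f (.tc t)).head? = c.tape t (c.workPos t)
  tr : ∀ t (i : ℕ), D.decWork (f (.tr t))[i]? = c.tape t (c.workPos t + 1 + i)

theorem length_cells (w : List (Option Bool)) : (cells w : List Γ).length = w.length + 2 := by
  simp [cells]

theorem readSym_cells (w : List (Option Bool)) (p : ℕ) (hp : p ≤ w.length + 1) :
    readSym (cells w : List Γ)[p]? = OfflineTM.readInput w p := by
  cases p with
  | zero => rfl
  | succ p =>
    rcases Nat.lt_or_ge p w.length with h | h
    · have h1 : (cells w : List Γ)[p + 1]? = some (inSym w[p]) := by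
        rw [cells, List.getElem?_cons_succ, List.getElem?_append_left (by simpa using h),
          List.getElem?_map, List.getElem?_eq_getElem h]
        rfl
      rw [h1, OfflineTM.readInput, List.getElem?_eq_getElem h]
      cases w[p] <;> rfl
    · obtain rfl : p = w.length := by omega
      have h1 : (cells w : List Γ)[w.length + 1]? = some .rend := by
        simp [cells]
      rw [h1, OfflineTM.readInput, List.getElem?_eq_none le_rfl]
      rfl

theorem atEnd_cells (w : List (Option Bool)) (p : ℕ) (hp : p ≤ w.length + 1) :
    atEnd (cells w : List Γ)[p]? = decide (p = w.length + 1) := by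
  cases p with
  | zero => simp [cells, atEnd]
  | succ p =>
    rcases Nat.lt_or_ge p w.length with h | h
    · have h1 : (cells w : List Γ)[p + 1]? = some (inSym w[p]) := by
        rw [cells, List.getElem?_cons_succ, List.getElem?_append_left (by simpa using h),
          List.getElem?_map, List.getElem?_eq_getElem h]
        rfl
      rw [h1]
      cases w[p] <;> simp [inSym, atEnd] <;> omega
    · obtain rfl : p = w.length := by omega
      have h1 : (cells w : List Γ)[w.length + 1]? = some .rend := by
        simp [cells]
      rw [h1]
      simp [atEnd]

theorem Rep.action_eq {w : List (Option Bool)} {c : M.Cfg} {v : View α K Γ}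
    {f : SimKey M.numTapes → List Γ} (h : D.Rep w c f) (hv : ∀ i, v.top (D.key i) = (f i).head?) :
    D.action v = M.trans c.state (OfflineTM.readInput w c.inputPos)
      fun k => c.tape k (c.workPos k) := by
  have h1 : D.decState (v.top (D.key .st)) = some c.state := by
    rw [hv, h.st]; simp [decState, D.dec_enc]
  have h2 : readSym (v.top (D.key .inr)) = OfflineTM.readInput w c.inputPos := by
    rw [hv, h.inr, List.head?_drop, readSym_cells w _ h.pos]
  rw [action, h1, Option.bind_some, h2]
  simp only [hv, h.tc]

/-- One step of `M` is one parallel stack operation. A head movement passes the scanned cell from one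
of the three stacks of a tape to the next; cells beyond the bottom of a stack are blank. -/
theorem Rep.step {w : List (Option Bool)} {c : M.Cfg}
    {f : SimKey M.numTapes → List Γ} (h : D.Rep w c f)
    {a : TMAction M.State M.Work Bool M.numTapes}
    (ha : M.trans c.state (OfflineTM.readInput w c.inputPos)
      (fun k => c.tape k (c.workPos k)) = some a) (c' : M.Cfg) (hc : M.step w c = some c') :
    D.Rep w c' fun i => (D.stepOp (fun i => (f i).head?) a i).app (f i) := by
  rw [OfflineTM.step, ha, Option.map_some, Option.some_inj] at hc
  subst hc
  have hlen := length_cells (sg := sg) (r := r) (W := W) w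
  have hend := atEnd_cells (sg := sg) (r := r) (W := W) w _ h.pos
  have hpos := h.pos
  have hin : OfflineTM.moveInput w a.inputMove c.inputPos ≤ w.length + 1 ∧
      (D.stepOp (fun i => (f i).head?) a .inl).app (f .inl) =
        ((cells w).take (OfflineTM.moveInput w a.inputMove c.inputPos)).reverse ∧
      (D.stepOp (fun i => (f i).head?) a .inr).app (f .inr) =
        (cells w).drop (OfflineTM.moveInput w a.inputMove c.inputPos) := by
    simp only [stepOp, h.inr, List.head?_drop, hend]
    cases a.inputMove with
    | stay => simp [OfflineTM.moveInput, StackOp.app, h.inl, h.pos]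
    | right =>
      by_cases he : c.inputPos = w.length + 1
      · simp [OfflineTM.moveInput, StackOp.app, h.inl, he]
      · have e1 : min (c.inputPos + 1) (w.length + 1) = c.inputPos + 1 := by omega
        have hlt : c.inputPos < (cells w : List Γ).length := by omega
        simp only [OfflineTM.moveInput, e1, he, decide_false, Bool.false_eq_true, if_false,
          StackOp.app, List.tail_drop, List.getElem?_eq_getElem hlt, StackOp.push?, and_true, h.inl]
        refine ⟨by omega, ?_⟩
        rw [← List.take_append_getElem hlt, List.reverse_append]
        rfl
    | left =>
      rcases Nat.eq_zero_or_pos c.inputPos with h0 | h0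
      · simp [OfflineTM.moveInput, h.inl, h0, StackOp.app, StackOp.push?]
      · obtain ⟨p, hp⟩ : ∃ p, c.inputPos = p + 1 := ⟨c.inputPos - 1, by omega⟩
        have hlt : p < (cells w : List Γ).length := by omega
        have e2 : f .inl = (cells w)[p] :: ((cells w).take p).reverse := by
          rw [h.inl, hp, ← List.take_append_getElem hlt, List.reverse_append]
          rfl
        have e3 : ((cells w)[p] :: (cells w).drop (p + 1) : List Γ) = (cells w).drop p :=
          List.getElem_cons_drop hlt
        simp only [OfflineTM.moveInput, e2, hp, StackOp.app, StackOp.push?, List.head?_cons, e3,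
          Nat.add_sub_cancel, List.tail_cons, and_true]
        omega
  have htape : ∀ t, (∀ i : ℕ, D.decWork ((D.stepOp (fun i => (f i).head?) a (.tl t)).app
        (f (.tl t)))[i]? = Function.update (c.tape t) (c.workPos t) (a.write t)
          (OfflineTM.moveWork (a.workMove t) (c.workPos t) - 1 - i)) ∧
      D.decWork ((D.stepOp (fun i => (f i).head?) a (.tc t)).app (f (.tc t))).head? =
        Function.update (c.tape t) (c.workPos t) (a.write t)
          (OfflineTM.moveWork (a.workMove t) (c.workPos t)) ∧
      (∀ i : ℕ, D.decWork ((D.stepOp (fun i => (f i).head?) a (.tr t)).app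
        (f (.tr t)))[i]? = Function.update (c.tape t) (c.workPos t) (a.write t)
          (OfflineTM.moveWork (a.workMove t) (c.workPos t) + 1 + i)) := by
    intro t
    have hl := h.tl t
    have hr := h.tr t
    have hl0 := hl 0
    have hr0 := hr 0
    simp only [stepOp]
    have hget : ∀ o : Option Γ, D.decWork (some (o.getD (D.encWork M.blank))) = D.decWork o := by
      intro o; cases o <;> simp
    rw [← List.head?_eq_getElem?] at hl0 hr0
    cases a.workMove t with
    | stay =>
      refine ⟨fun i => ?_, ?_, fun i => ?_⟩
      · simp only [OfflineTM.moveWork, StackOp.app]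
        rw [hl, Function.update_of_ne (by omega)]
      · simp [OfflineTM.moveWork, StackOp.app]
      · simp only [OfflineTM.moveWork, StackOp.app]
        rw [hr, Function.update_of_ne (by omega)]
    | left =>
      refine ⟨fun i => ?_, ?_, fun i => ?_⟩
      · simp only [OfflineTM.moveWork, StackOp.app, List.getElem?_tail]
        rw [hl, Function.update_of_ne (by omega)]
        congr 1; push_cast; ring
      · simp only [OfflineTM.moveWork, StackOp.app, List.head?_cons, hget]
        rw [hl0, Function.update_of_ne (by omega)]
        congr 1; push_cast; ring
      · cases i with
        | zero => simp [OfflineTM.moveWork, StackOp.app]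
        | succ i =>
          simp only [OfflineTM.moveWork, StackOp.app, List.getElem?_cons_succ]
          rw [hr, Function.update_of_ne (by push_cast; omega)]
          congr 1; push_cast; ring
    | right =>
      refine ⟨fun i => ?_, ?_, fun i => ?_⟩
      · cases i with
        | zero => simp [OfflineTM.moveWork, StackOp.app]
        | succ i =>
          simp only [OfflineTM.moveWork, StackOp.app, List.getElem?_cons_succ]
          rw [hl, Function.update_of_ne (by push_cast; omega)]
          congr 1; push_cast; ring
      · simp only [OfflineTM.moveWork, StackOp.app, List.head?_cons, hget]
        rw [hr0, Function.update_of_ne (by omega)]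
        congr 1; push_cast; ring
      · simp only [OfflineTM.moveWork, StackOp.app, List.getElem?_tail]
        rw [hr, Function.update_of_ne (by omega)]
        congr 1; push_cast; ring
  refine ⟨?_, ?_, hin.1, hin.2.1, hin.2.2, fun t => (htape t).1, fun t => (htape t).2.1,
    fun t => (htape t).2.2⟩
  · simp [stepOp, StackOp.app, h.st]
  · simp only [stepOp, h.out]
    cases a.output <;> simp [StackOp.push?, StackOp.app, bitWord]

/-- The stack operations of one step of `M`, none if `M` halts. -/
noncomputable def stepAct (v : View α K Γ) : K → StackOp Γ :=
  match D.action v with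
  | none => fun _ => .keep
  | some a => Function.extend D.key (D.stepOp (fun i => v.top (D.key i)) a) fun _ => .keep

variable [DecidableEq K]

/-- Runs `M` on the input that is on the stack `inr` and leaves the reversed output on `out`. -/
noncomputable def call : Cmd α β K Γ :=
  .seq (.act fun _ k => if k = D.key .st then .push (.ext (D.enc (.inr M.start)))
    else if k = D.key .inr then .push .lend else .keep)
  (.seq (.loop (fun v => (D.action v).isSome) (.act D.stepAct))
  (.clear fun k => ∃ i, D.key i = k ∧ k ≠ D.key .out))

omit [DecidableEq K] in
/-- The simulation after `i` steps of `M` takes `n` more steps to reach time `T`, by which `M` has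
halted; it may end before that. -/
theorem fast_loop {w : List (Option Bool)} {T : ℕ}
    (hT : M.step w (M.cfgAt w T) = none) (n : ℕ) : ∀ i, i + n = T → ∀ s : Store β K Γ,
      D.Rep w (M.cfgAt w i) (fun j => s.stk (D.key j)) →
      ∃ s' : Store β K Γ, Fast x (.loop (fun v => (D.action v).isSome) (.act D.stepAct)) s s'
        (3 * n + 1) ∧ D.Rep w (M.cfgAt w T) (fun j => s'.stk (D.key j)) ∧ s'.pos = s.pos ∧
        s'.out = s.out ∧ ∀ k, (∀ j, D.key j ≠ k) → s'.stk k = s.stk k := by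
  have halt : ∀ i (s : Store β K Γ), D.Rep w (M.cfgAt w i) (fun j => s.stk (D.key j)) →
      M.step w (M.cfgAt w i) = none → (D.action (s.view x)).isSome = false := by
    intro i s h hi
    rw [h.action_eq D fun _ => rfl]
    simpa [OfflineTM.step] using hi
  induction n with
  | zero =>
    rintro i rfl s h
    exact ⟨s, Runs.loop_done (halt _ _ h hT), h, rfl, rfl, fun _ _ => rfl⟩
  | succ n ih =>
    intro i hi s h
    rcases hs : M.step w (M.cfgAt w i) with _ | c'
    · have hconst : ∀ j, M.cfgAt w (i + j) = M.cfgAt w i := by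
        intro j
        induction j with
        | zero => rfl
        | succ j ihj => rw [← add_assoc, OfflineTM.cfgAt, ihj, hs]; rfl
      refine ⟨s, (Runs.loop_done (halt _ _ h hs)).mono (by omega), ?_, rfl, rfl, fun _ _ => rfl⟩
      rw [← hi, hconst]; exact h
    · have hnext : M.cfgAt w (i + 1) = c' := by rw [OfflineTM.cfgAt, hs]; rfl
      obtain ⟨a, ha⟩ : ∃ a, M.trans (M.cfgAt w i).state
          (OfflineTM.readInput w (M.cfgAt w i).inputPos)
          (fun k => (M.cfgAt w i).tape k ((M.cfgAt w i).workPos k)) = some a := by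
        rw [OfflineTM.step] at hs
        obtain ⟨a, ha, -⟩ := Option.map_eq_some_iff.1 hs
        exact ⟨a, ha⟩
      have hact : D.action (s.view x) = some a := by rw [h.action_eq D fun _ => rfl, ha]
      have h₁ := Fast.act (x := x) (D.stepAct) s
      have hr := h.step D ha c' hs
      rw [← hnext] at hr
      obtain ⟨s', e1, e2, e3, e4, e5⟩ := ih (i + 1) (by omega)
        (s.put fun k => (D.stepAct (s.view x) k).app (s.stk k)) (by
          simp only [stepAct, hact, D.key_inj.extend_apply]
          exact hr)
      refine ⟨s', (Runs.loop_more (by rw [hact]; rfl) h₁ e1).mono (by omega), e2, e3, e4,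
        fun k hk => ?_⟩
      rw [e5 k hk]
      simp only [stepAct, hact]
      rw [Function.extend_apply' _ _ _ (by rintro ⟨j, hj⟩; exact hk j hj)]
      rfl

/-- A subroutine call costs time proportional to the time of `M`, and empties all stacks of the
simulation except for the output, so that the next call finds them as this one did. -/
theorem fast_call {w : List (Option Bool)} {z : List Bool} {T : ℕ} (h : M.OutputsWithin w z T)
    {s : Store β K Γ} (hin : s.stk (D.key .inr) = w.map inSym ++ [.rend])
    (hs : ∀ i, i ≠ .inr → s.stk (D.key i) = []) :
    Fast x D.call s ((s.set (D.key .inr) []).set (D.key .out) (bitWord z.reverse))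
      (12 * T + 3 * w.length + 20) := by
  have hne : ∀ i j, i ≠ j → D.key i ≠ D.key j := fun i j hij h => hij (D.key_inj h)
  have e1 := Fast.act (x := x) (β := β) (fun (_ : View α K Γ) k => if k = D.key .st then .push (.ext (D.enc (.inr M.start)))
    else if k = D.key .inr then .push .lend else .keep) s
  have hrep : D.Rep w (M.cfgAt w 0) fun j => (s.put fun k => (if k = D.key .st then
      .push (.ext (D.enc (.inr M.start))) else if k = D.key .inr then .push .lend else
      .keep : StackOp Γ).app (s.stk k)).stk (D.key j) := by
    simp only [D.key_inj.eq_iff]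
    refine ⟨?_, ?_, ?_, ?_, ?_, fun t i => ?_, fun t => ?_, fun t i => ?_⟩ <;>
      simp [hs, hin, StackOp.app, OfflineTM.cfgAt, OfflineTM.initCfg, cells, bitWord]
  obtain ⟨s', e2, r, p1, p2, p3⟩ := D.fast_loop (x := x) h.1 T 0 (by omega) _ hrep
  have hle : ∀ k, (∃ i, D.key i = k ∧ k ≠ D.key .out) → (s'.stk k).length ≤
      w.length + 3 * T + 4 := by
    rintro k ⟨i, rfl, hi⟩
    have l1 := e1.length_le (D.key i)
    have l2 := e2.length_le (D.key i)
    have l3 : (s.stk (D.key i)).length ≤ w.length + 1 := by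
      by_cases hi : i = .inr
      · rw [hi, hin]; simp
      · rw [hs i hi]; simp
    omega
  have e3 := Fast.clear (x := x) _ _ hle
  refine (e1.seq (e2.seq e3)).finish (Store.ext ?_ (funext fun k => ?_) ?_) (by omega)
  · exact p1
  · by_cases hk : ∃ i, D.key i = k
    · obtain ⟨i, rfl⟩ := hk
      by_cases hi : i = .out
      · subst hi
        simp only [ne_eq, not_true_eq_false, and_false, exists_false, if_false, Store.set_stk,
          if_true]
        rw [r.out, h.2]
      · have h1 : D.key i ≠ D.key .out := hne _ _ hi
        have h2 : ∃ j, D.key j = D.key i ∧ D.key i ≠ D.key .out := ⟨i, rfl, h1⟩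
        refine (if_pos h2).trans ?_
        rw [Store.set_stk, if_neg h1, Store.set_stk]
        split_ifs with h3
        · rfl
        · rw [hs i fun h => h3 (by rw [h])]
    · have hk' : ∀ j, D.key j ≠ k := fun j hj => hk ⟨j, hj⟩
      have h2 : ¬ ∃ j, D.key j = k ∧ k ≠ D.key .out := fun ⟨j, hj, _⟩ => hk' j hj
      refine (if_neg h2).trans ?_
      rw [Store.set_stk, if_neg (hk' _).symm, Store.set_stk, if_neg (hk' _).symm,
        p3 k hk']
      simp only [if_neg (hk' _).symm]
      rfl
  · exact p2

end SimData

/-! ### Comparing candidates for the value of a cell -/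

namespace OfflineTM

variable {α β : Type} {M : OfflineTM α β} {x : List α}

theorem cfgAt_add_of_halted {t : ℕ} (h : M.step x (M.cfgAt x t) = none) (i : ℕ) :
    M.cfgAt x (t + i) = M.cfgAt x t := by
  induction i with
  | zero => rfl
  | succ i ih => rw [← add_assoc, cfgAt, ih, h]; rfl

theorem OutputsWithin.mono {y : List β} {t t' : ℕ} (h : M.OutputsWithin x y t) (ht : t ≤ t') :
    M.OutputsWithin x y t' := by
  obtain ⟨i, rfl⟩ := Nat.exists_eq_add_of_le ht
  rw [OutputsWithin, cfgAt_add_of_halted h.1]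
  exact h

theorem length_output_le (t : ℕ) : (M.cfgAt x t).output.length ≤ t := by
  induction t with
  | zero => simp [cfgAt, initCfg]
  | succ t ih =>
    rw [cfgAt]
    rcases hs : M.step x (M.cfgAt x t) with _ | c
    · rw [Option.getD_none]; omega
    · rw [Option.getD_some]
      rw [step] at hs
      obtain ⟨a, -, rfl⟩ := Option.map_eq_some_iff.1 hs
      have : a.output.toList.length ≤ 1 := by cases a.output <;> simp
      simp only [List.length_append]
      omega

theorem OutputsWithin.length_le {y : List β} {t : ℕ} (h : M.OutputsWithin x y t) : y.length ≤ t := by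
  rw [← h.2]; exact length_output_le t

end OfflineTM

/-- The entries of a score table. -/
inductive TabIdx (s r : ℕ) where
  | init (q : Fin r)
  | del (p q : Fin r) (a : Fin s)
  | ins (p q : Fin r) (b : Fin s)
  | sub (p q : Fin r) (a b : Fin s)
  deriving DecidableEq

/-- The stacks of the alignment machine.  `tab` holds the score table, `aF` and `aB` the first string
from the current row on and before it; `col`, `dcol` the values of the previous column from the
current row on and before it, `ncol` those of the current column, `cur` those of the current cell;
`ci`, `cj` count rows and columns, `si`, `sj` are the coordinates of the target cell, `act` marks
that the current cell is the target cell, and `fin` that the last target has been treated; `mul` and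
`le` serve the two subroutines. -/
inductive Key (s r n₁ n₂ : ℕ) where
  | tab (t : TabIdx s r)
  | aF
  | aB
  | col (p : Fin r)
  | dcol (p : Fin r)
  | ncol (p : Fin r)
  | cur (p : Fin r)
  | cand
  | best
  | tmp
  | act
  | fin
  | ci
  | cj
  | si
  | sj
  | mul (i : SimKey n₁)
  | le (i : SimKey n₂)
  deriving DecidableEq

/-- The stack alphabet of the alignment machine with subroutines `M₁` and `M₂`. -/
abbrev ASym (s r : ℕ) (M₁ M₂ : OfflineTM (Option Bool) Bool) : Type :=
  StkSym s r ((M₁.Work ⊕ M₁.State) ⊕ (M₂.Work ⊕ M₂.State))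

/-- The programs from which the alignment machine is built. -/
abbrev AProg (s r : ℕ) (M₁ M₂ : OfflineTM (Option Bool) Bool) : Type 1 :=
  Cmd (AlignSym s) (PathSym r) (Key s r M₁.numTapes M₂.numTapes) (ASym s r M₁ M₂)

/-- The stores of the alignment machine. -/
abbrev AStore (s r : ℕ) (M₁ M₂ : OfflineTM (Option Bool) Bool) : Type :=
  Store (PathSym r) (Key s r M₁.numTapes M₂.numTapes) (ASym s r M₁ M₂)

section Candidates

variable {s r : ℕ} {M₁ M₂ : OfflineTM (Option Bool) Bool} {x : List (AlignSym s)}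

/-- The simulation of the first subroutine. -/
def mulSim (s r : ℕ) (M₁ M₂ : OfflineTM (Option Bool) Bool) :
    SimData M₁ (Key s r M₁.numTapes M₂.numTapes) ((M₁.Work ⊕ M₁.State) ⊕ (M₂.Work ⊕ M₂.State)) where
  key := .mul
  key_inj _ _ h := by injection h
  enc := .inl
  dec := Sum.getLeft?
  dec_enc _ := rfl

/-- The simulation of the second subroutine. -/
def leSim (s r : ℕ) (M₁ M₂ : OfflineTM (Option Bool) Bool) :
    SimData M₂ (Key s r M₁.numTapes M₂.numTapes) ((M₁.Work ⊕ M₁.State) ⊕ (M₂.Work ⊕ M₂.State)) where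
  key := .le
  key_inj _ _ h := by injection h
  enc := .inr
  dec := Sum.getRight?
  dec_enc _ := rfl

/-- The better one of the best candidate so far and the new one; the older one wins ties. -/
def better {S τ : Type*} [LinearOrder S] : Option (S × τ) → S × τ → S × τ
  | none, a => a
  | some b, a => if a.1 ≤ b.1 then b else a

/-- A value with its tag as a field. -/
def valField {S : Type*} (code : S → List Bool) (v : S × Option (Fin r)) : List (ASym s r M₁ M₂) :=
  bitField (code v.1) (.tag v.2)

/-- The contents of `best`. -/
def optField {S : Type*} (code : S → List Bool) :
    Option (S × Option (Fin r)) → List (ASym s r M₁ M₂)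
  | none => []
  | some v => valField code v

theorem map_inSym_pairWord (u v : List Bool) :
    ((pairWord u v).map SimData.inSym : List (ASym s r M₁ M₂)) =
      bitWord u ++ .sep :: bitWord v := by
  simp [pairWord, bitWord, SimData.inSym, Function.comp_def]

/-- Compares `cand` with `best`, keeps the better one in `best`, and empties `cand`. -/
noncomputable def improve : AProg s r M₁ M₂ :=
  .case Bool inferInstance (fun v => (v.top .best).isSome) fun
  | false => .moveField .tmp .cand .best id
  | true =>
    .seq (.copyField .tmp .best (.le .inr) (fun _ => .rend) fun _ => false)
    (.seq (.copyField .tmp .cand (.le .inr) (fun _ => .sep) fun _ => false)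
    (.seq (leSim s r M₁ M₂).call
    (.case Bool inferInstance (fun v => (v.top (.le .out)).bind StkSym.bit? == some true) fun
    | true => .clear fun k => k = .cand ∨ k = .le .out
    | false => .seq (.clear fun k => k = .best ∨ k = .le .out) (.moveField .tmp .cand .best id))))

/-- The old best value `u` is kept exactly if `v ≤ u` for the new value `v`, so ties go to the
candidate that came first. -/
theorem fast_improve {S : Type*} [LinearOrder S] {code : S → List Bool} {b : ℕ}
    {o : Option (S × Option (Fin r))} {v : S × Option (Fin r)}
    (hv : (code v.1).length ≤ b) (ho : ∀ u ∈ o, (code u.1).length ≤ b)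
    (hle : ∀ u ∈ o, M₂.OutputsWithin (pairWord (code v.1) (code u.1)) [decide (v.1 ≤ u.1)] b)
    {σ : AStore s r M₁ M₂} (hc : σ.stk .cand = valField code v) (hb : σ.stk .best = optField code o)
    (ht : σ.stk .tmp = []) (hs : ∀ i, σ.stk (.le i) = []) :
    Fast x improve σ ((σ.set .cand []).set .best (optField code (some (better o v)))) (50 * b + 80) := by
  cases o with
  | none =>
    refine (Runs.case false (by simp [Store.view, hb, optField]) (Fast.moveField id _ _ []
      (by simp) (by simp) (by simp) rfl ht (by rw [hc, List.append_nil]; rfl))).finish ?_ ?_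
    · rw [hb]; simp [optField, better, valField]
    · omega
  | some u =>
    have hu := ho u rfl
    have hw : (pairWord (code v.1) (code u.1)).length ≤ 2 * b + 1 := by
      simp [pairWord]; omega
    have e1 := Fast.copyField_set (x := x) (tmp := .tmp) (src := .best) (dst := .le .inr)
      (fun _ => .rend) (code u.1) (.tag u.2) [] (s := σ) (by simp) (by simp)
      (by simp) rfl ht (by rw [hb, List.append_nil]; rfl)
    have e2 := Fast.copyField_set (x := x) (tmp := .tmp) (src := .cand) (dst := .le .inr)
      (fun _ => .sep) (code v.1) (.tag v.2) [] (s := σ.set (.le .inr) (bitField (code u.1) .rend))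
      (by simp) (by simp) (by simp) rfl (by simpa using ht)
      (by simp only [Store.set_stk, reduceCtorEq, if_false]; rw [hc, List.append_nil]; rfl)
    have e3 := (leSim s r M₁ M₂).fast_call (x := x) (hle u rfl)
      (s := σ.set (.le .inr) ((pairWord (code v.1) (code u.1)).map SimData.inSym ++ [.rend]))
      (by simp [leSim]) (by intro i hi; simp [leSim, hi, hs])
    refine ((Runs.case true (by simp [Store.view, hb, optField, valField, bitField, bitWord])
      ((e1.finish ?_ le_rfl).seq ((e2.finish ?_ le_rfl).seq (e3.seq
        (Runs.case (decide (v.1 ≤ u.1)) ?_ (s' := (σ.set .cand []).set .best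
          (optField code (some (better (some u) v)))) (T := 12 * b + 10) ?_)))))).mono ?_
    · rw [hs, List.append_nil]
    · rw [Store.set_set, Store.set_stk, if_pos rfl, map_inSym_pairWord]
      simp [bitField]
    · simp [Store.view, leSim, bitWord, StkSym.bit?]
    · by_cases hvu : v.1 ≤ u.1
      · simp only [hvu, decide_true]
        refine (Fast.clear (x := x) _ (b + 1) ?_).finish (Store.ext rfl (funext fun k => ?_) rfl)
          (by omega)
        · rintro k (rfl | rfl)
          · simp [leSim, hc, valField]; omega
          · simp [leSim]
        · by_cases h1 : k = .cand
          · simp [h1]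
          · by_cases h2 : k = .le .out
            · simp [h2, hs]
            · by_cases h3 : k = .le .inr
              · simp [h3, hs, leSim]
              · by_cases h4 : k = .best <;> simp [h1, h2, h3, h4, leSim, hb, better, hvu]
      · simp only [hvu, decide_false]
        refine (Runs.seq (Fast.clear (x := x) _ (b + 1) ?_) (Fast.moveField id (code v.1) (.tag v.2)
          [] (by simp) (by simp) (by simp) rfl ?_ ?_)).finish
          (Store.ext rfl (funext fun k => ?_) rfl) (by omega)
        · rintro k (rfl | rfl)
          · simp [leSim, hb, optField, valField]; omega
          · simp [leSim]
        · simp [leSim, ht]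
        · simp [leSim, hc, valField]
        · by_cases h1 : k = .cand
          · simp [h1]
          · by_cases h2 : k = .le .out
            · simp [h2, hs]
            · by_cases h3 : k = .le .inr
              · simp [h3, hs, leSim]
              · by_cases h4 : k = .best <;>
                  simp [h1, h2, h3, h4, leSim, better, hvu, optField, valField]
    · omega

/-- Bounds for the subroutines: on operands with code words of length at most `ℓ` the product is
computed in `b` steps and has length at most `lam`, and on operands of length at most `lam` the
comparison takes `b` steps. Only products of two operands of length `ℓ` are ever formed, but such
products are compared before it is known which of them is a value of the program, hence two bounds. -/
structure OpBounds {S : Type*} [LinearOrder S] [Mul S] (M₁ M₂ : OfflineTM (Option Bool) Bool)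
    (code : S → List Bool) (ℓ lam b : ℕ) : Prop where
  le_lam : ℓ ≤ lam
  lam_le : lam ≤ b
  length_mul : ∀ u v : S, (code u).length ≤ ℓ → (code v).length ≤ ℓ → (code (u * v)).length ≤ lam
  mul : ∀ u v : S, (code u).length ≤ ℓ → (code v).length ≤ ℓ →
    M₁.OutputsWithin (pairWord (code u) (code v)) (code (u * v)) b
  le : ∀ u v : S, (code u).length ≤ lam → (code v).length ≤ lam →
    M₂.OutputsWithin (pairWord (code u) (code v)) [decide (u ≤ v)] b

/-- Multiplies the value on top of `src` with the table entry `t` and compares the product, with the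
tag of the value, with `best`. -/
noncomputable def tryCandidate (src : Key s r M₁.numTapes M₂.numTapes) (t : TabIdx s r) :
    AProg s r M₁ M₂ :=
  .seq (.copyField .tmp (.tab t) (.mul .inr) (fun _ => .rend) fun _ => false)
  (.seq (.copyField .tmp src (.mul .inr) (fun _ => .sep) fun k => k = .cand)
  (.seq (mulSim s r M₁ M₂).call
  (.seq (.shift StkSym.isBit (.mul .out) fun k => k = .cand) improve)))

theorem better_length_le {S τ : Type*} [LinearOrder S] {code : S → List Bool} {l : ℕ}
    {o : Option (S × τ)} {v : S × τ} (ho : ∀ u ∈ o, (code u.1).length ≤ l)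
    (hv : (code v.1).length ≤ l) : (code (better o v).1).length ≤ l := by
  cases o with
  | none => exact hv
  | some u =>
    simp only [better]
    split_ifs
    · exact ho u rfl
    · exact hv

/-- The tag of the value on `src` is pushed on `cand` first, and the product goes on top of it: the
simulation leaves its output reversed, and the shift restores the order. -/
theorem fast_tryCandidate {S : Type*} [LinearOrder S] [Mul S] {code : S → List Bool} {ℓ lam b : ℕ}
    (hB : OpBounds M₁ M₂ code ℓ lam b)
    {o : Option (S × Option (Fin r))} {v : S × Option (Fin r)} {y : S} {t : TabIdx s r}
    {src : Key s r M₁.numTapes M₂.numTapes}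
    (hsrc : src ≠ .tmp ∧ src ≠ .cand ∧ ∀ i, src ≠ .mul i)
    (hv : (code v.1).length ≤ ℓ) (hy : (code y).length ≤ ℓ)
    (ho : ∀ u ∈ o, (code u.1).length ≤ lam)
    {σ : AStore s r M₁ M₂} {rest : List (ASym s r M₁ M₂)} (htab : σ.stk (.tab t) = bitField (code y) .sep)
    (hval : σ.stk src = valField code v ++ rest)
    (hc : σ.stk .cand = []) (hb : σ.stk .best = optField code o)
    (ht : σ.stk .tmp = []) (hs : ∀ i, σ.stk (.le i) = []) (hs' : ∀ i, σ.stk (.mul i) = []) :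
    Fast x (tryCandidate src t) σ
      (σ.set .best (optField code (some (better o (v.1 * y, v.2))))) (100 * b + 150) := by
  have hℓ := hB.le_lam
  have hlam := hB.lam_le
  have hm := hB.length_mul _ _ hv hy
  obtain ⟨n1, n2, n3⟩ := hsrc
  have hw : (pairWord (code v.1) (code y)).length ≤ 2 * b + 1 := by
    simp [pairWord]; omega
  have e1 := Fast.copyField_set (x := x) (tmp := .tmp) (src := .tab t) (dst := .mul .inr)
    (fun _ => .rend) (code y) .sep [] (s := σ) (by simp) (by simp)
    (by simp) rfl ht (by rw [htab, List.append_nil])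
  have e2 := Fast.copyField (x := x) (tmp := .tmp) (src := src) (dst := .mul .inr)
    (fun _ => .sep) (fun k => k = .cand) (code v.1) (.tag v.2) rest
    (s := σ.set (.mul .inr) (bitField (code y) .rend))
    n1.symm (by simp) (n3 _) (by simp) (by simpa using n2) (by simp) rfl (by simpa using ht)
    (by rw [Store.set_stk, if_neg (n3 _), hval]; rfl)
  have e3 := (mulSim s r M₁ M₂).fast_call (x := x) (hB.mul _ _ hv hy)
    (s := (σ.set (.mul .inr) ((pairWord (code v.1) (code y)).map SimData.inSym ++ [.rend])).set
      .cand [.tag v.2])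
    (by simp [mulSim]) (by intro i hi; simp [mulSim, hi, hs'])
  have e4 := Fast.shift (x := x) (test := StkSym.isBit) (src := .mul .out) (fun k => k = .cand)
    (bitWord (code (v.1 * y)).reverse) [] (s := (σ.set .cand [.tag v.2]).set (.mul .out)
      (bitWord (code (v.1 * y)).reverse)) isBit_of_mem_bitWord (by simp) (by simp)
  have e5 := fast_improve (x := x) (σ := σ.set .cand (valField code (v.1 * y, v.2))) (o := o)
    (v := (v.1 * y, v.2)) (code := code) (b := b) (hm.trans hlam)
    (fun u hu => (ho u hu).trans hlam) (fun u hu => hB.le _ _ hm (ho u hu)) (by simp) (by simpa using hb)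
    (by simpa using ht) (by simpa using hs)
  refine (Runs.seq (e1.finish ?_ le_rfl) (Runs.seq (e2.finish ?_ le_rfl) (Runs.seq
    (e3.finish ?_ le_rfl) (Runs.seq (e4.finish ?_ le_rfl) (e5.finish ?_ le_rfl))))).mono ?_
  · rw [hs', List.append_nil]
  · refine Store.ext rfl (funext fun k => ?_) rfl
    by_cases h1 : k = .mul .inr
    · subst h1
      rw [map_inSym_pairWord]; simp [bitField]
    · by_cases h2 : k = .cand <;> simp [h1, h2, hc]
  · refine Store.ext rfl (funext fun k => ?_) rfl
    by_cases h1 : k = .mul .inr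
    · subst h1; simp [mulSim, hs']
    · by_cases h2 : k = .mul .out
      · subst h2; simp [mulSim]
      · simp [h1, h2, mulSim]
  · refine Store.ext rfl (funext fun k => ?_) rfl
    by_cases h1 : k = .mul .out
    · subst h1; simp [hs']
    · by_cases h2 : k = .cand <;> simp [h1, h2, valField, bitField, bitWord_reverse]
  · rw [Store.set_set, Store.set_eq_self hc]
  · simp; omega

end Candidates

/-! ### The value of a cell -/

section Cell

variable {s r : ℕ} {M₁ M₂ : OfflineTM (Option Bool) Bool} {x : List (AlignSym s)}

/-- The kinds of edges into state `q`, in the tie-breaking order. -/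
def TieBreak.kinds (tie : TieBreak r) (q : Fin r) : List (AlignMove × Fin r) :=
  ((List.finRange r).flatMap fun p => [(.del, p), (.ins, p), (.sub, p)]).mergeSort
    fun k l => tie.rank q k.1 k.2 ≤ tie.rank q l.1 l.2

theorem TieBreak.mem_kinds (tie : TieBreak r) (q : Fin r) (k : AlignMove × Fin r) :
    k ∈ tie.kinds q := by
  rw [kinds, List.mem_mergeSort, List.mem_flatMap]
  refine ⟨k.2, List.mem_finRange _, ?_⟩
  obtain ⟨d, p⟩ := k
  cases d <;> simp

theorem TieBreak.pairwise_kinds (tie : TieBreak r) (q : Fin r) :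
    (tie.kinds q).Pairwise fun k l => tie.rank q k.1 k.2 ≤ tie.rank q l.1 l.2 := by
  have := List.pairwise_mergeSort (le := fun k l : AlignMove × Fin r =>
    decide (tie.rank q k.1 k.2 ≤ tie.rank q l.1 l.2)) (by intro a b c; simp; omega)
    (by intro a b; simp; omega)
    ((List.finRange r).flatMap fun p => [(.del, p), (.ins, p), (.sub, p)])
  simpa [TieBreak.kinds] using this

theorem TieBreak.length_kinds (tie : TieBreak r) (q : Fin r) : (tie.kinds q).length = 3 * r := by
  simp [kinds, List.length_mergeSort, mul_comm]

/-- The table entry for an edge of given kind into state `q`; `oa` and `ob` are the letters before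
the cell, `none` in row or column `0`. -/
def tableIdx (oa ob : Option (Fin s)) (q : Fin r) : AlignMove × Fin r → Option (TabIdx s r)
  | (.del, p) => oa.map (.del p q)
  | (.ins, p) => ob.map (.ins p q)
  | (.sub, p) => oa.bind fun a => ob.map (.sub p q a)

/-- The stack with the value at the start of an edge on top. -/
def srcKey {n₁ n₂ : ℕ} : AlignMove × Fin r → Key s r n₁ n₂
  | (.del, p) => .ncol p
  | (.ins, p) => .col p
  | (.sub, p) => .dcol p

variable {S : Type*} [LinearOrder S] [Mul S]

/-- The best candidate among the edges of the given kinds, where `src` are the values and tags at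
their starts and `tv` is the score table. -/
def bestOf (tv : TabIdx s r → S) (src : AlignMove × Fin r → S × Option (Fin r))
    (oa ob : Option (Fin s)) (q : Fin r) (l : List (AlignMove × Fin r)) :
    Option (S × Option (Fin r)) :=
  l.foldl (fun o k => match tableIdx oa ob q k with
    | none => o
    | some t => some (better o ((src k).1 * tv t, (src k).2))) none

/-- The value of a cell for state `q`, with the tag inherited from the witness predecessor. -/
def cellValue (tie : TieBreak r) (tv : TabIdx s r → S)
    (src : AlignMove × Fin r → S × Option (Fin r)) (oa ob : Option (Fin s)) (q : Fin r) :
    Option (S × Option (Fin r)) :=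
  if oa = none ∧ ob = none then some (tv (.init q), none)
  else bestOf tv src oa ob q (tie.kinds q)

/-- Computes `cellValue` into `best`. The loop over the kinds of edges is unrolled, in the tie-breaking
order, and edges from outside the grid are left out. -/
noncomputable def stateValue (tie : TieBreak r) (oa ob : Option (Fin s)) (q : Fin r) :
    AProg s r M₁ M₂ :=
  if oa = none ∧ ob = none then
    .copyField .tmp (.tab (.init q)) .best (fun _ => .tag none) fun _ => false
  else .forAll (fun k => match tableIdx oa ob q k with
    | none => .skip
    | some t => tryCandidate (srcKey k) t) (tie.kinds q)

/-- What the computation of a cell needs: the score table, the values at the starts of the edges,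
and empty auxiliary stacks. -/
structure CellReady (code : S → List Bool) (ℓ : ℕ) (tv : TabIdx s r → S)
    (src : AlignMove × Fin r → S × Option (Fin r)) (oa ob : Option (Fin s))
    (f : Key s r M₁.numTapes M₂.numTapes → List (ASym s r M₁ M₂)) : Prop where
  tab : ∀ t, f (.tab t) = bitField (code (tv t)) .sep
  length_tab : ∀ t, (code (tv t)).length ≤ ℓ
  top_src : ∀ q k t, tableIdx oa ob q k = some t → ∃ rest, f (srcKey k) = valField code (src k) ++ rest
  length_src : ∀ q k t, tableIdx oa ob q k = some t → (code (src k).1).length ≤ ℓ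
  cand : f .cand = []
  tmp : f .tmp = []
  mul : ∀ i, f (.mul i) = []
  le : ∀ i, f (.le i) = []

omit [LinearOrder S] [Mul S] in
theorem CellReady.congr {code : S → List Bool} {ℓ : ℕ} {tv : TabIdx s r → S}
    {src : AlignMove × Fin r → S × Option (Fin r)} {oa ob : Option (Fin s)}
    {f g : Key s r M₁.numTapes M₂.numTapes → List (ASym s r M₁ M₂)}
    (h : CellReady code ℓ tv src oa ob f)
    (hg : ∀ k, k ≠ .best → k ≠ .act → (∀ q, k ≠ .cur q) → g k = f k) :
    CellReady code ℓ tv src oa ob g where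
  tab t := by rw [hg _ (by simp) (by simp) (by simp), h.tab]
  length_tab := h.length_tab
  top_src q k t hk := by
    rw [hg]
    · exact h.top_src q k t hk
    all_goals obtain ⟨d, p⟩ := k; cases d <;> simp [srcKey]
  length_src := h.length_src
  cand := by rw [hg _ (by simp) (by simp) (by simp), h.cand]
  tmp := by rw [hg _ (by simp) (by simp) (by simp), h.tmp]
  mul i := by rw [hg _ (by simp) (by simp) (by simp), h.mul]
  le i := by rw [hg _ (by simp) (by simp) (by simp), h.le]

theorem bestOf_append (tv : TabIdx s r → S) (src : AlignMove × Fin r → S × Option (Fin r))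
    (oa ob : Option (Fin s)) (q : Fin r) (l : List (AlignMove × Fin r)) (k : AlignMove × Fin r) :
    bestOf tv src oa ob q (l ++ [k]) = match tableIdx oa ob q k with
      | none => bestOf tv src oa ob q l
      | some t => some (better (bestOf tv src oa ob q l) ((src k).1 * tv t, (src k).2)) := by
  rw [bestOf, List.foldl_append]; rfl

/-- The candidates for a cell are products, so their code words are bounded by `lam` and not by `ℓ`;
only the final value of the cell is known to be short. -/
theorem length_bestOf_le {code : S → List Bool} {ℓ lam b : ℕ} (hB : OpBounds M₁ M₂ code ℓ lam b)
    {tv : TabIdx s r → S} {src : AlignMove × Fin r → S × Option (Fin r)} {oa ob : Option (Fin s)}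
    (q : Fin r) (h1 : ∀ t, (code (tv t)).length ≤ ℓ)
    (h2 : ∀ k t, tableIdx oa ob q k = some t → (code (src k).1).length ≤ ℓ)
    (l : List (AlignMove × Fin r)) :
    ∀ u ∈ bestOf tv src oa ob q l, (code u.1).length ≤ lam := by
  induction l using List.reverseRecOn with
  | nil => simp [bestOf]
  | append_singleton l k ih =>
    rw [bestOf_append]
    split
    · exact ih
    · rename_i t ht
      rintro u ⟨⟩
      exact better_length_le ih (hB.length_mul _ _ (h2 _ _ ht) (h1 _))

theorem length_cellValue_le {code : S → List Bool} {ℓ lam b : ℕ} (hB : OpBounds M₁ M₂ code ℓ lam b)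
    (tie : TieBreak r)
    {tv : TabIdx s r → S} {src : AlignMove × Fin r → S × Option (Fin r)} {oa ob : Option (Fin s)}
    (q : Fin r) (h1 : ∀ t, (code (tv t)).length ≤ ℓ)
    (h2 : ∀ k t, tableIdx oa ob q k = some t → (code (src k).1).length ≤ ℓ) :
    ∀ u ∈ cellValue tie tv src oa ob q, (code u.1).length ≤ lam := by
  rw [cellValue]
  split_ifs
  · rintro u ⟨⟩
    exact (h1 _).trans hB.le_lam
  · exact length_bestOf_le hB q h1 h2 _

/-- Bound for the time to compute the value of a cell for one state. -/
def stateTime (r b : ℕ) : ℕ := 3 * r * (100 * b + 150) + 2 + (12 * b + 10)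

theorem fast_stateValue {code : S → List Bool} {ℓ lam b : ℕ} (hB : OpBounds M₁ M₂ code ℓ lam b)
    (tie : TieBreak r) {tv : TabIdx s r → S} {src : AlignMove × Fin r → S × Option (Fin r)}
    {oa ob : Option (Fin s)} (q : Fin r) {σ : AStore s r M₁ M₂}
    (h : CellReady code ℓ tv src oa ob σ.stk) (hb : σ.stk .best = []) :
    Fast x (stateValue tie oa ob q) σ
      (σ.set .best (optField code (cellValue tie tv src oa ob q)))
      (3 * r * (100 * b + 150) + 2 + (6 * b + 4)) := by
  have hℓ := hB.le_lam
  have hlam := hB.lam_le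
  rw [stateValue, cellValue]
  split_ifs with h0
  · refine (Fast.copyField_set (x := x) _ (code (tv (.init q))) .sep [] (by simp) (by simp)
      (by simp) rfl h.tmp (by rw [h.tab, List.append_nil])).finish (by rw [hb]; simp [optField, valField]) ?_
    have := h.length_tab (.init q)
    omega
  · have key := Fast.forAll (x := x) (f := fun k => match tableIdx oa ob q k with
      | none => (.skip : AProg s r M₁ M₂)
      | some t => tryCandidate (srcKey k) t) (l := tie.kinds q)
      (fun l => σ.set .best (optField code (bestOf tv src oa ob q l))) (100 * b + 150) ?_
    · rw [tie.length_kinds] at key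
      have e : σ.set .best (optField code (bestOf tv src oa ob q [])) = σ := Store.set_eq_self hb
      have k := key.mono (T' := 3 * r * (100 * b + 150) + 2 + (6 * b + 4)) (by omega)
      simp only [e] at k
      exact k
    · intro l₁ k l₂ hl
      have hr : CellReady code ℓ tv src oa ob
          (σ.set .best (optField code (bestOf tv src oa ob q l₁))).stk :=
        h.congr fun k h1 _ _ => by simp [h1]
      rw [bestOf_append]
      rcases ht : tableIdx oa ob q k with _ | t
      · exact (Fast.skip x _).mono (by omega)
      · obtain ⟨rest, hrest⟩ := hr.top_src q k t ht
        refine (fast_tryCandidate hB (src := srcKey k) (y := tv t) (v := src k)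
          (o := bestOf tv src oa ob q l₁) ?_ (hr.length_src q k t ht) (hr.length_tab t)
          (length_bestOf_le hB q hr.length_tab (hr.length_src q) l₁) (hr.tab t) hrest hr.cand
          (by simp) hr.tmp hr.le hr.mul).finish ?_ le_rfl
        · obtain ⟨d, p⟩ := k; cases d <;> simp [srcKey]
        · simp

/-- Computes the value of the current cell for state `q`, with its tag, into `cur q`; at the target
cell the tag is `q`. -/
noncomputable def stateStep (tie : TieBreak r) (oa ob : Option (Fin s)) (q : Fin r) :
    AProg s r M₁ M₂ :=
  .seq (stateValue tie oa ob q)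
  (.case Bool inferInstance (fun v => (v.top .act).isSome) fun
  | true => .moveField .tmp .best (.cur q) fun _ => .tag (some q)
  | false => .moveField .tmp .best (.cur q) id)

theorem fast_stateStep {code : S → List Bool} {ℓ lam b : ℕ} (hB : OpBounds M₁ M₂ code ℓ lam b)
    (tie : TieBreak r) {tv : TabIdx s r → S} {src : AlignMove × Fin r → S × Option (Fin r)}
    {oa ob : Option (Fin s)} {q : Fin r} {σ : AStore s r M₁ M₂}
    (h : CellReady code ℓ tv src oa ob σ.stk) (hb : σ.stk .best = []) (hcur : σ.stk (.cur q) = [])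
    {v : S × Option (Fin r)} (hv : cellValue tie tv src oa ob q = some v) :
    Fast x (stateStep tie oa ob q) σ (σ.set (.cur q) (valField code
      (v.1, if (σ.stk .act).head?.isSome then some q else v.2))) (stateTime r b) := by
  have hlam := hB.lam_le
  have hlen := length_cellValue_le hB tie q h.length_tab (h.length_src q) v hv
  have e1 := fast_stateValue (x := x) hB tie q h hb
  rw [hv] at e1
  have e2 := fun g => Fast.moveField (x := x) (tmp := .tmp) (src := .best) (dst := .cur q) g
    (code v.1) (.tag v.2) [] (s := σ.set .best (optField code (some v)))
    (by simp) (by simp) (by simp) rfl (by simpa using h.tmp) (by simp [optField, valField])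
  have fin : ∀ l, ((σ.set .best (optField code (some v))).set .best []).set (.cur q) l =
      σ.set (.cur q) l := fun l => by rw [Store.set_set, Store.set_eq_self hb]
  refine (e1.seq (Runs.case (T := 6 * b + 4) ((σ.stk .act).head?.isSome) (by simp [Store.view])
    ?_)).mono (by rw [stateTime]; omega)
  cases ha : (σ.stk .act).head?.isSome
  · exact (e2 id).finish (by rw [fin]; simp [hcur, valField]) (by omega)
  · exact (e2 _).finish (by rw [fin]; simp [hcur, valField]) (by omega)

end Cell

/-! ### One run of the dynamic program -/

/-- The data of a run of the dynamic program: the two strings `a` and `b`, the score table `tv`, the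
values and tags `V i j q` of the cells, and the target cell `(ti, tj)`. The tag of a value is the
state in which the witness path of the value passes through the target cell, `none` if it does not
or if the target cell comes later. -/
structure DPData (S : Type*) (s r : ℕ) where
  a : List (Fin s)
  b : List (Fin s)
  tv : TabIdx s r → S
  V : ℕ → ℕ → Fin r → S × Option (Fin r)
  ti : ℕ
  tj : ℕ

/-- The letter before position `i`, none at the beginning. -/
def letterBefore {s : ℕ} (a : List (Fin s)) : ℕ → Option (Fin s)
  | 0 => none
  | i + 1 => a[i]?

section Run

variable {s r : ℕ} {M₁ M₂ : OfflineTM (Option Bool) Bool} {x : List (AlignSym s)}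
variable {S : Type*} [LinearOrder S] [Mul S]

/-- The values at the starts of the edges into cell `(i, j)`. -/
def DPData.src (d : DPData S s r) (i j : ℕ) : AlignMove × Fin r → S × Option (Fin r)
  | (.del, p) => d.V (i - 1) j p
  | (.ins, p) => d.V i (j - 1) p
  | (.sub, p) => d.V (i - 1) (j - 1) p

/-- The values satisfy the recursion, and the lengths of values, scores and counters are bounded.
At the target cell the inherited tag is replaced by the state of the cell itself. -/
structure DPData.Valid (d : DPData S s r) (tie : TieBreak r) (code : S → List Bool) (ℓ b : ℕ) :
    Prop where
  rec_eq : ∀ i ≤ d.a.length, ∀ j ≤ d.b.length, ∀ q, ∃ v,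
    cellValue tie d.tv (d.src i j) (letterBefore d.a i) (letterBefore d.b j) q = some v ∧
      d.V i j q = (v.1, if i = d.ti ∧ j = d.tj then some q else v.2)
  length_tab : ∀ t, (code (d.tv t)).length ≤ ℓ
  length_val : ∀ i ≤ d.a.length, ∀ j ≤ d.b.length, ∀ q, (code (d.V i j q).1).length ≤ ℓ
  length_bits : ∀ i, i ≤ d.a.length ∨ i ≤ d.b.length → (Nat.bits i).length ≤ b

/-- The fields of the rows `c - 1, …, 0`. -/
def downWord (code : S → List Bool) (f : ℕ → S × Option (Fin r)) : ℕ → List (ASym s r M₁ M₂)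
  | 0 => []
  | c + 1 => valField code (f c) ++ downWord code f c

/-- The fields of the rows `c, …, c + k - 1`. -/
def upWord (code : S → List Bool) (f : ℕ → S × Option (Fin r)) : ℕ → ℕ → List (ASym s r M₁ M₂)
  | _, 0 => []
  | c, k + 1 => valField code (f c) ++ upWord code f (c + 1) k

/-- The contents of the stacks in column `j`, when for state `p` the rows below `c p` have been
treated, `e` letters of the first string have been read, the row counter is `i`, the values `cur` of
the current cell have been computed, and `act` marks a target cell. -/
def DPData.mem (d : DPData S s r) (code : S → List Bool) (j : ℕ) (c : Fin r → ℕ) (e i : ℕ)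
    (cur : Fin r → List (ASym s r M₁ M₂)) (act : List (ASym s r M₁ M₂)) :
    Key s r M₁.numTapes M₂.numTapes → List (ASym s r M₁ M₂)
  | .tab t => bitField (code (d.tv t)) .sep
  | .aF => (d.a.drop e).map .letter
  | .aB => ((d.a.take e).map .letter).reverse
  | .col p => if j = 0 then [] else
      upWord code (fun i => d.V i (j - 1) p) (c p) (d.a.length + 1 - c p)
  | .dcol p => if j = 0 then [] else downWord code (fun i => d.V i (j - 1) p) (c p)
  | .ncol p => downWord code (fun i => d.V i j p) (c p)
  | .cur p => cur p
  | .act => act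
  | .ci => bitWord (Nat.bits i)
  | .cj => bitWord (Nat.bits j)
  | .si => bitWord (Nat.bits d.ti)
  | .sj => bitWord (Nat.bits d.tj)
  | _ => []

theorem letterBefore_eq_none {a : List (Fin s)} {i : ℕ} (hi : i ≤ a.length) :
    letterBefore a i = none ↔ i = 0 := by
  cases i with
  | zero => simp [letterBefore]
  | succ i => simp [letterBefore, List.getElem?_eq_getElem (show i < a.length by omega)]

theorem tableIdx_pos {a b : List (Fin s)} {i j : ℕ} {q p : Fin r} {m : AlignMove} {t : TabIdx s r}
    (h : tableIdx (letterBefore a i) (letterBefore b j) q (m, p) = some t) :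
    match m with
    | .del => 0 < i
    | .ins => 0 < j
    | .sub => 0 < i ∧ 0 < j := by
  rcases i with _ | i <;> rcases j with _ | j <;> cases m <;>
    first
    | exact Nat.succ_pos _
    | exact ⟨Nat.succ_pos _, Nat.succ_pos _⟩
    | simp [tableIdx, letterBefore] at h

theorem DPData.cellReady {d : DPData S s r} {tie : TieBreak r} {code : S → List Bool} {ℓ b : ℕ}
    (h : d.Valid tie code ℓ b) {i j : ℕ} (hi : i ≤ d.a.length) (hj : j ≤ d.b.length) (e i' : ℕ)
    (cur : Fin r → List (ASym s r M₁ M₂)) (act : List (ASym s r M₁ M₂)) :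
    CellReady code ℓ d.tv (d.src i j) (letterBefore d.a i) (letterBefore d.b j)
      (d.mem code j (fun _ => i) e i' cur act) where
  tab _ := rfl
  length_tab := h.length_tab
  top_src q k t hk := by
    obtain ⟨m, p⟩ := k
    have := tableIdx_pos hk
    cases m
    · obtain ⟨i, rfl⟩ : ∃ i₀, i = i₀ + 1 := ⟨i - 1, by simp at this; omega⟩
      exact ⟨_, rfl⟩
    · have hj0 : j ≠ 0 := by simp at this; omega
      obtain ⟨c, hc⟩ : ∃ c, d.a.length + 1 - i = c + 1 := ⟨d.a.length - i, by omega⟩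
      exact ⟨upWord code (fun i => d.V i (j - 1) p) (i + 1) c, by
        simp [srcKey, DPData.mem, hj0, hc, upWord, DPData.src]⟩
    · obtain ⟨i, rfl⟩ : ∃ i₀, i = i₀ + 1 := ⟨i - 1, by simp at this; omega⟩
      have hj0 : j ≠ 0 := by simp at this; omega
      exact ⟨downWord code (fun i => d.V i (j - 1) p) i, by
        simp [srcKey, DPData.mem, hj0, downWord, DPData.src]⟩
  length_src q k t hk := by
    obtain ⟨m, p⟩ := k
    cases m <;> exact h.length_val _ (by omega) _ (by omega) _
  cand := rfl
  tmp := rfl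
  mul _ := rfl
  le _ := rfl

/-- Appends the value of the current cell to the new column and advances in the old one, which is
absent in column `0`. -/
def commit (ob : Option (Fin s)) (q : Fin r) : AProg s r M₁ M₂ :=
  .seq (.moveField .tmp (.cur q) (.ncol q) id)
    (if ob = none then .skip else .moveField .tmp (.col q) (.dcol q) id)

/-- Treats one cell. -/
noncomputable def cell (tie : TieBreak r) (oa ob : Option (Fin s)) : AProg s r M₁ M₂ :=
  .seq (.act fun _ k => if k = .act then .push .sep else .keep)
  (.seq (.eqTest .tmp .ci .si .act)
  (.seq (.eqTest .tmp .cj .sj .act)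
  (.seq (.forAll (stateStep tie oa ob) (List.finRange r))
  (.seq (.forAll (commit ob) (List.finRange r))
  (.clear fun k => k = .act)))))

/-- Bound for the time to treat a cell. -/
def cellTime (r b : ℕ) : ℕ := r * stateTime r b + r * (12 * b + 10) + (12 * b + 30)

theorem bits_injective : Function.Injective Nat.bits := by
  intro m n h
  exact Nat.eq_of_testBit_eq fun i => by rw [Nat.testBit_eq_inth, Nat.testBit_eq_inth, h]

/-- The treatment of a cell keeps the invariant `DPData.mem`: the values for all states are computed
before any of them is committed, since a commit changes the tops of the stacks with the values of the
neighbours. -/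
theorem DPData.fast_cell {d : DPData S s r} {tie : TieBreak r} {code : S → List Bool} {ℓ lam b : ℕ}
    (hB : OpBounds M₁ M₂ code ℓ lam b) (h : d.Valid tie code ℓ b) {i j : ℕ} (hi : i ≤ d.a.length)
    (hj : j ≤ d.b.length) (e : ℕ) (σ : AStore s r M₁ M₂) :
    Fast x (cell tie (letterBefore d.a i) (letterBefore d.b j))
      (σ.put (d.mem code j (fun _ => i) e i (fun _ => []) []))
      (σ.put (d.mem code j (fun _ => i + 1) e i (fun _ => []) [])) (cellTime r b) := by
  have hℓ := hB.le_lam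
  have hlam := hB.lam_le
  have hbi := h.length_bits i (.inl hi)
  have hbj := h.length_bits j (.inr hj)
  -- what the two comparisons leave of the mark on `act`
  let A : List (ASym s r M₁ M₂) := if i = d.ti ∧ j = d.tj then [.sep] else []
  have hA : A.head?.isSome = decide (i = d.ti ∧ j = d.tj) := by
    simp only [A]; split_ifs with ht <;> simp [ht]
  let F : ℕ → Fin r → List (ASym s r M₁ M₂) := fun i q => valField code (d.V i j q)
  have e1 := Fast.act (x := x) (fun _ k => if k = .act then .push .sep else .keep)
    (σ.put (d.mem code j (fun _ => i) e i (fun _ => []) []))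
  have e2 := Fast.eqTest (x := x) (tmp := .tmp) (a := .ci) (b := .si) (flag := .act) (Nat.bits i)
    (Nat.bits d.ti) (s := σ.put (d.mem code j (fun _ => i) e i (fun _ => []) [.sep]))
    (by simp) (by simp) (by simp) (by simp) (by simp) (by simp) rfl rfl rfl
  have e3 := Fast.eqTest (x := x) (tmp := .tmp) (a := .cj) (b := .sj) (flag := .act) (Nat.bits j)
    (Nat.bits d.tj) (s := σ.put (d.mem code j (fun _ => i) e i (fun _ => [])
      (if i = d.ti then [.sep] else [])))
    (by simp) (by simp) (by simp) (by simp) (by simp) (by simp) rfl rfl rfl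
  have e4 := Fast.forAll (x := x) (f := stateStep (M₁ := M₁) (M₂ := M₂) tie (letterBefore d.a i)
      (letterBefore d.b j)) (l := List.finRange r) (fun l => σ.put (d.mem code j (fun _ => i) e i
      (fun q => if q ∈ l then F i q else []) A)) (stateTime r b) (by
    intro l₁ q l₂ hl
    have hq : q ∉ l₁ := by
      have := List.nodup_finRange r
      rw [hl, List.nodup_append] at this
      exact fun hm => this.2.2 q hm q (by simp) rfl
    obtain ⟨v, hv, hV⟩ := h.rec_eq i hi j hj q
    refine (fast_stateStep hB tie (DPData.cellReady h hi hj e i _ _) rfl (by simp [DPData.mem, hq])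
      hv).finish (Store.ext rfl (funext fun k => ?_) rfl) le_rfl
    cases k with
    | cur p =>
      by_cases hp : p = q
      · subst hp
        simp [DPData.mem, F, hV, hA]
      · by_cases hp' : p ∈ l₁ <;> simp [DPData.mem, hp, hp']
    | _ => simp [DPData.mem])
  have e5 := Fast.forAll (x := x) (f := commit (M₁ := M₁) (M₂ := M₂) (letterBefore d.b j))
      (l := List.finRange r) (fun l => σ.put (d.mem code j (fun q => if q ∈ l then i + 1 else i) e i
      (fun q => if q ∈ l then [] else F i q) A)) (12 * b + 10) (by
    intro l₁ q l₂ hl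
    have hq : q ∉ l₁ := by
      have := List.nodup_finRange r
      rw [hl, List.nodup_append] at this
      exact fun hm => this.2.2 q hm q (by simp) rfl
    have hlen := h.length_val i hi j hj q
    have m1 := Fast.moveField (x := x) (tmp := .tmp) (src := .cur q) (dst := .ncol q) id
      (code (d.V i j q).1) (.tag (d.V i j q).2) [] (s := σ.put (d.mem (M₁ := M₁) (M₂ := M₂) code j
        (fun q => if q ∈ l₁ then i + 1 else i) e i (fun q => if q ∈ l₁ then [] else F i q) A))
      (by simp) (by simp) (by simp) rfl rfl (by simp [DPData.mem, hq, F, valField])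
    rw [commit]
    rcases Nat.eq_zero_or_pos j with rfl | hj0
    · have hn : letterBefore d.b 0 = none := rfl
      rw [if_pos hn]
      refine (m1.seq (Fast.skip x _)).finish (Store.ext rfl (funext fun k => ?_) rfl) (by omega)
      cases k with
      | cur p =>
        by_cases hp : p = q
        · simp [DPData.mem, hp]
        · by_cases hp' : p ∈ l₁ <;> simp [DPData.mem, hp, hp']
      | ncol p =>
        by_cases hp : p = q
        · simp [DPData.mem, hp, hq, downWord, valField]
        · by_cases hp' : p ∈ l₁ <;> simp [DPData.mem, hp, hp']
      | _ => simp [DPData.mem]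
    · rw [if_neg (by rw [letterBefore_eq_none hj]; omega)]
      have hlen' := h.length_val i hi (j - 1) (by omega) q
      have hk : d.a.length + 1 - i = (d.a.length + 1 - (i + 1)) + 1 := by omega
      have hj1 : j ≠ 0 := by omega
      have m2 := fun (σ' : AStore s r M₁ M₂) h1 h2 => Fast.moveField (x := x) (tmp := .tmp)
        (src := .col q) (dst := .dcol q) id (code (d.V i (j - 1) q).1) (.tag (d.V i (j - 1) q).2)
        (upWord code (fun i => d.V i (j - 1) q) (i + 1) (d.a.length + 1 - (i + 1)))
        (s := σ') (by simp) (by simp) (by simp) rfl h1 h2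
      refine (m1.seq (m2 _ (by simp [DPData.mem]) ?_)).finish
        (Store.ext rfl (funext fun k => ?_) rfl) ?_
      · simp only [Store.set_stk, reduceCtorEq, if_false, DPData.mem, hq, hj1, hk, upWord, valField]
      · cases k with
        | cur p =>
          by_cases hp : p = q
          · simp [DPData.mem, hp]
          · by_cases hp' : p ∈ l₁ <;> simp [DPData.mem, hp, hp']
        | ncol p =>
          by_cases hp : p = q
          · simp [DPData.mem, hp, hq, downWord, valField]
          · by_cases hp' : p ∈ l₁ <;> simp [DPData.mem, hp, hp']
        | col p =>
          by_cases hp : p = q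
          · simp [DPData.mem, hp, hj1]
          · by_cases hp' : p ∈ l₁ <;> simp [DPData.mem, hp, hp']
        | dcol p =>
          by_cases hp : p = q
          · simp [DPData.mem, hp, hq, downWord, valField, hj1]
          · by_cases hp' : p ∈ l₁ <;> simp [DPData.mem, hp, hp']
        | _ => simp [DPData.mem]
      · omega)
  have e6 := Fast.clear (x := x) (fun k => k = .act) 1
    (s := σ.put (d.mem (M₁ := M₁) (M₂ := M₂) code j (fun _ => i + 1) e i (fun _ => []) A)) (by
    rintro k rfl
    change A.length ≤ 1
    simp only [A]
    split_ifs <;> simp)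
  simp only [List.length_finRange, List.not_mem_nil, if_false, List.mem_finRange, if_true] at e4 e5
  refine ((e1.finish ?_ le_rfl).seq ((e2.finish ?_ le_rfl).seq ((e3.finish ?_ le_rfl).seq
    (e4.seq (e5.seq e6))))).finish ?_ ?_
  · refine Store.ext rfl (funext fun k => ?_) rfl
    cases k <;> simp [DPData.mem, StackOp.app]
  · simp only [bits_injective.eq_iff]
    by_cases ht : i = d.ti
    · simp [ht]
    · simp only [ht, if_false]
      refine Store.ext rfl (funext fun k => ?_) rfl
      cases k <;> simp [DPData.mem]
  · simp only [bits_injective.eq_iff]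
    by_cases ht : j = d.tj
    · by_cases ht' : i = d.ti <;> simp [ht, ht', A]
    · simp only [ht, if_false]
      refine Store.ext rfl (funext fun k => ?_) rfl
      cases k <;> simp [DPData.mem, A, ht]
      split_ifs <;> rfl
  · refine Store.ext rfl (funext fun k => ?_) rfl
    cases k <;> simp [DPData.mem]
  · rw [cellTime]; omega

end Run

/-! ### Columns and passes over the grid -/

section Columns

variable {s r : ℕ} {M₁ M₂ : OfflineTM (Option Bool) Bool} {x : List (AlignSym s)}
variable {S : Type*} [LinearOrder S] [Mul S]

/-- The letter that a stack symbol stands for. -/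
def StkSym.letter? {W : Type} : StkSym s r W → Option (Fin s)
  | .letter a => some a
  | _ => none

/-- The letter that an input symbol stands for. -/
def inputLetter : InputRead (AlignSym s) → Option (Fin s)
  | .letter (.letter a) => some a
  | _ => none

/-- The contents of the stacks in column `j` when the rows below `c` have been treated. The row counter
and the position in the first string are those of the last treated row; at `c = 0` the truncated
subtraction gives `0`, as row `0` is treated without reading a letter. -/
def DPData.colMem (d : DPData S s r) (code : S → List Bool) (j c : ℕ) :
    Key s r M₁.numTapes M₂.numTapes → List (ASym s r M₁ M₂) :=
  d.mem code j (fun _ => c) (c - 1) (c - 1) (fun _ => []) []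

omit [LinearOrder S] [Mul S] in
theorem length_downWord_le {code : S → List Bool} {f : ℕ → S × Option (Fin r)} {ℓ c : ℕ}
    (h : ∀ i < c, (code (f i).1).length ≤ ℓ) :
    (downWord code f c : List (ASym s r M₁ M₂)).length ≤ c * (ℓ + 1) := by
  induction c with
  | zero => simp [downWord]
  | succ c ih =>
    have h1 := ih fun i hi => h i (by omega)
    have h2 := h c (by omega)
    rw [downWord, List.length_append, valField, length_bitField, Nat.add_mul]
    omega

omit [LinearOrder S] [Mul S] in
theorem length_upWord_le {code : S → List Bool} {f : ℕ → S × Option (Fin r)} {ℓ c k : ℕ}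
    (h : ∀ i, c ≤ i → i < c + k → (code (f i).1).length ≤ ℓ) :
    (upWord code f c k : List (ASym s r M₁ M₂)).length ≤ k * (ℓ + 1) := by
  induction k generalizing c with
  | zero => simp [upWord]
  | succ k ih =>
    have h1 := ih (c := c + 1) fun i hi hi' => h i (by omega) (by omega)
    have h2 := h c le_rfl (by omega)
    rw [upWord, List.length_append, valField, length_bitField, Nat.add_mul]
    omega

/-- Bound for the heights of the stacks between the treatment of two cells. -/
def memHeight (m ℓ b : ℕ) : ℕ := (m + 1) * (ℓ + 1) + b

theorem DPData.Valid.heightLE_colMem {d : DPData S s r} {tie : TieBreak r} {code : S → List Bool}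
    {ℓ b : ℕ} (h : d.Valid tie code ℓ b) (hi : d.ti ≤ d.a.length) (hj : d.tj ≤ d.b.length)
    {j c : ℕ} (hj' : j ≤ d.b.length) (hc : c ≤ d.a.length + 1) (p : ℕ) (o : List (PathSym r)) :
    (⟨p, d.colMem code j c, o⟩ : AStore s r M₁ M₂).HeightLE (memHeight d.a.length ℓ b) := by
  have hm : d.a.length ≤ (d.a.length + 1) * (ℓ + 1) :=
    (Nat.le_succ _).trans (Nat.le_mul_of_pos_right _ (Nat.succ_pos _))
  have hl : ℓ + 1 ≤ (d.a.length + 1) * (ℓ + 1) := Nat.le_mul_of_pos_left _ (Nat.succ_pos _)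
  have hmul : ∀ k ≤ d.a.length + 1, k * (ℓ + 1) ≤ (d.a.length + 1) * (ℓ + 1) := fun k hk =>
    Nat.mul_le_mul_right _ hk
  have hdown : ∀ j ≤ d.b.length, ∀ q, (downWord code (fun i => d.V i j q) c :
      List (ASym s r M₁ M₂)).length ≤ memHeight d.a.length ℓ b := by
    intro j hj q
    refine (length_downWord_le fun i hi => h.length_val i (by omega) j hj q).trans ?_
    exact (hmul c hc).trans (Nat.le_add_right _ _)
  intro k
  cases k with
  | tab t =>
    have := h.length_tab t
    simp [DPData.colMem, DPData.mem, memHeight]; omega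
  | aF => simp [DPData.colMem, DPData.mem, memHeight]; omega
  | aB => simp [DPData.colMem, DPData.mem, memHeight]; omega
  | col q =>
    simp only [DPData.colMem, DPData.mem]
    split_ifs
    · simp
    · refine (length_upWord_le (ℓ := ℓ) fun i hi hi' =>
        h.length_val i (by omega) _ (by omega) q).trans ?_
      exact (hmul _ (by omega)).trans (Nat.le_add_right _ _)
  | dcol q =>
    simp only [DPData.colMem, DPData.mem]
    split_ifs
    · simp
    · exact hdown (j - 1) (by omega) q
  | ncol q => exact hdown j hj' q
  | ci =>
    have := h.length_bits (c - 1) (.inl (by omega))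
    simp [DPData.colMem, DPData.mem, memHeight]; omega
  | cj =>
    have := h.length_bits j (.inr hj')
    simp [DPData.colMem, DPData.mem, memHeight]; omega
  | si =>
    have := h.length_bits d.ti (.inl hi)
    simp [DPData.colMem, DPData.mem, memHeight]; omega
  | sj =>
    have := h.length_bits d.tj (.inr hj)
    simp [DPData.colMem, DPData.mem, memHeight]; omega
  | _ => simp [DPData.colMem, DPData.mem]

/-- Treats the next row of the current column. -/
noncomputable def rowStep (tie : TieBreak r) (ob : Option (Fin s)) : AProg s r M₁ M₂ :=
  .seq (.inc .tmp .ci)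
  (.case (Option (Fin s)) inferInstance (fun v => (v.top .aF).bind StkSym.letter?) fun oa =>
    .seq (cell tie oa ob)
    (.act fun v k => if k = .aF then .pop else if k = .aB then .push? (v.top .aF) else .keep))

/-- Bound for the time to treat a row. -/
def rowTime (r b : ℕ) : ℕ := cellTime r b + (6 * b + 10)

theorem DPData.fast_rowStep {d : DPData S s r} {tie : TieBreak r} {code : S → List Bool}
    {ℓ lam b : ℕ} (hB : OpBounds M₁ M₂ code ℓ lam b) (h : d.Valid tie code ℓ b) {i j : ℕ}
    (hi : i < d.a.length) (hj : j ≤ d.b.length) (σ : AStore s r M₁ M₂) :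
    Fast x (rowStep tie (letterBefore d.b j)) (σ.put (d.colMem code j (i + 1)))
      (σ.put (d.colMem code j (i + 2))) (rowTime r b) := by
  have hb := h.length_bits i (.inl hi.le)
  have e1 := Fast.inc (x := x) (tmp := .tmp) (a := .ci) i
    (s := σ.put (d.colMem (M₁ := M₁) (M₂ := M₂) code j (i + 1))) (by simp) rfl rfl
  have e2 := d.fast_cell (x := x) hB h (i := i + 1) hi hj i σ
  have e3 := Fast.act (x := x) (fun v k => if k = .aF then .pop else if k = .aB then
    .push? (v.top .aF) else .keep) (σ.put (d.mem (M₁ := M₁) (M₂ := M₂) code j (fun _ => i + 2) i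
      (i + 1) (fun _ => []) []))
  refine ((e1.finish (s' := σ.put (d.mem code j (fun _ => i + 1) i (i + 1) (fun _ => []) [])) ?_
    le_rfl).seq (Runs.case (letterBefore d.a (i + 1)) ?_ (e2.seq e3))).finish ?_ ?_
  · refine Store.ext rfl (funext fun k => ?_) rfl
    cases k <;> simp [mem, colMem]
  · simp [Store.view, mem, letterBefore, hi, StkSym.letter?]
  · refine Store.ext rfl (funext fun k => ?_) rfl
    cases k with
    | aF =>
      simp [mem, colMem, StackOp.app]
    | aB =>
      have hd : d.a.drop i = d.a[i] :: d.a.drop (i + 1) := List.drop_eq_getElem_cons hi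
      have ht : d.a.take (i + 1) = d.a.take i ++ [d.a[i]] := (List.take_append_getElem hi).symm
      simp only [colMem, mem, Store.view, hd, show i + 2 - 1 = i + 1 from rfl, ht, StackOp.push?,
        StackOp.app, List.map_cons, List.head?_cons, List.map_append, List.reverse_append,
        List.map_nil, List.reverse_cons, List.reverse_nil, List.nil_append, List.cons_append,
        reduceCtorEq, if_false, if_true]
    | _ => simp [mem, colMem, StackOp.app]
  · rw [rowTime]; omega

/-- Treats a column. -/
noncomputable def column (tie : TieBreak r) (ob : Option (Fin s)) : AProg s r M₁ M₂ :=
  .seq (cell tie none ob) (.loop (fun v => ((v.top .aF).bind StkSym.letter?).isSome) (rowStep tie ob))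

/-- Bound for the time to treat a column. -/
def colTime (r b m : ℕ) : ℕ := cellTime r b + (m * (rowTime r b + 1) + 1)

/-- The time for a column may not be added to the bound for the heights, since it has a factor `m` in
front of the time of the subroutines. Therefore the invariant gives the heights between two rows, and
only the time of a single row is added. -/
theorem DPData.runs_column {d : DPData S s r} {tie : TieBreak r} {code : S → List Bool}
    {ℓ lam b : ℕ} (hB : OpBounds M₁ M₂ code ℓ lam b) (h : d.Valid tie code ℓ b)
    (hi : d.ti ≤ d.a.length) (hj : d.tj ≤ d.b.length) {j : ℕ} (hj' : j ≤ d.b.length) {H : ℕ}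
    (hH : memHeight d.a.length ℓ b + rowTime r b ≤ H) (σ : AStore s r M₁ M₂) :
    Runs x (Store.HeightLE H) (column tie (letterBefore d.b j)) (σ.put (d.colMem code j 0))
      (σ.put (d.colMem code j (d.a.length + 1))) (colTime r b d.a.length) := by
  have hct : cellTime r b ≤ rowTime r b := Nat.le_add_right _ _
  have e1 := (d.fast_cell (x := x) hB h (i := 0) (by omega) hj' 0 σ).of_fast
    (h := H) (h.heightLE_colMem hi hj hj' (by omega) _ _) (by omega)
  have e2 := Runs.loop_iterate (x := x) (P := Store.HeightLE H)
    (b := fun v => ((v.top .aF).bind StkSym.letter?).isSome)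
    (p := rowStep (M₁ := M₁) (M₂ := M₂) tie (letterBefore d.b j))
    (fun i => σ.put (d.colMem code j (i + 1))) d.a.length (rowTime r b)
    (by intro i hi; simp [Store.view, mem, colMem, hi, StkSym.letter?])
    (by simp [Store.view, mem, colMem])
    (fun i hi' => (d.fast_rowStep hB h hi' hj' σ).of_fast
      (h.heightLE_colMem hi hj hj' (by omega) _ _) (by omega))
  exact e1.seq e2

/-- Moves the new column to the place of the old one, which turns it upside down. -/
def transfer (p : Fin r) : AProg s r M₁ M₂ :=
  .loop (fun v => (v.top (.ncol p)).isSome) (.moveField .tmp (.ncol p) (.col p) id)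

omit [LinearOrder S] [Mul S] in
/-- The fields come out from the last row up, so row `0` ends on top. -/
theorem fast_transfer {code : S → List Bool} {ℓ : ℕ} {f : ℕ → S × Option (Fin r)} (p : Fin r)
    (c : ℕ) : ∀ (k : ℕ) (σ : AStore s r M₁ M₂), (∀ i < c, (code (f i).1).length ≤ ℓ) →
      σ.stk .tmp = [] → σ.stk (.ncol p) = downWord code f c → σ.stk (.col p) = upWord code f c k →
      Fast x (transfer p) σ ((σ.set (.ncol p) []).set (.col p) (upWord code f 0 (c + k)))
        (c * (6 * ℓ + 5) + 1) := by
  induction c with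
  | zero =>
    intro k σ _ _ h1 h2
    refine (Runs.loop_done (by simp [Store.view, h1, downWord])).finish ?_ (by omega)
    rw [Store.set_eq_self (show σ.stk (.ncol p) = [] from h1), Store.set_eq_self (by rw [h2, Nat.zero_add])]
  | succ c ih =>
    intro k σ hℓ ht h1 h2
    have := hℓ c (by omega)
    have e1 := Fast.moveField (x := x) (tmp := .tmp) (src := .ncol p) (dst := .col p) id
      (code (f c).1) (.tag (f c).2) (downWord code f c) (s := σ) (by simp) (by simp) (by simp) rfl
      ht h1
    refine (Runs.loop_more (by simp [Store.view, h1, downWord, valField, bitField]) e1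
      (ih (k + 1) _ (fun i hi => hℓ i (by omega)) (by simpa using ht) (by simp) ?_)).finish ?_ ?_
    · simp [h2, upWord, valField]
    · refine Store.ext rfl (funext fun k' => ?_) rfl
      by_cases h3 : k' = .col p
      · simp [h3, Nat.add_assoc, Nat.add_comm 1 k]
      · by_cases h4 : k' = .ncol p <;> simp [h3, h4]
    · rw [Nat.add_mul]; omega

/-- Prepares the stacks for the next column. -/
noncomputable def nextColumn : AProg s r M₁ M₂ :=
  .seq (.clear fun k => ∃ p, k = .dcol p)
  (.seq (.forAll transfer (List.finRange r))
  (.seq (.shift (fun a => a.letter?.isSome) .aB fun k => k = .aF)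
  (.seq (.clear fun k => k = .ci) (.inc .tmp .cj))))

/-- Bound for the time between two columns. -/
def nextTime (r ℓ b m : ℕ) : ℕ :=
  3 * ((m + 1) * (ℓ + 1)) + (r * ((m + 1) * (6 * ℓ + 5) + 1)) + 3 * m + (9 * b + 20)

theorem DPData.fast_nextColumn {d : DPData S s r} {tie : TieBreak r} {code : S → List Bool}
    {ℓ b : ℕ} (h : d.Valid tie code ℓ b)
    {j : ℕ} (hj : j < d.b.length) (σ : AStore s r M₁ M₂) :
    Fast x nextColumn (σ.put (d.colMem code j (d.a.length + 1)))
      (σ.put (d.colMem code (j + 1) 0)) (nextTime r ℓ b d.a.length) := by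
  have hbi := h.length_bits d.a.length (.inl le_rfl)
  have hbj := h.length_bits j (.inr hj.le)
  set m := d.a.length with hm
  have hℓ : ∀ q, ∀ i < m + 1, (code (d.V i j q).1).length ≤ ℓ := fun q i hi =>
    h.length_val i (by omega) j hj.le q
  have e1 := Fast.clear (x := x) (fun k => ∃ p, k = .dcol p) ((m + 1) * (ℓ + 1))
    (s := σ.put (d.colMem (M₁ := M₁) (M₂ := M₂) code j (m + 1))) (by
      rintro k ⟨p, rfl⟩
      simp only [colMem, mem]
      split_ifs
      · simp
      · exact length_downWord_le fun i hi => h.length_val i (by omega) _ (by omega) p)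
  let G : List (Fin r) → AStore s r M₁ M₂ := fun l => σ.put fun k => match k with
    | .col p => if p ∈ l then upWord code (fun i => d.V i j p) 0 (m + 1) else []
    | .ncol p => if p ∈ l then [] else downWord code (fun i => d.V i j p) (m + 1)
    | .dcol _ => []
    | k => d.colMem code j (m + 1) k
  have e2 := Fast.forAll (x := x) (f := transfer (s := s) (M₁ := M₁) (M₂ := M₂)) (l := List.finRange r) G
    ((m + 1) * (6 * ℓ + 5) + 1) (by
      intro l₁ q l₂ hl
      have hq : q ∉ l₁ := by
        have := List.nodup_finRange r
        rw [hl, List.nodup_append] at this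
        exact fun hm => this.2.2 q hm q (by simp) rfl
      refine (fast_transfer (f := fun i => d.V i j q) q (m + 1) 0 (G l₁) (hℓ q) rfl
        (by simp [G, hq]) (by simp [G, hq, upWord])).finish
        (Store.ext rfl (funext fun k => ?_) rfl) le_rfl
      cases k with
      | col p =>
        by_cases hp : p = q
        · simp [G, hp]
        · by_cases hp' : p ∈ l₁ <;> simp [G, hp, hp']
      | ncol p =>
        by_cases hp : p = q
        · simp [G, hp]
        · by_cases hp' : p ∈ l₁ <;> simp [G, hp, hp']
      | _ => simp [G])
  have e3 := Fast.shift (x := x) (test := fun a : ASym s r M₁ M₂ => a.letter?.isSome) (src := .aB)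
    (fun k => k = .aF) (d.a.map .letter).reverse [] (s := G (List.finRange r))
    (by simp [StkSym.letter?]) rfl (by simp [G, colMem, mem, hm])
  have e4 := fun (σ' : AStore s r M₁ M₂) => Fast.clear (x := x) (fun k => k = .ci) b (s := σ')
  have e5 := Fast.inc (x := x) (tmp := .tmp) (a := .cj) j
    (s := (σ.put (d.colMem (M₁ := M₁) (M₂ := M₂) code (j + 1) 0)).set .cj (bitWord (Nat.bits j)))
    (by simp) (by simp [colMem, mem]) (by simp)
  refine ((e1.finish (s' := G []) ?_ le_rfl).seq (e2.seq (e3.seq (((e4 _ ?_).finish ?_ le_rfl).seq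
    e5)))).finish ?_ ?_
  · refine Store.ext rfl (funext fun k => ?_) rfl
    cases k <;> simp [G, colMem, mem, ← hm, upWord]
  · rintro k rfl
    simpa [G, colMem, mem] using hbi
  · refine Store.ext rfl (funext fun k => ?_) rfl
    cases k <;> simp [G, colMem, mem, ← hm, downWord, bitWord]
  · refine Store.ext rfl (funext fun k => ?_) rfl
    cases k <;> simp [colMem, mem]
  · simp only [List.length_finRange, List.length_reverse, List.length_map, nextTime]
    omega

/-- Moves the input head. -/
def moveHead (m : HeadMove) : AProg s r M₁ M₂ := .op fun _ => { move := m, stk := fun _ => .keep }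

theorem fast_moveHead (m : HeadMove) (p : ℕ)
    (f : Key s r M₁.numTapes M₂.numTapes → List (ASym s r M₁ M₂)) (o : List (PathSym r)) :
    Fast x (moveHead m) ⟨p, f, o⟩ ⟨OfflineTM.moveInput x m p, f, o⟩ 2 := by
  refine (Fast.op (x := x) _ _).finish ?_ le_rfl
  simp [Act.app, StackOp.app]

/-- Treats the column given by the scanned input symbol and moves on. -/
noncomputable def columnHere (tie : TieBreak r) : AProg s r M₁ M₂ :=
  .seq (.case (Option (Fin s)) inferInstance (fun v => inputLetter v.inp) (column tie))
    (moveHead .right)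

/-- Computes all columns, from the separator in front of the second string on. -/
noncomputable def dpPass (tie : TieBreak r) : AProg s r M₁ M₂ :=
  .seq (columnHere tie)
    (.loop (fun v => (inputLetter v.inp).isSome) (.seq nextColumn (columnHere tie)))

/-- Returns to the separator in front of the second string. -/
def rewind : AProg s r M₁ M₂ :=
  .seq (moveHead .left) (.loop (fun v => (inputLetter v.inp).isSome) (moveHead .left))

/-- The second string `b` is the end of the input `x`, its letters are in the cells from `p + 1` on,
and cell `p` holds no letter. -/
structure StringAt (x : List (AlignSym s)) (p : ℕ) (b : List (Fin s)) : Prop where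
  length : x.length = p + b.length
  letter : ∀ j ≤ b.length, inputLetter (OfflineTM.readInput x (p + j)) = letterBefore b j
  atEnd : inputLetter (OfflineTM.readInput x (p + b.length + 1)) = none

theorem StringAt.move_right {p : ℕ} {b : List (Fin s)} (h : StringAt x p b) {j : ℕ}
    (hj : j ≤ b.length) : OfflineTM.moveInput x .right (p + j) = p + (j + 1) := by
  have := h.length
  simp only [OfflineTM.moveInput]; omega

/-- Bound for the time to compute all columns and to return. -/
def passTime (r ℓ b m n : ℕ) : ℕ :=
  colTime r b m + 3 + (n * (nextTime r ℓ b m + (colTime r b m + 3) + 1) + 1)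

/-- A pass starts at the separator in front of the second string, which stands for column `0`, and
ends one cell behind the string. -/
theorem DPData.runs_dpPass {d : DPData S s r} {tie : TieBreak r} {code : S → List Bool}
    {ℓ lam b : ℕ} (hB : OpBounds M₁ M₂ code ℓ lam b) (h : d.Valid tie code ℓ b)
    (hi : d.ti ≤ d.a.length) (hj : d.tj ≤ d.b.length) {p : ℕ} (hx : StringAt x p d.b) {H : ℕ}
    (hH : memHeight d.a.length ℓ b + rowTime r b + nextTime r ℓ b d.a.length ≤ H)
    (o : List (PathSym r)) :
    Runs x (Store.HeightLE H) (dpPass (M₁ := M₁) (M₂ := M₂) tie) ⟨p, d.colMem code 0 0, o⟩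
      ⟨p + d.b.length + 1, d.colMem code d.b.length (d.a.length + 1), o⟩
      (passTime r ℓ b d.a.length d.b.length) := by
  have here : ∀ j ≤ d.b.length, Runs x (Store.HeightLE H) (columnHere (M₁ := M₁) (M₂ := M₂) tie)
      ⟨p + j, d.colMem code j 0, o⟩ ⟨p + (j + 1), d.colMem code j (d.a.length + 1), o⟩
      (colTime r b d.a.length + 3) := by
    intro j hj'
    have e1 := d.runs_column (x := x) hB h hi hj hj' (H := H) (by omega)
      ⟨p + j, fun _ => [], o⟩
    have e2 := (fast_moveHead (x := x) (M₁ := M₁) (M₂ := M₂) .right (p + j)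
      (d.colMem code j (d.a.length + 1)) o).of_fast (h := H)
      (h.heightLE_colMem hi hj hj' le_rfl _ _) (by
        have : 2 ≤ nextTime r ℓ b d.a.length := by rw [nextTime]; omega
        omega)
    rw [hx.move_right hj'] at e2
    exact ((Runs.case (letterBefore d.b j) (by simpa [Store.view] using hx.letter j hj') e1).seq
      e2).mono (by omega)
  have e2 := Runs.loop_iterate (x := x) (P := Store.HeightLE H)
    (b := fun v => (inputLetter v.inp).isSome) (p := .seq nextColumn (columnHere tie))
    (fun j => (⟨p + (j + 1), d.colMem code j (d.a.length + 1), o⟩ : AStore s r M₁ M₂)) d.b.length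
    (nextTime r ℓ b d.a.length + (colTime r b d.a.length + 3))
    (by
      intro j hj'
      simp only [Store.view]
      rw [hx.letter (j + 1) hj', letterBefore, List.getElem?_eq_getElem hj']
      rfl)
    (by simp only [Store.view]; rw [← add_assoc, hx.atEnd]; rfl)
    (fun j hj' => by
      have e3 := (d.fast_nextColumn (x := x) (M₁ := M₁) (M₂ := M₂) h hj'
        ⟨p + (j + 1), fun _ => [], o⟩).of_fast (h := H)
        (h.heightLE_colMem hi hj hj'.le le_rfl _ _) (by omega)
      exact e3.seq (here (j + 1) hj'))
  exact (here 0 (by omega)).seq e2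

theorem runs_rewind {p : ℕ} {b : List (Fin s)} (hx : StringAt x p b) {h₀ H : ℕ} (hH : h₀ + 2 ≤ H)
    {f : Key s r M₁.numTapes M₂.numTapes → List (ASym s r M₁ M₂)} {o : List (PathSym r)}
    (hf : ∀ p, (⟨p, f, o⟩ : AStore s r M₁ M₂).HeightLE h₀) :
    Runs x (Store.HeightLE H) rewind ⟨p + b.length + 1, f, o⟩ ⟨p, f, o⟩ (b.length * 3 + 3) := by
  have e1 := (fast_moveHead (x := x) (M₁ := M₁) (M₂ := M₂) .left (p + b.length + 1) f o).of_fast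
    (h := H) (hf _) hH
  have e2 := Runs.loop_iterate (x := x) (P := Store.HeightLE H)
    (b := fun v => (inputLetter v.inp).isSome) (p := moveHead .left)
    (fun j => (⟨p + (b.length - j), f, o⟩ : AStore s r M₁ M₂)) b.length 2
    (by
      intro j hj
      simp only [Store.view]
      rw [hx.letter _ (by omega), show b.length - j = (b.length - j - 1) + 1 by omega, letterBefore,
        List.getElem?_eq_getElem (by omega)]
      rfl)
    (by
      simp only [Store.view]
      rw [hx.letter _ (by omega), Nat.sub_self]; rfl)
    (fun j hj => by
      have := (fast_moveHead (x := x) (M₁ := M₁) (M₂ := M₂) .left (p + (b.length - j)) f o).of_fast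
        (h := H) (hf _) hH
      have e : OfflineTM.moveInput x .left (p + (b.length - j)) = p + (b.length - (j + 1)) := by
        simp only [OfflineTM.moveInput]; omega
      rwa [e] at this)
  simp only [Nat.sub_self, Nat.sub_zero, Nat.add_zero] at e2
  exact (e1.seq e2).mono (by omega)

end Columns

/-! ### Reporting the canonical path at a target cell -/

/-- A loop that passes through the stores `σ 0, …, σ N` and may go on from there. -/
theorem Runs.loop_prefix {α β K Γ : Type} {x : List α} {P : Store β K Γ → Prop}
    {b : View α K Γ → Bool} {p : Cmd α β K Γ} (σ : ℕ → Store β K Γ) {s' : Store β K Γ} (N T T' : ℕ)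
    (hb : ∀ i < N, b ((σ i).view x) = true) (h : ∀ i < N, Runs x P p (σ i) (σ (i + 1)) T)
    (hN : Runs x P (.loop b p) (σ N) s' T') : Runs x P (.loop b p) (σ 0) s' (N * (T + 1) + T') := by
  induction N generalizing σ with
  | zero => exact hN.mono (by omega)
  | succ N ih =>
    refine (loop_more (hb 0 (by omega)) (h 0 (by omega)) (ih (fun i => σ (i + 1))
      (fun i hi => hb _ (by omega)) (fun i hi => h _ (by omega)) hN)).mono ?_
    rw [Nat.add_mul]; omega

section Rounds

variable {s r : ℕ} {M₁ M₂ : OfflineTM (Option Bool) Bool} {x : List (AlignSym s)}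
variable {S : Type*} [LinearOrder S] [Mul S]

/-- The tag that a stack symbol stands for. -/
def StkSym.tag? {W : Type} : StkSym s r W → Option (Fin r)
  | .tag o => o
  | _ => none

/-- The best one of the values of the given states; the first one wins ties. -/
def selectBest (V : Fin r → S × Option (Fin r)) (l : List (Fin r)) : Option (S × Option (Fin r)) :=
  l.foldl (fun o q => some (better o (V q))) none

/-- Computes the best value among the given states at the end of the new column into `best`. -/
noncomputable def select (l : List (Fin r)) : AProg s r M₁ M₂ :=
  .forAll (fun q => .seq (.copyField .tmp (.ncol q) .cand id fun _ => false) improve) l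

omit [Mul S] in
theorem selectBest_append (V : Fin r → S × Option (Fin r)) (l : List (Fin r)) (q : Fin r) :
    selectBest V (l ++ [q]) = some (better (selectBest V l) (V q)) := by
  simp [selectBest]

omit [Mul S] in
theorem length_selectBest_le {code : S → List Bool} {ℓ : ℕ} {V : Fin r → S × Option (Fin r)}
    (h : ∀ q, (code (V q).1).length ≤ ℓ) (l : List (Fin r)) :
    ∀ u ∈ selectBest V l, (code u.1).length ≤ ℓ := by
  induction l using List.reverseRecOn with
  | nil => simp [selectBest]
  | append_singleton l q ih =>
    rw [selectBest_append]
    rintro u ⟨⟩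
    exact better_length_le ih (h q)

theorem fast_select {code : S → List Bool} {ℓ lam b : ℕ} (hB : OpBounds M₁ M₂ code ℓ lam b)
    {V : Fin r → S × Option (Fin r)} (hV : ∀ q, (code (V q).1).length ≤ ℓ) (l : List (Fin r))
    {σ : AStore s r M₁ M₂} (hn : ∀ q, ∃ rest, σ.stk (.ncol q) = valField code (V q) ++ rest)
    (hc : σ.stk .cand = []) (hb : σ.stk .best = []) (ht : σ.stk .tmp = [])
    (hs : ∀ i, σ.stk (.le i) = []) :
    Fast x (select l) σ (σ.set .best (optField code (selectBest V l)))
      (l.length * (56 * b + 84) + 2) := by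
  have hℓ := hB.le_lam
  have hlam := hB.lam_le
  have key := Fast.forAll (x := x) (f := fun q => (.seq (.copyField .tmp (.ncol q) .cand id fun _ =>
    false) improve : AProg s r M₁ M₂)) (l := l)
    (fun l => σ.set .best (optField code (selectBest V l))) (56 * b + 84) ?_
  · have e : σ.set .best (optField code (selectBest V [])) = σ := Store.set_eq_self hb
    simp only [e] at key
    exact key
  · intro l₁ q l₂ _
    obtain ⟨rest, hr⟩ := hn q
    have hq := hV q
    have hsel := length_selectBest_le hV l₁
    have e1 := Fast.copyField_set (x := x) (tmp := .tmp) (src := .ncol q) (dst := .cand) id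
      (code (V q).1) (.tag (V q).2) rest (s := σ.set .best (optField code (selectBest V l₁)))
      (by simp) (by simp) (by simp) rfl (by simpa using ht) (by
        simp only [Store.set_stk, reduceCtorEq, if_false]; rw [hr]; rfl)
    have e2 := fast_improve (x := x) (code := code) (b := b) (o := selectBest V l₁) (v := V q)
      (σ := (σ.set .best (optField code (selectBest V l₁))).set .cand (valField code (V q)))
      (by omega) (fun u hu => (hsel u hu).trans (hℓ.trans hlam))
      (fun u hu => hB.le _ _ (hq.trans hℓ) ((hsel u hu).trans hℓ)) (by simp) (by simp)
      (by simpa using ht) (by simpa using hs)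
    refine ((e1.finish ?_ le_rfl).seq e2).finish ?_ (by omega)
    · simp [hc, valField]
    · rw [selectBest_append, Store.set_set, Store.set_comm _ (by simp), Store.set_set,
        Store.set_comm _ (by simp), Store.set_eq_self hc]

/-- Writes one symbol on the output tape. -/
def emit (a : PathSym r) : AProg s r M₁ M₂ := .op fun _ => { stk := fun _ => .keep, out := some a }

theorem fast_emit (a : PathSym r) (σ : AStore s r M₁ M₂) :
    Fast x (emit a) σ ⟨σ.pos, σ.stk, σ.out ++ [a]⟩ 2 := by
  refine (Fast.op (x := x) _ _).finish ?_ le_rfl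
  simp [Act.app, StackOp.app, OfflineTM.moveInput]

/-- Writes the bits on the stack `a` on the output tape. -/
def emitBits (a : Key s r M₁.numTapes M₂.numTapes) : AProg s r M₁ M₂ :=
  .seq (.loop (fun v => ((v.top a).bind StkSym.bit?).isSome)
    (.op fun v => {
      stk := fun k => if k = a then .pop else if k = .tmp then .push? (v.top a) else .keep
      out := ((v.top a).bind StkSym.bit?).map PathSym.bit }))
  (.shift StkSym.isBit .tmp fun k => k = a)

theorem fast_emitBits {a : Key s r M₁.numTapes M₂.numTapes} (ha : a ≠ .tmp) (w : List Bool)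
    {σ : AStore s r M₁ M₂} (hw : σ.stk a = bitWord w) (ht : σ.stk .tmp = []) :
    Fast x (emitBits a) σ ⟨σ.pos, σ.stk, σ.out ++ w.map .bit⟩ (6 * w.length + 2) := by
  have key : ∀ (w : List Bool) (σ : AStore s r M₁ M₂), σ.stk a = bitWord w →
      Fast x (.loop (fun v => ((v.top a).bind StkSym.bit?).isSome)
        (.op fun v => {
          stk := fun k => if k = a then .pop else if k = .tmp then .push? (v.top a) else .keep
          out := ((v.top a).bind StkSym.bit?).map PathSym.bit })) σ
        ⟨σ.pos, ((σ.set a []).set .tmp (bitWord w.reverse ++ σ.stk .tmp)).stk,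
          σ.out ++ w.map .bit⟩ (3 * w.length + 1) := by
    intro w
    induction w with
    | nil =>
      intro σ hw
      refine (Runs.loop_done (by simp [Store.view, hw, bitWord])).finish ?_ le_rfl
      have h0 : σ.set a [] = σ := Store.set_eq_self (by rw [hw]; rfl)
      have h1 : σ.set .tmp (bitWord [].reverse ++ σ.stk .tmp) = σ :=
        Store.set_eq_self (by simp [bitWord])
      rw [h0, h1, List.map_nil, List.append_nil]
    | cons c w ih =>
      intro σ hw
      refine (Runs.loop_more (by simp [Store.view, hw, bitWord, StkSym.bit?]) (Fast.op _ _)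
        (ih _ ?_)).finish ?_ ?_
      · simp [Act.app, StackOp.app, hw, bitWord]
      · refine Store.ext ?_ (funext fun k => ?_) ?_
        · simp [Act.app, OfflineTM.moveInput]
        · by_cases h1 : k = .tmp
          · simp [h1, Act.app, StackOp.app, ha.symm, Store.view, hw, bitWord, StackOp.push?]
          · by_cases h2 : k = a
            · subst h2; simp [h1, Act.app, StackOp.app]
            · simp [h1, h2, Act.app, StackOp.app]
        · simp [Act.app, Store.view, hw, bitWord, StkSym.bit?]
      · simp; omega
  refine ((key w σ hw).seq (Fast.shift _ (bitWord w.reverse) [] isBit_of_mem_bitWord rfl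
    (by simp [ht]))).finish ?_ ?_
  · refine Store.ext rfl (funext fun k => ?_) rfl
    by_cases h1 : k = .tmp
    · simp [h1, ht]
    · by_cases h2 : k = a
      · simp [h2, ha, hw, bitWord]
      · simp [h1, h2]
  · simp; omega

/-- How the vertex `(i, j, q)` is written. -/
def targetWord (i j : ℕ) (q : Fin r) : List (PathSym r) :=
  (Nat.bits i).map .bit ++ .sep :: (Nat.bits j).map .bit ++ [.sep, .state q]

/-- Writes the target cell with state `q` on the output tape. -/
def emitTarget (q : Fin r) : AProg s r M₁ M₂ :=
  .seq (emitBits .si) (.seq (emit .sep) (.seq (emitBits .sj) (.seq (emit .sep) (emit (.state q)))))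

/-- Writes the vertex in which the canonical path passes through the target cell, if it does so. -/
noncomputable def report (l : List (Fin r)) : AProg s r M₁ M₂ :=
  .seq (select l)
  (.seq (.shift StkSym.isBit .best fun _ => false)
  (.seq (.case (Option (Fin r)) inferInstance (fun v => (v.top .best).bind StkSym.tag?) fun
    | none => .skip
    | some q => emitTarget q)
  (.clear fun k => k = .best)))

/-- What is written for a target cell, given the tag of the best final value. -/
def tagWord (i j : ℕ) : Option (Fin r) → List (PathSym r)
  | none => []
  | some q => targetWord i j q

/-- Bound for the time of a report. -/
def reportTime (n b : ℕ) : ℕ := n * (56 * b + 84) + (15 * b + 30)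

theorem fast_report {code : S → List Bool} {ℓ lam b : ℕ} (hB : OpBounds M₁ M₂ code ℓ lam b)
    {V : Fin r → S × Option (Fin r)} (hV : ∀ q, (code (V q).1).length ≤ ℓ) {l : List (Fin r)}
    {v : S × Option (Fin r)} (hv : selectBest V l = some v) {i j : ℕ}
    (hi : (Nat.bits i).length ≤ b) (hj : (Nat.bits j).length ≤ b)
    {σ : AStore s r M₁ M₂} (hn : ∀ q, ∃ rest, σ.stk (.ncol q) = valField code (V q) ++ rest)
    (hc : σ.stk .cand = []) (hb : σ.stk .best = []) (ht : σ.stk .tmp = [])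
    (hs : ∀ i, σ.stk (.le i) = []) (hsi : σ.stk .si = bitWord (Nat.bits i))
    (hsj : σ.stk .sj = bitWord (Nat.bits j)) :
    Fast x (report l) σ ⟨σ.pos, σ.stk, σ.out ++ tagWord i j v.2⟩ (reportTime l.length b) := by
  have hℓ := hB.le_lam
  have hlam := hB.lam_le
  have hlen := length_selectBest_le hV l v hv
  have e1 := fast_select (x := x) hB hV l hn hc hb ht hs
  rw [hv] at e1
  have e2 := Fast.shift (x := x) (test := StkSym.isBit) (src := .best) (fun _ => false)
    (bitWord (code v.1)) [.tag v.2] (s := σ.set .best (optField code (some v)))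
    isBit_of_mem_bitWord rfl (by simp [optField, valField, bitField])
  have e3 : ∀ τ : AStore s r M₁ M₂, τ.stk = (σ.set .best [.tag v.2]).stk →
      Fast x ((fun | none => .skip | some q => emitTarget q : Option (Fin r) → AProg s r M₁ M₂) v.2) τ
        ⟨τ.pos, τ.stk, τ.out ++ tagWord i j v.2⟩ (12 * b + 12) := by
    intro τ hτ
    cases v.2 with
    | none =>
      refine (Fast.skip x τ).finish ?_ (by omega)
      simp [tagWord]
    | some q =>
      refine (Runs.seq (fast_emitBits (by simp) (Nat.bits i) (by simp [hτ, hsi]) (by simp [hτ, ht]))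
        (Runs.seq (fast_emit _ _) (Runs.seq (fast_emitBits (by simp) (Nat.bits j) (by simp [hτ, hsj])
          (by simp [hτ, ht])) (Runs.seq (fast_emit _ _) (fast_emit _ _))))).finish ?_ (by omega)
      simp [tagWord, targetWord]
  have e4 := fun τ : AStore s r M₁ M₂ => Fast.clear (x := x) (fun k => k = .best) 1 (s := τ)
  refine (e1.seq ((e2.finish (s' := σ.set .best [.tag v.2]) ?_ le_rfl).seq
    ((Runs.case v.2 ?_ (e3 _ rfl)).seq (e4 _ ?_)))).finish ?_ ?_
  · refine Store.ext rfl (funext fun k => ?_) rfl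
    by_cases h : k = .best <;> simp [h]
  · simp [Store.view, StkSym.tag?]
  · rintro k rfl; simp
  · refine Store.ext rfl (funext fun k => ?_) rfl
    by_cases h : k = .best <;> simp [h, hb]
  · simp only [length_bitWord, reportTime]; omega

/-! ### All targets, one after the other -/

/-- Sets the counters of the target to the next cell, or raises `fin` at the last cell, and
prepares the stacks for another pass. -/
noncomputable def advance : AProg s r M₁ M₂ :=
  .seq (.act fun _ k => if k = .act then .push .sep else .keep)
  (.seq (.eqTest .tmp .ci .si .act)
  (.seq (.case Bool inferInstance (fun v => (v.top .act).isSome) fun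
    | false => .inc .tmp .si
    | true => .seq (.clear fun k => k = .si) (.seq (.eqTest .tmp .cj .sj .act)
      (.case Bool inferInstance (fun v => (v.top .act).isSome) fun
      | false => .inc .tmp .sj
      | true => .act fun _ k => if k = .fin then .push .sep else .keep)))
  (.seq (.clear fun k => (∃ p, k = .ncol p ∨ k = .dcol p) ∨ k = .ci ∨ k = .cj ∨ k = .act)
  (.shift (fun a => a.letter?.isSome) .aB fun k => k = .aF))))

/-- Bound for the time to go to the next target. -/
def advanceTime (m ℓ b : ℕ) : ℕ := 3 * memHeight m ℓ b + 3 * m + (24 * b + 30)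

/-- After a pass the counters `ci`, `cj` hold the coordinates of the last cell, and the target is
compared with them. If the target was the last cell, only the flag `fin` matters, which ends the
program. -/
theorem DPData.fast_advance {d : DPData S s r} {tie : TieBreak r} {code : S → List Bool}
    {ℓ b : ℕ} (h : d.Valid tie code ℓ b) (hi : d.ti ≤ d.a.length)
    (hj : d.tj ≤ d.b.length) (p : ℕ) (o : List (PathSym r)) :
    ∃ f : Key s r M₁.numTapes M₂.numTapes → List (ASym s r M₁ M₂),
      Fast x advance ⟨p, d.colMem code d.b.length (d.a.length + 1), o⟩ ⟨p, f, o⟩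
        (advanceTime d.a.length ℓ b) ∧
      (d.ti ≠ d.a.length → f = ({ d with ti := d.ti + 1 } : DPData S s r).colMem code 0 0) ∧
      (d.ti = d.a.length → d.tj ≠ d.b.length →
        f = ({ d with ti := 0, tj := d.tj + 1 } : DPData S s r).colMem code 0 0) ∧
      (d.ti = d.a.length → d.tj = d.b.length → f .fin ≠ []) := by
  set m := d.a.length with hm
  set n := d.b.length with hn
  have hbm := h.length_bits m (.inl le_rfl)
  have hbn := h.length_bits n (.inr le_rfl)
  have hbi := h.length_bits d.ti (.inl hi)
  have hbj := h.length_bits d.tj (.inr hj)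
  -- the memory after the counters of the target have been changed
  let G : List (ASym s r M₁ M₂) → List (ASym s r M₁ M₂) → List (ASym s r M₁ M₂) →
      List (ASym s r M₁ M₂) → Key s r M₁.numTapes M₂.numTapes → List (ASym s r M₁ M₂) :=
    fun si sj act fin k => match k with
      | .si => si
      | .sj => sj
      | .act => act
      | .fin => fin
      | k => d.colMem code n (m + 1) k
  have hG : ∀ si sj act fin, act.length ≤ 1 → Fast x (.seq (.clear fun k => (∃ p, k = .ncol p ∨ k = .dcol p) ∨
      k = .ci ∨ k = .cj ∨ k = .act) (.shift (fun a => a.letter?.isSome) .aB fun k => k = .aF) :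
      AProg s r M₁ M₂) ⟨p, G si sj act fin, o⟩ ⟨p, fun k => match k with
        | .si => si
        | .sj => sj
        | .fin => fin
        | k => d.colMem code 0 0 k, o⟩ (3 * memHeight m ℓ b + 3 * m + 6) := by
    intro si sj act fin hact
    have hH := h.heightLE_colMem (M₁ := M₁) (M₂ := M₂) hi hj (j := n) (c := m + 1) le_rfl le_rfl p o
    have e1 := Fast.clear (x := x) (fun k => (∃ p, k = .ncol p ∨ k = .dcol p) ∨
      k = .ci ∨ k = .cj ∨ k = .act) (memHeight m ℓ b + 1) (s := ⟨p, G si sj act fin, o⟩) (by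
        rintro k (⟨p, rfl | rfl⟩ | rfl | rfl | rfl)
        · have := (hH (.ncol p)); exact this.trans (Nat.le_succ _)
        · have := (hH (.dcol p)); exact this.trans (Nat.le_succ _)
        · have := (hH .ci); exact this.trans (Nat.le_succ _)
        · have := (hH .cj); exact this.trans (Nat.le_succ _)
        · simp only [G]; omega)
    refine (Runs.seq e1 (Fast.shift _ (d.a.map .letter).reverse [] (by simp [StkSym.letter?]) rfl
      (by simp [G, colMem, mem, hm]))).finish ?_ ?_
    · refine Store.ext rfl (funext fun k => ?_) rfl
      cases k with
      | col q =>
        simp only [G, colMem, mem, reduceCtorEq, ← hm, Nat.sub_self]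
        simp [upWord]
      | _ => simp [G, colMem, mem, ← hm, downWord, bitWord]
    · simp [← hm]; omega
  have e1 := Fast.act (x := x) (fun _ k => if k = .act then .push .sep else .keep)
    (⟨p, d.colMem code n (m + 1), o⟩ : AStore s r M₁ M₂)
  have e2 := Fast.eqTest (x := x) (tmp := .tmp) (a := .ci) (b := .si) (flag := .act) (Nat.bits m)
    (Nat.bits d.ti) (s := ⟨p, G (bitWord (Nat.bits d.ti)) (bitWord (Nat.bits d.tj)) [.sep] [], o⟩)
    (by simp) (by simp) (by simp) (by simp) (by simp) (by simp) rfl rfl rfl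
  have e12 := e1.finish (s' := ⟨p, G (bitWord (Nat.bits d.ti)) (bitWord (Nat.bits d.tj)) [.sep] [],
    o⟩) (Store.ext rfl (funext fun k => by cases k <;> simp [G, StackOp.app, colMem, mem]) rfl) le_rfl
  simp only [bits_injective.eq_iff] at e2
  by_cases hti : m = d.ti
  · rw [if_pos hti] at e2
    have e3 := Fast.clear (x := x) (fun k => k = .si) b (s := (⟨p, G (bitWord (Nat.bits d.ti))
      (bitWord (Nat.bits d.tj)) [.sep] [], o⟩ : AStore s r M₁ M₂)) (by
        rintro k rfl; simpa [G] using hbi)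
    have e4 := Fast.eqTest (x := x) (tmp := .tmp) (a := .cj) (b := .sj) (flag := .act) (Nat.bits n)
      (Nat.bits d.tj) (s := ⟨p, G [] (bitWord (Nat.bits d.tj)) [.sep] [], o⟩)
      (by simp) (by simp) (by simp) (by simp) (by simp) (by simp) rfl rfl rfl
    have e34 := e3.finish (s' := ⟨p, G [] (bitWord (Nat.bits d.tj)) [.sep] [], o⟩)
      (Store.ext rfl (funext fun k => by cases k <;> simp [G]) rfl) le_rfl
    simp only [bits_injective.eq_iff] at e4
    by_cases htj : n = d.tj
    · rw [if_pos htj] at e4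
      have e5 := Fast.act (x := x) (fun _ k => if k = .fin then .push .sep else .keep)
        (⟨p, G [] (bitWord (Nat.bits d.tj)) [.sep] [], o⟩ : AStore s r M₁ M₂)
      have e56 := e5.finish (s' := ⟨p, G [] (bitWord (Nat.bits d.tj)) [.sep] [.sep], o⟩)
        (Store.ext rfl (funext fun k => by cases k <;> simp [G, StackOp.app]) rfl) le_rfl
      refine ⟨_, (e12.seq (e2.seq ((Runs.case true rfl (e34.seq (e4.seq (Runs.case true rfl
        e56)))).seq (hG [] (bitWord (Nat.bits d.tj)) [.sep] [.sep] (by simp))))).mono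
        (by rw [advanceTime]; omega), fun h => absurd hti.symm h, fun _ h => absurd htj.symm h,
        fun _ _ => by simp⟩
    · rw [if_neg htj] at e4
      have e5 := Fast.inc (x := x) (tmp := .tmp) (a := .sj) d.tj
        (s := ⟨p, G [] (bitWord (Nat.bits d.tj)) [] [], o⟩) (by simp) rfl rfl
      have e56 := e5.finish (s' := ⟨p, G [] (bitWord (Nat.bits (d.tj + 1))) [] [], o⟩)
        (Store.ext rfl (funext fun k => by cases k <;> simp [G]) rfl) le_rfl
      have e45 := e4.finish (s' := ⟨p, G [] (bitWord (Nat.bits d.tj)) [] [], o⟩)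
        (Store.ext rfl (funext fun k => by cases k <;> simp [G]) rfl) le_rfl
      refine ⟨_, (e12.seq (e2.seq ((Runs.case true rfl (e34.seq (e45.seq (Runs.case false rfl
        e56)))).seq (hG [] (bitWord (Nat.bits (d.tj + 1))) [] [] (by simp))))).mono
        (by rw [advanceTime]; omega), fun h => absurd hti.symm h, fun _ _ => ?_,
        fun _ h => absurd h.symm htj⟩
      funext k
      cases k <;> simp [colMem, mem, bitWord, downWord]
  · rw [if_neg hti] at e2
    have e5 := Fast.inc (x := x) (tmp := .tmp) (a := .si) d.ti
      (s := ⟨p, G (bitWord (Nat.bits d.ti)) (bitWord (Nat.bits d.tj)) [] [], o⟩) (by simp) rfl rfl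
    have e56 := e5.finish (s' := ⟨p, G (bitWord (Nat.bits (d.ti + 1))) (bitWord (Nat.bits d.tj)) []
      [], o⟩) (Store.ext rfl (funext fun k => by cases k <;> simp [G]) rfl) le_rfl
    have e25 := e2.finish (s' := ⟨p, G (bitWord (Nat.bits d.ti)) (bitWord (Nat.bits d.tj)) [] [], o⟩)
      (Store.ext rfl (funext fun k => by cases k <;> simp [G]) rfl) le_rfl
    refine ⟨_, (e12.seq (e25.seq ((Runs.case false rfl e56).seq (hG (bitWord (Nat.bits (d.ti + 1)))
      (bitWord (Nat.bits d.tj)) [] [] (by simp))))).mono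
      (by rw [advanceTime]; omega), fun _ => ?_, fun h => absurd h.symm hti,
      fun h => absurd h.symm hti⟩
    funext k
    cases k <;> simp [colMem, mem, bitWord, downWord]

end Rounds

section Main

variable {s r : ℕ} {M₁ M₂ : OfflineTM (Option Bool) Bool} {x : List (AlignSym s)}
variable {S : Type*} [LinearOrder S] [Mul S]

/-- One run of the dynamic program for the current target, its report, and the next target. -/
noncomputable def targetRound (tie : TieBreak r) (l : List (Fin r)) : AProg s r M₁ M₂ :=
  .seq (dpPass tie) (.seq rewind (.seq (report l) advance))

/-- Bound for the heights of the stacks during a round. -/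
def roundHeight (r ℓ b m l : ℕ) : ℕ :=
  memHeight m ℓ b + rowTime r b + nextTime r ℓ b m + reportTime l b + advanceTime m ℓ b + 2

/-- Bound for the time of a round. -/
def roundTime (r ℓ b m n l : ℕ) : ℕ :=
  passTime r ℓ b m n + (n * 3 + 3) + reportTime l b + advanceTime m ℓ b

/-- A round writes the tag word of the best final value and leaves the stacks as the next round needs
them; at the last target it raises `fin`. -/
theorem DPData.runs_round {d : DPData S s r} {tie : TieBreak r} {code : S → List Bool}
    {ℓ lam b : ℕ} (hB : OpBounds M₁ M₂ code ℓ lam b) (h : d.Valid tie code ℓ b)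
    (hi : d.ti ≤ d.a.length) (hj : d.tj ≤ d.b.length) {p : ℕ} (hx : StringAt x p d.b)
    {l : List (Fin r)} {v : S × Option (Fin r)}
    (hv : selectBest (d.V d.a.length d.b.length) l = some v) (o : List (PathSym r)) :
    ∃ f : Key s r M₁.numTapes M₂.numTapes → List (ASym s r M₁ M₂),
      Runs x (Store.HeightLE (roundHeight r ℓ b d.a.length l.length)) (targetRound tie l)
        ⟨p, d.colMem code 0 0, o⟩ ⟨p, f, o ++ tagWord d.ti d.tj v.2⟩
        (roundTime r ℓ b d.a.length d.b.length l.length) ∧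
      (d.ti ≠ d.a.length → f = ({ d with ti := d.ti + 1 } : DPData S s r).colMem code 0 0) ∧
      (d.ti = d.a.length → d.tj ≠ d.b.length →
        f = ({ d with ti := 0, tj := d.tj + 1 } : DPData S s r).colMem code 0 0) ∧
      (d.ti = d.a.length → d.tj = d.b.length → f .fin ≠ []) := by
  have hh := fun p o => h.heightLE_colMem (M₁ := M₁) (M₂ := M₂) hi hj (j := d.b.length)
    (c := d.a.length + 1) le_rfl le_rfl p o
  obtain ⟨f, hf, h1, h2, h3⟩ := d.fast_advance (x := x) (M₁ := M₁) (M₂ := M₂) h hi hj p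
    (o ++ tagWord d.ti d.tj v.2)
  refine ⟨f, ?_, h1, h2, h3⟩
  have e1 := d.runs_dpPass hB h hi hj hx (H := roundHeight r ℓ b d.a.length l.length)
    (by rw [roundHeight]; omega) o
  have e2 := runs_rewind hx (H := roundHeight r ℓ b d.a.length l.length)
    (by rw [roundHeight]; omega) (fun p => hh p o)
  have e3 := (fast_report (x := x) hB (V := d.V d.a.length d.b.length) (l := l)
    (fun q => h.length_val _ le_rfl _ le_rfl q) hv (h.length_bits _ (.inl hi))
    (h.length_bits _ (.inr hj)) (σ := ⟨p, d.colMem code d.b.length (d.a.length + 1), o⟩)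
    (fun q => ⟨_, rfl⟩) rfl rfl rfl (fun _ => rfl) rfl rfl).of_fast
    (h := roundHeight r ℓ b d.a.length l.length) (hh p o) (by rw [roundHeight]; omega)
  have e4 := hf.of_fast (h := roundHeight r ℓ b d.a.length l.length) (hh p _)
    (by rw [roundHeight]; omega)
  exact (e1.seq (e2.seq (e3.seq e4))).mono (by rw [roundTime]; omega)

/-- The runs of the dynamic program for all targets; the cells are enumerated column by column. -/
def targetRun (a b : List (Fin s)) (tv : TabIdx s r → S)
    (V : ℕ → ℕ → ℕ → Fin r → S × Option (Fin r)) (k : ℕ) : DPData S s r :=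
  ⟨a, b, tv, V k, k % (a.length + 1), k / (a.length + 1)⟩

/-- Treats all targets. -/
noncomputable def allRounds (tie : TieBreak r) (l : List (Fin r)) : AProg s r M₁ M₂ :=
  .loop (fun v => (v.top .fin).isNone) (targetRound tie l)

theorem div_mod_succ (k m : ℕ) :
    (k % (m + 1) ≠ m → (k + 1) % (m + 1) = k % (m + 1) + 1 ∧ (k + 1) / (m + 1) = k / (m + 1)) ∧
    (k % (m + 1) = m → (k + 1) % (m + 1) = 0 ∧ (k + 1) / (m + 1) = k / (m + 1) + 1) := by
  have h := Nat.div_add_mod k (m + 1)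
  have hpos : 0 < m + 1 := by omega
  have hlt := Nat.mod_lt k hpos
  refine ⟨fun hk => ?_, fun hk => ?_⟩
  · exact ((Nat.div_mod_unique hpos).2 ⟨by omega, by omega⟩).symm
  · exact ((Nat.div_mod_unique hpos).2 ⟨by rw [Nat.mul_add]; omega, by omega⟩).symm

omit [LinearOrder S] [Mul S] in
/-- Before the first column, the memory does not depend on the values of the program. -/
theorem colMem_zero_congr {d d' : DPData S s r} {code : S → List Bool} (ha : d.a = d'.a)
    (ht : d.tv = d'.tv) (hi : d.ti = d'.ti) (hj : d.tj = d'.tj) :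
    (d.colMem code 0 0 : Key s r M₁.numTapes M₂.numTapes → List (ASym s r M₁ M₂)) =
      d'.colMem code 0 0 := by
  funext k
  cases k <;> simp [DPData.colMem, DPData.mem, downWord, ha, ht, hi, hj]

/-- The reports are written for the targets in column order. All rounds but the last one end in the
initial memory of the next one, and the last one raises `fin`. -/
theorem runs_allRounds {a b' : List (Fin s)} {tv : TabIdx s r → S}
    {V : ℕ → ℕ → ℕ → Fin r → S × Option (Fin r)} {tie : TieBreak r} {code : S → List Bool}
    {ℓ lam b : ℕ} (hB : OpBounds M₁ M₂ code ℓ lam b)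
    (h : ∀ k < (a.length + 1) * (b'.length + 1), (targetRun a b' tv V k).Valid tie code ℓ b)
    {p : ℕ} (hx : StringAt x p b') {l : List (Fin r)} {v : ℕ → S × Option (Fin r)}
    (hv : ∀ k < (a.length + 1) * (b'.length + 1),
      selectBest (V k a.length b'.length) l = some (v k)) :
    ∃ s', s'.out = ((List.range ((a.length + 1) * (b'.length + 1))).flatMap fun k =>
        tagWord (k % (a.length + 1)) (k / (a.length + 1)) (v k).2) ∧
      Runs x (Store.HeightLE (roundHeight r ℓ b a.length l.length))
        (allRounds (M₁ := M₁) (M₂ := M₂) tie l) ⟨p, (targetRun a b' tv V 0).colMem code 0 0, []⟩ s'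
        ((a.length + 1) * (b'.length + 1) * (roundTime r ℓ b a.length b'.length l.length + 1) + 1) := by
  set m := a.length with hm
  set n := b'.length with hn
  have hlast : (m + 1) * (n + 1) = (m + n + m * n) + 1 := by ring
  have hmod : ∀ k, k % (m + 1) ≤ m := fun k => Nat.lt_succ_iff.1 (Nat.mod_lt k (Nat.succ_pos m))
  have hdiv : ∀ k < (m + 1) * (n + 1), k / (m + 1) ≤ n := fun k hk =>
    Nat.lt_succ_iff.1 (Nat.div_lt_of_lt_mul hk)
  have hround := fun k (hk : k < (m + 1) * (n + 1)) o =>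
    (targetRun a b' tv V k).runs_round (x := x) hB (h k hk) (hmod k) (hdiv k hk) hx (hv k hk) o
  let out : ℕ → List (PathSym r) := fun N =>
    (List.range N).flatMap fun k => tagWord (k % (m + 1)) (k / (m + 1)) (v k).2
  have hout : ∀ k, out (k + 1) = out k ++ tagWord (k % (m + 1)) (k / (m + 1)) (v k).2 := by
    intro k
    simp only [out, List.range_succ, List.flatMap_append, List.flatMap_singleton]
  obtain ⟨f, hf, -, -, h3⟩ := hround (m + n + m * n) (by omega) (out (m + n + m * n))
  have hN : (m + n + m * n) = (m + 1) * n + m := by ring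
  have hNm : (m + n + m * n) / (m + 1) = n ∧ (m + n + m * n) % (m + 1) = m :=
    (Nat.div_mod_unique (by omega)).2 ⟨by rw [hN]; ring, by omega⟩
  refine ⟨_, ?_, (Runs.loop_prefix (fun k => (⟨p, (targetRun a b' tv V k).colMem code 0 0, out k⟩ :
    AStore s r M₁ M₂)) (m + n + m * n) (roundTime r ℓ b m n l.length) _ (fun k _ => rfl)
    (fun k hk => ?_) (Runs.loop_more rfl hf (Runs.loop_done ?_))).mono ?_⟩
  · rw [hlast]
    exact (hout _).symm
  · obtain ⟨f', hf', h1', h2', -⟩ := hround k (by omega) (out k)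
    have e : f' = (targetRun a b' tv V (k + 1)).colMem code 0 0 := by
      by_cases hk' : k % (m + 1) = m
      · obtain ⟨g1, g2⟩ := (div_mod_succ k m).2 hk'
        rw [h2' hk' ?_]
        · exact colMem_zero_congr rfl rfl g1.symm g2.symm
        · change k / (m + 1) ≠ n
          intro hkn
          have := Nat.div_add_mod k (m + 1)
          rw [hk', hkn] at this
          omega
      · obtain ⟨g1, g2⟩ := (div_mod_succ k m).1 hk'
        rw [h1' hk']
        exact colMem_zero_congr rfl rfl g1.symm g2.symm
    rw [hout k, ← e]
    exact hf'
  · have := h3 hNm.2 hNm.1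
    simp only [Store.view]
    cases hfin : f .fin with
    | nil => exact absurd hfin this
    | cons => rfl
  · have : (roundTime r ℓ b (targetRun a b' tv V (m + n + m * n)).a.length
      (targetRun a b' tv V (m + n + m * n)).b.length l.length) = roundTime r ℓ b m n l.length := rfl
    rw [this, hlast, Nat.add_mul (m + n + m * n) 1]
    omega

/-! ### Reading the input -/

/-- The bit that an input symbol stands for. -/
def inputBit : InputRead (AlignSym s) → Option Bool
  | .letter (.bit c) => some c
  | _ => none

theorem readInput_append (u w : List (AlignSym s)) (c : AlignSym s) :
    OfflineTM.readInput (u ++ c :: w) (u.length + 1) = .letter c := by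
  simp [OfflineTM.readInput]

theorem moveInput_append (u w : List (AlignSym s)) (c : AlignSym s) :
    OfflineTM.moveInput (u ++ c :: w) .right (u.length + 1) = (u ++ [c]).length + 1 := by
  simp [OfflineTM.moveInput]

/-- Reads symbols of one kind and pushes them on a stack. -/
def readWhile (get : InputRead (AlignSym s) → Option (ASym s r M₁ M₂))
    (dst : Key s r M₁.numTapes M₂.numTapes) : AProg s r M₁ M₂ :=
  .loop (fun v => (get v.inp).isSome)
    (.op fun v => { move := .right, stk := fun k => if k = dst then .push? (get v.inp) else .keep })

theorem fast_readWhile {ι : Type} (f : ι → AlignSym s) (g : ι → ASym s r M₁ M₂)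
    {get : InputRead (AlignSym s) → Option (ASym s r M₁ M₂)}
    (hget : ∀ c, get (.letter (f c)) = some (g c)) {z : AlignSym s} (hz : get (.letter z) = none)
    (dst : Key s r M₁.numTapes M₂.numTapes) (c : List ι) (w : List (AlignSym s)) :
    ∀ (u : List (AlignSym s)) (σ : AStore s r M₁ M₂), σ.pos = u.length + 1 →
      Fast (u ++ c.map f ++ z :: w) (readWhile get dst) σ
        ⟨(u ++ c.map f).length + 1, (σ.set dst ((c.map g).reverse ++ σ.stk dst)).stk, σ.out⟩
        (3 * c.length + 1) := by
  induction c with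
  | nil =>
    intro u σ hp
    refine (Runs.loop_done ?_).finish ?_ le_rfl
    · simp only [Store.view, hp, List.map_nil, List.append_nil, readInput_append, hz]; rfl
    · have h0 : σ.set dst (([].map g).reverse ++ σ.stk dst) = σ := Store.set_eq_self (by simp)
      rw [h0]
      exact Store.ext (by simp [hp]) rfl rfl
  | cons a c ih =>
    intro u σ hp
    have e : u ++ (a :: c).map f ++ z :: w = (u ++ [f a]) ++ c.map f ++ z :: w := by simp
    have e' : u ++ (a :: c).map f ++ z :: w = u ++ f a :: (c.map f ++ z :: w) := by simp
    have hr : OfflineTM.readInput (u ++ (a :: c).map f ++ z :: w) σ.pos = .letter (f a) := by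
      rw [e', hp, readInput_append]
    have h2 := ih (u ++ [f a]) (⟨(u ++ [f a]).length + 1, (σ.set dst (g a :: σ.stk dst)).stk, σ.out⟩)
      rfl
    rw [← e] at h2
    refine (Runs.loop_more ?_ ((Fast.op _ _).finish ?_ le_rfl) h2).finish ?_ ?_
    · simp only [Store.view, hr, hget]; rfl
    · refine Store.ext ?_ (funext fun k => ?_) ?_
      · simp only [Act.app, e', hp, moveInput_append]
      · by_cases h : k = dst
        · subst h; simp only [Act.app, Store.view, hr, hget, StackOp.push?, StackOp.app, if_true,
            Store.set_stk]
        · simp [Act.app, h, StackOp.app]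
      · simp [Act.app]
    · refine Store.ext (by simp) (funext fun k => ?_) rfl
      by_cases h : k = dst <;> simp [h]
    · simp; omega

/-- Reads an entry of the score table. -/
noncomputable def loadEntry (t : TabIdx s r) : AProg s r M₁ M₂ :=
  .seq (.clear fun k => k = .tab t)
  (.seq (readWhile (fun c => (inputBit c).map .bit) .tmp)
  (.seq (.op fun _ => { move := .right, stk := fun k => if k = .tab t then .push .sep else .keep })
  (.shift StkSym.isBit .tmp fun k => k = .tab t)))

theorem fast_loadEntry (t : TabIdx s r) (c : List Bool) (u w : List (AlignSym s))
    {σ : AStore s r M₁ M₂} (hp : σ.pos = u.length + 1) (ht : σ.stk .tmp = []) {N : ℕ}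
    (hN : (σ.stk (.tab t)).length ≤ N) :
    Fast (u ++ field c ++ w) (loadEntry t) σ
      ⟨(u ++ field c).length + 1, (σ.set (.tab t) (bitField c .sep)).stk, σ.out⟩
      (3 * N + 6 * c.length + 5) := by
  have hx : u ++ field c ++ w = u ++ c.map .bit ++ .sep :: w := by simp [field]
  have e1 := Fast.clear (x := u ++ field c ++ w) (fun k => k = .tab t) N (s := σ) (by
    rintro k rfl; exact hN)
  have e2 := fast_readWhile (M₁ := M₁) (M₂ := M₂) (r := r) AlignSym.bit StkSym.bit
    (get := fun c => (inputBit c).map .bit) (fun _ => rfl) (z := .sep) rfl .tmp c w u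
    (σ.set (.tab t) []) hp
  rw [← hx] at e2
  refine ((e1.finish (s' := σ.set (.tab t) []) ?_ le_rfl).seq (e2.seq ((Fast.op _ _).seq
    (Fast.shift _ (bitWord c.reverse) [] isBit_of_mem_bitWord rfl ?_)))).finish ?_ ?_
  · refine Store.ext rfl (funext fun k => ?_) rfl
    by_cases h : k = .tab t <;> simp [h]
  · simp [Act.app, StackOp.app, ht, bitWord]
  · refine Store.ext ?_ (funext fun k => ?_) ?_
    · simp only [Act.app]
      rw [hx, moveInput_append]
      simp [field]
    · by_cases h : k = .tmp
      · simp [h, ht]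
      · by_cases h' : k = .tab t <;> simp [h, h', Act.app, StackOp.app, bitField, bitWord]
    · simp [Act.app]
  · simp; omega

/-- The entries of a score table in the order of the input. -/
def TabIdx.list (s r : ℕ) : List (TabIdx s r) :=
  (List.finRange r).map .init ++ (List.finRange r).flatMap fun p => (List.finRange r).flatMap fun q =>
    (List.finRange s).map (.del p q) ++ (List.finRange s).map (.ins p q) ++
      (List.finRange s).flatMap fun a => (List.finRange s).map (.sub p q a)

theorem TabIdx.mem_list (t : TabIdx s r) : t ∈ TabIdx.list s r := by
  cases t <;> simp [TabIdx.list]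

/-- Reads the score table and the first string. -/
noncomputable def load : AProg s r M₁ M₂ :=
  .seq (moveHead .right)
  (.seq (.forAll loadEntry (TabIdx.list s r))
  (.seq (readWhile (fun c => (inputLetter c).map .letter) .aB)
  (.shift (fun c => c.letter?.isSome) .aB fun k => k = .aF)))

/-- Bound for the time to read the score table and the first string. -/
def loadTime (N ℓ m : ℕ) : ℕ := N * (9 * ℓ + 8) + 6 * m + 6

omit [LinearOrder S] [Mul S] in
theorem fast_load {a b' : List (Fin s)} {tv : TabIdx s r → S}
    {V : ℕ → ℕ → ℕ → Fin r → S × Option (Fin r)} {code : S → List Bool} {ℓ : ℕ}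
    (hℓ : ∀ t, (code (tv t)).length ≤ ℓ)
    (hx : x = ((TabIdx.list s r).flatMap fun t => field (code (tv t))) ++ a.map .letter ++
      .sep :: b'.map .letter) :
    Fast x (load (M₁ := M₁) (M₂ := M₂) (r := r)) .empty
      ⟨((TabIdx.list s r).flatMap fun t => field (s := s) (code (tv t))).length + a.length + 1,
        (targetRun a b' tv V 0).colMem code 0 0, []⟩ (loadTime (TabIdx.list s r).length ℓ a.length) := by
  have e1 := fast_moveHead (x := x) (M₁ := M₁) (M₂ := M₂) (r := r) .right 0 (fun _ => []) []
  have e0 : OfflineTM.moveInput x .right 0 = 1 := by simp [OfflineTM.moveInput]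
  rw [e0] at e1
  have e2 := Fast.forAll (x := x) (f := loadEntry (M₁ := M₁) (M₂ := M₂)) (l := TabIdx.list s r)
    (fun l => ⟨(l.flatMap fun t => field (s := s) (code (tv t))).length + 1, fun k => match k with
      | .tab t => if t ∈ l then bitField (code (tv t)) .sep else []
      | _ => [], []⟩) (9 * ℓ + 8) (by
      intro l₁ t l₂ hl
      have := hℓ t
      have e : x = (l₁.flatMap fun t => field (code (tv t))) ++ field (code (tv t)) ++
          ((l₂.flatMap fun t => field (code (tv t))) ++ a.map .letter ++ .sep :: b'.map .letter) := by
        rw [hx, hl]; simp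
      rw [e]
      refine (fast_loadEntry (N := ℓ + 1) t (code (tv t)) _ _ rfl rfl ?_).finish ?_ (by omega)
      · dsimp only
        split_ifs
        · simpa using hℓ t
        · simp
      · refine Store.ext (by simp) (funext fun k => ?_) rfl
        cases k with
        | tab t' =>
          by_cases h : t' = t
          · simp [h]
          · by_cases h' : t' ∈ l₁ <;> simp [h, h']
        | _ => simp)
  have e3 := fun σ hp => fast_readWhile (M₁ := M₁) (M₂ := M₂) (r := r) AlignSym.letter StkSym.letter
    (get := fun c => (inputLetter c).map .letter) (fun _ => rfl) (z := .sep) rfl .aB a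
    (b'.map .letter) ((TabIdx.list s r).flatMap fun t => field (code (tv t))) σ hp
  rw [← hx] at e3
  refine ((e1.finish ?_ le_rfl).seq (e2.seq ((e3 _ rfl).seq (Fast.shift (src := .aB)
    (test := fun c => c.letter?.isSome) _ (a.map .letter).reverse [] (by simp [StkSym.letter?]) rfl (by simp))))).finish ?_ ?_
  · refine Store.ext (by simp) (funext fun k => ?_) rfl
    cases k <;> simp
  · refine Store.ext (by simp) (funext fun k => ?_) rfl
    cases k <;> simp [DPData.colMem, DPData.mem, targetRun, downWord, bitWord, TabIdx.mem_list]
  · simp [loadTime]; omega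

/-- Cell `u.length + 1` is the separator. -/
theorem stringAt_append (u : List (AlignSym s)) (b : List (Fin s)) :
    StringAt (u ++ .sep :: b.map .letter) (u.length + 1) b where
  length := by simp; omega
  letter j hj := by
    cases j with
    | zero => rw [Nat.add_zero, readInput_append]; rfl
    | succ j =>
      have : (u ++ .sep :: b.map AlignSym.letter)[u.length + 1 + j]? = some (.letter b[j]) := by
        rw [List.getElem?_append_right (by omega), show u.length + 1 + j - u.length = j + 1 by omega]
        simp [List.getElem?_eq_getElem (show j < b.length by omega)]
      rw [← add_assoc]
      simp only [OfflineTM.readInput, this, inputLetter, letterBefore]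
      rw [List.getElem?_eq_getElem]
  atEnd := by
    have : (u ++ .sep :: b.map AlignSym.letter)[u.length + 1 + b.length]? = none := by
      rw [List.getElem?_eq_none_iff]; simp; omega
    simp only [OfflineTM.readInput, this, inputLetter]

/-- The alignment machine as a program; `l` lists the final states. -/
noncomputable def alignProg (tie : TieBreak r) (l : List (Fin r)) : AProg s r M₁ M₂ :=
  .seq load (allRounds tie l)

/-- Bound for the heights of the stacks. -/
def progHeight (N r ℓ b m l : ℕ) : ℕ := loadTime N ℓ m + roundHeight r ℓ b m l

/-- Bound for the running time. -/
def progTime (N r ℓ b m n l : ℕ) : ℕ :=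
  loadTime N ℓ m + ((m + 1) * (n + 1) * (roundTime r ℓ b m n l + 1) + 1)

/-- The heights of the stacks need the time for loading, which is linear in `m`, but not the time of
the rounds. -/
theorem runs_alignProg {a b' : List (Fin s)} {tv : TabIdx s r → S}
    {V : ℕ → ℕ → ℕ → Fin r → S × Option (Fin r)} {tie : TieBreak r} {code : S → List Bool}
    {ℓ lam b : ℕ} (hB : OpBounds M₁ M₂ code ℓ lam b)
    (h : ∀ k < (a.length + 1) * (b'.length + 1), (targetRun a b' tv V k).Valid tie code ℓ b)
    {l : List (Fin r)} {v : ℕ → S × Option (Fin r)}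
    (hv : ∀ k < (a.length + 1) * (b'.length + 1),
      selectBest (V k a.length b'.length) l = some (v k))
    (hx : x = ((TabIdx.list s r).flatMap fun t => field (code (tv t))) ++ a.map .letter ++
      .sep :: b'.map .letter) :
    ∃ s', s'.out = ((List.range ((a.length + 1) * (b'.length + 1))).flatMap fun k =>
        tagWord (k % (a.length + 1)) (k / (a.length + 1)) (v k).2) ∧
      Runs x (Store.HeightLE (progHeight (TabIdx.list s r).length r ℓ b a.length l.length))
        (alignProg (M₁ := M₁) (M₂ := M₂) tie l) .empty s'
        (progTime (TabIdx.list s r).length r ℓ b a.length b'.length l.length) := by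
  have hs : StringAt x (((TabIdx.list s r).flatMap fun t =>
      field (s := s) (code (tv t))).length + a.length + 1) b' := by
    have := stringAt_append (((TabIdx.list s r).flatMap fun t => field (code (tv t))) ++
      a.map .letter) b'
    rw [← hx] at this
    simpa using this
  obtain ⟨s', ho, e2⟩ := runs_allRounds (M₁ := M₁) (M₂ := M₂) hB h hs hv
  have e1 := (fast_load (M₁ := M₁) (M₂ := M₂) (V := V)
    (h 0 (Nat.mul_pos (Nat.succ_pos _) (Nat.succ_pos _))).length_tab hx).of_fast (h₀ := 0)
    (h := progHeight (TabIdx.list s r).length r ℓ b a.length l.length)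
    (fun _ => Nat.le_refl 0) (by rw [progHeight]; omega)
  refine ⟨s', ho, e1.seq ?_⟩
  obtain ⟨t, ht, e2⟩ := e2
  exact ⟨t, ht, e2.weaken fun _ h => h.mono (by rw [progHeight]; omega)⟩

end Main

/-! ### Witness paths -/

namespace DPDag

section Paths

variable {V S : Type*} [DecidableEq V] [LinearOrder S] [OrderBot S] [Mul S]

theorem IsWitnessPred.unique {G : DPDag V S} {u u' v : V} (h : G.IsWitnessPred u v)
    (h' : G.IsWitnessPred u' v) : u = u' :=
  G.edgeRank_inj v u h.2.1 u' h'.2.1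
    (le_antisymm (h.2.2.2 u' h'.2.1 h'.2.2.1) (h'.2.2.2 u h.2.1 h.2.2.1))

theorem exists_isWitnessPred {G : DPDag V S} {v : V} (hv : v ∉ G.src) (h : (G.preds v).Nonempty) :
    ∃ u, G.IsWitnessPred u v := by
  have hval : G.value v = (G.preds v).sup fun u => G.value u * G.weight u v := by
    rw [value_eq, if_neg hv]
  obtain ⟨u₀, hu₀, he⟩ := Finset.exists_mem_eq_sup _ h fun u => G.value u * G.weight u v
  obtain ⟨u, hu, hmin⟩ := Finset.exists_min_image
    ((G.preds v).filter fun u => G.value u * G.weight u v = G.value v) (fun u => G.edgeRank u v)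
    ⟨u₀, Finset.mem_filter.2 ⟨hu₀, by rw [hval, he]⟩⟩
  rw [Finset.mem_filter] at hu
  exact ⟨u, hv, hu.1, hu.2, fun u' h1 h2 => hmin u' (Finset.mem_filter.2 ⟨h1, h2⟩)⟩

theorem mul_weight_le_value {G : DPDag V S} {u v : V} (h : u ∈ G.preds v) :
    G.value u * G.weight u v ≤ G.value v := by
  have hv : v ∉ G.src := fun hv => by simp [G.src_preds v hv] at h
  rw [G.value_eq v, if_neg hv]
  exact Finset.le_sup (f := fun u => G.value u * G.weight u v) h

open scoped Classical in
/-- The path that follows witness predecessors back from `v`. -/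
noncomputable def witnessPath (G : DPDag V S) (v : V) : List V :=
  if h : ∃ u, G.IsWitnessPred u v then witnessPath G h.choose ++ [v] else [v]
termination_by G.height v
decreasing_by exact G.height_lt _ _ h.choose_spec.2.1

theorem IsWitnessPred.witnessPath_eq {G : DPDag V S} {u v : V} (h : G.IsWitnessPred u v) :
    G.witnessPath v = G.witnessPath u ++ [v] := by
  have hex : ∃ u, G.IsWitnessPred u v := ⟨u, h⟩
  rw [witnessPath, dif_pos hex, hex.choose_spec.unique h]

theorem witnessPath_of_mem_src {G : DPDag V S} {v : V} (h : v ∈ G.src) : G.witnessPath v = [v] := by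
  rw [witnessPath, dif_neg]
  rintro ⟨u, hu⟩
  exact hu.1 h

omit [DecidableEq V] [LinearOrder S] [OrderBot S] in
theorem extendValue_append (G : DPDag V S) (y : S) (v : V) (l : List V) {u w : V}
    (h : (v :: l).getLast? = some u) :
    G.extendValue y v (l ++ [w]) = G.extendValue y v l * G.weight u w := by
  induction l generalizing y v with
  | nil =>
    obtain rfl : v = u := by simpa using h
    rfl
  | cons a l ih => exact ih _ _ (by simpa using h)

omit [DecidableEq V] in
theorem pathValue_append (G : DPDag V S) {P : List V} {u : V} (w : V) (h : P.getLast? = some u) :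
    G.pathValue (P ++ [w]) = G.pathValue P * G.weight u w := by
  cases P with
  | nil => simp at h
  | cons v l => exact G.extendValue_append _ v l h

/-- The witness path is the canonical path, and its value is the value of the program: every
edge on it attains the value of its end. -/
theorem canonical_witnessPath (G : DPDag V S) (hG : ∀ v, v ∉ G.src → (G.preds v).Nonempty) (v : V) :
    G.IsCanonicalPath (G.witnessPath v) v ∧ G.pathValue (G.witnessPath v) = G.value v := by
  induction hn : G.height v using Nat.strong_induction_on generalizing v with
  | _ n ih =>
    by_cases hv : v ∈ G.src
    · rw [witnessPath_of_mem_src hv]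
      exact ⟨⟨⟨v, hv, rfl⟩, List.isChain_singleton v, rfl⟩, by
        rw [value_eq, if_pos hv]; rfl⟩
    · obtain ⟨u, hu⟩ := exists_isWitnessPred hv (hG v hv)
      obtain ⟨⟨⟨w, hw, hh⟩, hc, hl⟩, hval⟩ := ih _ (hn ▸ G.height_lt _ _ hu.2.1) u rfl
      rw [hu.witnessPath_eq]
      refine ⟨⟨⟨w, hw, ?_⟩, ?_, by simp⟩, ?_⟩
      · simp [List.head?_append, hh]
      · rw [List.isChain_append]
        refine ⟨hc, List.isChain_singleton v, ?_⟩
        rintro y hy z hz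
        rw [hl] at hy
        obtain rfl : u = y := by simpa using hy
        obtain rfl : v = z := by simpa using hz
        exact hu
      · rw [pathValue_append _ _ hl, hval, hu.2.2.1]

theorem IsCanonicalPath.isSourcePath {G : DPDag V S} {P : List V} {v : V}
    (h : G.IsCanonicalPath P v) : G.IsSourcePath P v :=
  ⟨h.1, h.2.1.imp fun _ _ h => h.2.1, h.2.2⟩

/-- By monotonicity of multiplication on the right, no path is better than the value of its end. -/
theorem pathValue_le [MulRightMono S] (G : DPDag V S) {P : List V} {t : V}
    (h : G.IsSourcePath P t) : G.pathValue P ≤ G.value t := by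
  induction P using List.reverseRecOn generalizing t with
  | nil => simp [IsSourcePath] at h
  | append_singleton P v ih =>
    obtain ⟨⟨w, hw, hh⟩, hc, hl⟩ := h
    obtain rfl : v = t := by simpa using hl
    rcases hP : P.getLast? with _ | u
    · rw [List.getLast?_eq_none_iff] at hP
      subst hP
      obtain rfl : v = w := by simpa using hh
      rw [value_eq, if_pos hw]
      exact le_rfl
    · rw [List.isChain_append] at hc
      have hu : u ∈ G.preds v := hc.2.2 u hP v rfl
      have hne : P ≠ [] := by rintro rfl; simp at hP
      rw [pathValue_append _ _ hP]
      refine le_trans (mul_le_mul_left (ih ⟨⟨w, hw, ?_⟩, hc.1, hP⟩) _) (mul_weight_le_value hu)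
      rwa [List.head?_append_of_ne_nil _ hne] at hh

end Paths

end DPDag

/-! ### Choosing the first best candidate -/

/-- A fold with `better` ends with the candidate `y` if all candidates before it are worse and none
after it is better; indices `k` with `c k = none` are skipped. -/
theorem foldl_better_eq {ι S τ : Type*} [LinearOrder S] {step : Option (S × τ) → ι → Option (S × τ)}
    {c : ι → Option (S × τ)}
    (hstep : ∀ o k, step o k = match c k with
      | none => o
      | some a => some (better o a)) {l₁ l₂ : List ι} {k₀ : ι} {y : S × τ} (hk₀ : c k₀ = some y)
    (h₁ : ∀ k ∈ l₁, ∀ z ∈ c k, z.1 < y.1) (h₂ : ∀ k ∈ l₂, ∀ z ∈ c k, z.1 ≤ y.1) :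
    (l₁ ++ k₀ :: l₂).foldl step none = some y := by
  have hlt : ∀ z ∈ l₁.foldl step none, z.1 < y.1 := by
    induction l₁ using List.reverseRecOn with
    | nil => simp
    | append_singleton l k ih =>
      have ih := ih fun k hk => h₁ k (by simp [hk])
      have hk := h₁ k (by simp)
      rw [List.foldl_append, List.foldl_cons, List.foldl_nil, hstep]
      cases hc : c k with
      | none => exact ih
      | some a =>
        rintro z ⟨⟩
        cases ho : l.foldl step none with
        | none => exact hk a hc
        | some b =>
          simp only [better]
          split_ifs
          · exact ih b ho
          · exact hk a hc
  rw [List.foldl_append, List.foldl_cons, hstep, hk₀]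
  have hy : some (better (l₁.foldl step none) y) = some y := by
    cases ho : l₁.foldl step none with
    | none => rfl
    | some b => simp [better, (hlt b ho).not_ge]
  dsimp only
  rw [hy]
  induction l₂ with
  | nil => rfl
  | cons k l ih =>
    rw [List.foldl_cons, hstep]
    have ih := ih fun k hk => h₂ k (by simp [hk])
    cases hc : c k with
    | none => exact ih
    | some a => simpa [better, h₂ k (by simp) a hc] using ih

/-- The first one among the best states wins in the selection. -/
theorem selectBest_eq {S : Type*} [LinearOrder S] {r : ℕ} {V : Fin r → S × Option (Fin r)}
    {l : List (Fin r)} (hl : l.Pairwise (· ≤ ·)) {q : Fin r} (hq : q ∈ l)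
    (h₁ : ∀ p ∈ l, (V p).1 ≤ (V q).1) (h₂ : ∀ p ∈ l, (V p).1 = (V q).1 → q ≤ p) :
    selectBest V l = some (V q) := by
  obtain ⟨l₁, l₂, rfl, hn⟩ := List.eq_append_cons_of_mem hq
  refine foldl_better_eq (c := fun p => some (V p)) (fun _ _ => rfl) rfl ?_ ?_
  · rintro p hp z ⟨⟩
    refine lt_of_le_of_ne (h₁ p (by simp [hp])) fun he => hn ?_
    have h3 := h₂ p (by simp [hp]) he
    rw [List.pairwise_append] at hl
    rwa [le_antisymm h3 (hl.2.2 p hp q (by simp))]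
  · rintro p hp z ⟨⟩
    exact h₁ p (by simp [hp])

/-- The first one in the tie-breaking order among the best edges wins. -/
theorem bestOf_eq {S : Type*} [LinearOrder S] [Mul S] {s r : ℕ} {tie : TieBreak r}
    {tv : TabIdx s r → S} {src : AlignMove × Fin r → S × Option (Fin r)} {oa ob : Option (Fin s)}
    {q : Fin r} {k : AlignMove × Fin r} {t : TabIdx s r} (hk : tableIdx oa ob q k = some t)
    (h₁ : ∀ l t', tableIdx oa ob q l = some t' → (src l).1 * tv t' ≤ (src k).1 * tv t)
    (h₂ : ∀ l t', tableIdx oa ob q l = some t' → (src l).1 * tv t' = (src k).1 * tv t →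
      tie.rank q k.1 k.2 ≤ tie.rank q l.1 l.2) :
    bestOf tv src oa ob q (tie.kinds q) = some ((src k).1 * tv t, (src k).2) := by
  have hp := tie.pairwise_kinds q
  obtain ⟨l₁, l₂, he, hn⟩ := List.eq_append_cons_of_mem (tie.mem_kinds q k)
  rw [he] at hp ⊢
  refine foldl_better_eq (c := fun k => (tableIdx oa ob q k).map fun t =>
    ((src k).1 * tv t, (src k).2)) (fun o k => ?_) (by simp [hk]) ?_ ?_
  · cases tableIdx oa ob q k <;> rfl
  · intro l hl z hz
    obtain ⟨t', ht', rfl⟩ := Option.map_eq_some_iff.1 hz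
    refine lt_of_le_of_ne (h₁ l t' ht') fun he => hn ?_
    have h3 := h₂ l t' ht' he
    rw [List.pairwise_append] at hp
    have h4 := tie.rank_inj _ _ _ _ _ (le_antisymm h3 (hp.2.2 l hl k (by simp)))
    rwa [show k = l from Prod.ext h4.1 h4.2]
  · intro l hl z hz
    obtain ⟨t', ht', rfl⟩ := Option.map_eq_some_iff.1 hz
    exact h₁ l t' ht'

/-! ### Reading a path cell by cell -/

/-- The last element of a list with a given key. -/
def lastWithKey {α : Type*} (key : α → ℕ) (k : ℕ) (P : List α) : Option α :=
  (P.filter fun a => key a = k).getLast?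

theorem lastWithKey_append {α : Type*} (key : α → ℕ) (k : ℕ) (P : List α) (a : α) :
    lastWithKey key k (P ++ [a]) = if key a = k then some a else lastWithKey key k P := by
  by_cases h : key a = k <;> simp [lastWithKey, h]

/-- A list with increasing keys can be read off key by key. -/
theorem flatMap_lastWithKey {α β : Type*} {key : α → ℕ} (f : α → List β) {P : List α}
    (hP : P.Pairwise fun a b => key a < key b) {N : ℕ} (hN : ∀ a ∈ P, key a < N) :
    ((List.range N).flatMap fun k => ((lastWithKey key k P).map f).getD []) = P.flatMap f := by
  induction P using List.reverseRecOn generalizing N with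
  | nil => simp [lastWithKey]
  | append_singleton P a ih =>
    rw [List.pairwise_append] at hP
    have hlt : ∀ b ∈ P, key b < key a := fun b hb => hP.2.2 b hb a (by simp)
    obtain ⟨d, rfl⟩ : ∃ d, N = key a + 1 + d := Nat.exists_eq_add_of_le (hN a (by simp))
    rw [List.range_add, List.range_succ, List.flatMap_append, List.flatMap_append,
      List.flatMap_append, ← ih hP.1 hlt]
    have e1 : ((List.range (key a)).flatMap fun k => ((lastWithKey key k (P ++ [a])).map f).getD []) =
        (List.range (key a)).flatMap fun k => ((lastWithKey key k P).map f).getD [] := by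
      refine List.flatMap_congr fun k hk => ?_
      rw [lastWithKey_append, if_neg (List.mem_range.1 hk).ne']
    have e2 : (((List.range d).map fun i => key a + 1 + i).flatMap fun k =>
        ((lastWithKey key k (P ++ [a])).map f).getD []) = [] := by
      rw [List.flatMap_eq_nil_iff]
      intro k hk
      obtain ⟨i, -, rfl⟩ := List.mem_map.1 hk
      rw [lastWithKey_append, if_neg (by omega), lastWithKey,
        List.filter_eq_nil_iff.2 fun b hb => by have := hlt b hb; simp; omega]
      rfl
    rw [e1, e2]
    simp [lastWithKey_append]

/-! ### The alignment grid -/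

section Grid

variable {S : Type*} [LinearOrder S] [OrderBot S] [Semigroup S] {s r m n : ℕ}

/-- The entries of the score table. -/
def ScoringScheme.get {S : Type*} (W : ScoringScheme s r S) : TabIdx s r → S
  | .init q => W.init q
  | .del p q a => W.del p q a
  | .ins p q b => W.ins p q b
  | .sub p q a b => W.sub p q a b

/-- The position of the cell of a vertex, when the cells are enumerated column by column. -/
def cellKey (v : GridVertex m n r) : ℕ := (m + 1) * v.2.1.val + v.1.val

/-- The value of cell `(i, j)` and the state in which the witness path of the cell passes through the
cell in position `k`. Outside the grid these are dummy values. -/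
noncomputable def gridVal (W : ScoringScheme s r S) (tie : TieBreak r) (A : Fin m → Fin s)
    (B : Fin n → Fin s) (k i j : ℕ) (q : Fin r) : S × Option (Fin r) :=
  if h : i ≤ m ∧ j ≤ n then
    let v : GridVertex m n r := (⟨i, Nat.lt_succ_of_le h.1⟩, ⟨j, Nat.lt_succ_of_le h.2⟩, q)
    ((alignDag W tie A B).value v,
      (lastWithKey cellKey k ((alignDag W tie A B).witnessPath v)).map fun u => u.2.2)
  else (⊥, none)

variable {W : ScoringScheme s r S} {tie : TieBreak r} {A : Fin m → Fin s} {B : Fin n → Fin s}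

theorem gridVal_vertex (k : ℕ) (v : GridVertex m n r) :
    gridVal W tie A B k v.1 v.2.1 v.2.2 = ((alignDag W tie A B).value v,
      (lastWithKey cellKey k ((alignDag W tie A B).witnessPath v)).map fun u => u.2.2) := by
  rw [gridVal, dif_pos ⟨Nat.lt_succ_iff.1 v.1.2, Nat.lt_succ_iff.1 v.2.1.2⟩]

theorem letterBefore_ofFn (A : Fin m → Fin s) {i : ℕ} (hi : i < m) :
    letterBefore (List.ofFn A) (i + 1) = some (A ⟨i, hi⟩) := by
  simp [letterBefore, hi]

theorem gridPreds_nonempty (v : GridVertex m n r) (hv : v ∉ gridSources m n r) :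
    (gridPreds v).Nonempty := by
  rw [mem_gridSources] at hv
  obtain ⟨⟨i, hi⟩, ⟨j, hj⟩, q⟩ := v
  rcases Nat.eq_zero_or_pos i with rfl | hi0
  · refine ⟨(⟨0, hi⟩, ⟨j - 1, by omega⟩, q), (mem_gridPreds _ _).2 (.inr (.inl ⟨rfl, ?_⟩))⟩
    simp at hv ⊢; omega
  · refine ⟨(⟨i - 1, by omega⟩, ⟨j, hj⟩, q), (mem_gridPreds _ _).2 (.inl ⟨?_, rfl⟩)⟩
    simp; omega

/-- The strings with the values for the target cell in position `k`. -/
noncomputable abbrev gridRun (W : ScoringScheme s r S) (tie : TieBreak r) (A : Fin m → Fin s)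
    (B : Fin n → Fin s) (k : ℕ) : DPData S s r :=
  targetRun (List.ofFn A) (List.ofFn B) W.get (gridVal W tie A B) k

/-- An edge of the grid appears among the candidates for the cell it enters. -/
theorem candidate_of_edge {u v : GridVertex m n r} (h : GridEdge u v) (k : ℕ) :
    (∃ t, tableIdx (letterBefore (List.ofFn A) v.1) (letterBefore (List.ofFn B) v.2.1) v.2.2
      (edgeMove u v, u.2.2) = some t ∧ W.get t = edgeWeight W A B u v) ∧
    (gridRun W tie A B k).src v.1 v.2.1 (edgeMove u v, u.2.2) = gridVal W tie A B k u.1 u.2.1 u.2.2 := by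
  obtain ⟨⟨i, hi⟩, ⟨j, hj⟩, q⟩ := v
  obtain ⟨⟨i', hi'⟩, ⟨j', hj'⟩, p⟩ := u
  simp only [GridEdge] at h
  rcases h with ⟨rfl, rfl⟩ | ⟨rfl, rfl⟩ | ⟨rfl, rfl⟩
  · rw [letterBefore_ofFn A (by omega)]
    simp [edgeMove, edgeWeight, tableIdx, ScoringScheme.get, DPData.src, targetRun]
  · rw [letterBefore_ofFn B (by omega)]
    simp [edgeMove, edgeWeight, tableIdx, ScoringScheme.get, DPData.src, targetRun]
  · rw [letterBefore_ofFn A (by omega), letterBefore_ofFn B (by omega)]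
    simp [edgeMove, edgeWeight, tableIdx, ScoringScheme.get, DPData.src, targetRun]

/-- Every candidate for a cell comes from an edge of the grid. -/
theorem edge_of_candidate {v : GridVertex m n r} {l : AlignMove × Fin r} {t : TabIdx s r}
    (h : tableIdx (letterBefore (List.ofFn A) v.1) (letterBefore (List.ofFn B) v.2.1) v.2.2 l = some t) :
    ∃ u, GridEdge u v ∧ (edgeMove u v, u.2.2) = l := by
  have hpos := tableIdx_pos h
  obtain ⟨⟨i, hi⟩, ⟨j, hj⟩, q⟩ := v
  obtain ⟨d, p⟩ := l
  cases d
  · simp only at hpos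
    refine ⟨(⟨i - 1, by omega⟩, ⟨j, hj⟩, p), .inl ⟨by simp; omega, rfl⟩, ?_⟩
    simp [edgeMove, hpos]
  · simp only at hpos
    refine ⟨(⟨i, hi⟩, ⟨j - 1, by omega⟩, p), .inr (.inl ⟨rfl, by simp; omega⟩), ?_⟩
    simp [edgeMove]
  · simp only at hpos
    refine ⟨(⟨i - 1, by omega⟩, ⟨j - 1, by omega⟩, p), .inr (.inr ⟨by simp; omega, by simp; omega⟩), ?_⟩
    simp [edgeMove, hpos]

/-- `k % (m + 1)` and `k / (m + 1)` are the coordinates of the target in position `k`. -/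
theorem cellKey_eq_iff (v : GridVertex m n r) (k : ℕ) :
    cellKey v = k ↔ v.1.val = k % (m + 1) ∧ v.2.1.val = k / (m + 1) := by
  have h := Nat.div_mod_unique (a := k) (b := m + 1) (c := v.1.val) (d := v.2.1.val) (by omega)
  have := v.1.2
  rw [cellKey]
  constructor
  · intro hk
    have := h.2 ⟨by omega, v.1.2⟩
    exact ⟨this.2.symm, this.1.symm⟩
  · rintro ⟨h1, h2⟩
    have := (h.1 ⟨h2.symm, h1.symm⟩).1
    omega

/-- The values of the grid satisfy the recursion that the machine evaluates. -/
theorem gridRun_rec (k : ℕ) (v : GridVertex m n r) :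
    ∃ w, cellValue tie W.get ((gridRun W tie A B k).src v.1 v.2.1)
        (letterBefore (List.ofFn A) v.1) (letterBefore (List.ofFn B) v.2.1) v.2.2 = some w ∧
      gridVal W tie A B k v.1 v.2.1 v.2.2 =
        (w.1, if v.1.val = k % (m + 1) ∧ v.2.1.val = k / (m + 1) then some v.2.2 else w.2) := by
  have hiff : letterBefore (List.ofFn A) v.1 = none ∧ letterBefore (List.ofFn B) v.2.1 = none ↔
      v ∈ gridSources m n r := by
    rw [mem_gridSources, letterBefore_eq_none (by simpa using Nat.lt_succ_iff.1 v.1.2),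
      letterBefore_eq_none (by simpa using Nat.lt_succ_iff.1 v.2.1.2)]
  rw [gridVal_vertex, cellValue]
  simp only [← cellKey_eq_iff]
  by_cases hv : v ∈ gridSources m n r
  · rw [if_pos (hiff.2 hv)]
    have hsrc : v ∈ (alignDag W tie A B).src := hv
    refine ⟨_, rfl, ?_⟩
    rw [DPDag.witnessPath_of_mem_src hsrc, DPDag.value_eq, if_pos hsrc]
    have := lastWithKey_append cellKey k [] v
    rw [List.nil_append] at this
    rw [this]
    by_cases hk : cellKey v = k <;> simp [hk, lastWithKey, ScoringScheme.get, alignDag]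
  · rw [if_neg (mt hiff.1 hv)]
    obtain ⟨u, hu⟩ := DPDag.exists_isWitnessPred (G := alignDag W tie A B) hv
      (gridPreds_nonempty v hv)
    have hedge := (mem_gridPreds _ _).1 hu.2.1
    obtain ⟨⟨t, ht, hw⟩, hsrc⟩ := candidate_of_edge (W := W) (tie := tie) (A := A) (B := B) hedge k
    have hvw : (alignDag W tie A B).value u * W.get t = (alignDag W tie A B).value v := by
      rw [hw]; exact hu.2.2.1
    rw [gridVal_vertex] at hsrc
    refine ⟨_, bestOf_eq ht ?_ ?_, ?_⟩
    · intro l t' hl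
      obtain ⟨u', hu', rfl⟩ := edge_of_candidate hl
      obtain ⟨⟨t'', ht'', hw'⟩, hsrc'⟩ := candidate_of_edge (W := W) (tie := tie) (A := A) (B := B) hu' k
      obtain rfl : t'' = t' := by rw [ht''] at hl; simpa using hl
      rw [hsrc, hsrc', gridVal_vertex, hvw, hw']
      exact DPDag.mul_weight_le_value (G := alignDag W tie A B) ((mem_gridPreds _ _).2 hu')
    · intro l t' hl he
      obtain ⟨u', hu', rfl⟩ := edge_of_candidate hl
      obtain ⟨⟨t'', ht'', hw'⟩, hsrc'⟩ := candidate_of_edge (W := W) (tie := tie) (A := A) (B := B) hu' k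
      obtain rfl : t'' = t' := by rw [ht''] at hl; simpa using hl
      rw [hsrc, hsrc', gridVal_vertex, hvw, hw'] at he
      exact hu.2.2.2 u' ((mem_gridPreds _ _).2 hu') he
    · rw [hsrc, hu.witnessPath_eq, lastWithKey_append]
      by_cases hk : cellKey v = k <;> simp [hk, hvw]

theorem cellKey_lt_of_edge {u v : GridVertex m n r} (h : GridEdge u v) : cellKey u < cellKey v := by
  unfold cellKey
  rcases h with ⟨h1, h2⟩ | ⟨h1, h2⟩ | ⟨h1, h2⟩
  · rw [h2]; omega
  · rw [← h2, h1, Nat.mul_add]; omega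
  · rw [← h2, Nat.mul_add]; omega

theorem cellKey_lt (v : GridVertex m n r) : cellKey v < (m + 1) * (n + 1) := by
  have h1 := v.1.2
  have h2 : (m + 1) * v.2.1.val ≤ (m + 1) * n := Nat.mul_le_mul_left _ (Nat.lt_succ_iff.1 v.2.1.2)
  unfold cellKey
  rw [Nat.mul_add]
  omega

/-- The words that are reported for all targets form the canonical path, because the positions of the
cells increase along a path. -/
theorem flatMap_tagWord (v : GridVertex m n r) :
    ((List.range ((m + 1) * (n + 1))).flatMap fun k =>
      tagWord (k % (m + 1)) (k / (m + 1)) (gridVal W tie A B k v.1 v.2.1 v.2.2).2) =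
    pathWord ((alignDag W tie A B).witnessPath v) := by
  have hcan := ((alignDag W tie A B).canonical_witnessPath gridPreds_nonempty v).1
  have hP : ((alignDag W tie A B).witnessPath v).Pairwise fun a b => cellKey a < cellKey b := by
    have : ((alignDag W tie A B).witnessPath v).IsChain fun a b => cellKey a < cellKey b :=
      hcan.2.1.imp fun a b h => cellKey_lt_of_edge ((mem_gridPreds _ _).1 h.2.1)
    rw [← List.isChain_map (R := (· < ·)) cellKey, List.isChain_iff_pairwise, List.pairwise_map] at this
    exact this
  rw [pathWord, ← flatMap_lastWithKey vertexWord hP fun a _ => cellKey_lt a]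
  refine List.flatMap_congr fun k _ => ?_
  rw [gridVal_vertex]
  cases hk : lastWithKey cellKey k ((alignDag W tie A B).witnessPath v) with
  | none => rfl
  | some u =>
    have hu : cellKey u = k := by
      have := List.mem_of_getLast? hk
      simpa using (List.mem_filter.1 this).2
    rw [cellKey_eq_iff] at hu
    simp only [Option.map_some, tagWord, Option.getD_some, ← hu.1, ← hu.2]
    rfl

omit [LinearOrder S] [OrderBot S] [Semigroup S] in
theorem instanceWord_eq (code : S → List Bool) (W : ScoringScheme s r S) (A : Fin m → Fin s)
    (B : Fin n → Fin s) : instanceWord code W A B =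
      ((TabIdx.list s r).flatMap fun t => field (code (W.get t))) ++ (List.ofFn A).map .letter ++
        .sep :: (List.ofFn B).map .letter := by
  simp [instanceWord, TabIdx.list, List.flatMap_assoc, List.flatMap_append, List.flatMap_map,
    ScoringScheme.get]

omit [OrderBot S] [Semigroup S] in
/-- There is a first final state with maximal value. -/
theorem exists_first_max {F : Finset (Fin r)} (hF : F.Nonempty) (f : Fin r → S) :
    ∃ q ∈ F, (∀ p ∈ F, f p ≤ f q) ∧ ∀ p ∈ F, f p = f q → q ≤ p := by
  obtain ⟨q₀, hq₀, hmax⟩ := F.exists_max_image f hF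
  have hne : (F.filter fun q => f q = f q₀).Nonempty := ⟨q₀, Finset.mem_filter.2 ⟨hq₀, rfl⟩⟩
  have hmem := Finset.mem_filter.1 (Finset.min'_mem _ hne)
  refine ⟨_, hmem.1, fun p hp => (hmax p hp).trans hmem.2.ge, fun p hp he => ?_⟩
  exact Finset.min'_le _ _ (Finset.mem_filter.2 ⟨hp, he.trans hmem.2⟩)

/-- In an instance with short values, every run of the program satisfies the assumptions of the
machine. -/
theorem gridRun_valid {code : S → List Bool} {κ ℓ b : ℕ} (h : HasLogSizeValues code κ W tie A B)
    (hℓ : κ * Nat.log 2 ((m + 1) * (n + 1)) ≤ ℓ)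
    (hb : ∀ i, i ≤ m ∨ i ≤ n → (Nat.bits i).length ≤ b) (k : ℕ) :
    (gridRun W tie A B k).Valid tie code ℓ b where
  rec_eq i hi j hj q := by
    simp only [targetRun, List.length_ofFn] at hi hj
    have := gridRun_rec (W := W) (tie := tie) (A := A) (B := B) k
      (⟨i, Nat.lt_succ_of_le hi⟩, ⟨j, Nat.lt_succ_of_le hj⟩, q)
    simpa [targetRun] using this
  length_tab t := by
    cases t with
    | init q => exact (h.init q).trans hℓ
    | del p q a => exact (h.del p q a).trans hℓ
    | ins p q a => exact (h.ins p q a).trans hℓ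
    | sub p q a c => exact (h.sub p q a c).trans hℓ
  length_val i hi j hj q := by
    simp only [targetRun, List.length_ofFn] at hi hj
    have := gridVal_vertex (W := W) (tie := tie) (A := A) (B := B) k
      (⟨i, Nat.lt_succ_of_le hi⟩, ⟨j, Nat.lt_succ_of_le hj⟩, q)
    simp only at this
    simp only [targetRun, this]
    exact (h.value _).trans hℓ
  length_bits i hi := hb i (by simpa [targetRun] using hi)

end Grid

/-! ### Finitely many stacks and symbols -/

instance (n : ℕ) : Finite (SimKey n) :=
  Finite.of_surjective (α := Fin 4 ⊕ Fin 3 × Fin n)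
    (fun
      | .inl 0 => .inl
      | .inl 1 => .inr
      | .inl 2 => .out
      | .inl 3 => .st
      | .inr (0, t) => .tl t
      | .inr (1, t) => .tc t
      | .inr (2, t) => .tr t)
    (by
      rintro (_ | _ | _ | _ | t | t | t)
      exacts [⟨.inl 0, rfl⟩, ⟨.inl 1, rfl⟩, ⟨.inl 2, rfl⟩, ⟨.inl 3, rfl⟩, ⟨.inr (0, t), rfl⟩,
        ⟨.inr (1, t), rfl⟩, ⟨.inr (2, t), rfl⟩])

instance (s r : ℕ) : Finite (TabIdx s r) :=
  Set.finite_univ_iff.1 ((TabIdx.list s r).finite_toSet.subset fun t _ => t.mem_list)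

instance (s r n₁ n₂ : ℕ) : Finite (Key s r n₁ n₂) := by
  let f : (TabIdx s r ⊕ Fin 4 × Fin r) ⊕ (Fin 11 ⊕ (SimKey n₁ ⊕ SimKey n₂)) → Key s r n₁ n₂ := fun
    | .inl (.inl t) => .tab t
    | .inl (.inr (i, p)) => ![.col p, .dcol p, .ncol p, .cur p] i
    | .inr (.inl i) => ![.aF, .aB, .cand, .best, .tmp, .act, .fin, .ci, .cj, .si, .sj] i
    | .inr (.inr (.inl i)) => .mul i
    | .inr (.inr (.inr i)) => .le i
  refine Finite.of_surjective f ?_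
  rintro (t | _ | _ | p | p | p | p | _ | _ | _ | _ | _ | _ | _ | _ | _ | i | i)
  exacts [⟨.inl (.inl t), rfl⟩, ⟨.inr (.inl 0), rfl⟩, ⟨.inr (.inl 1), rfl⟩, ⟨.inl (.inr (0, p)), rfl⟩,
    ⟨.inl (.inr (1, p)), rfl⟩, ⟨.inl (.inr (2, p)), rfl⟩, ⟨.inl (.inr (3, p)), rfl⟩,
    ⟨.inr (.inl 2), rfl⟩, ⟨.inr (.inl 3), rfl⟩, ⟨.inr (.inl 4), rfl⟩, ⟨.inr (.inl 5), rfl⟩,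
    ⟨.inr (.inl 6), rfl⟩, ⟨.inr (.inl 7), rfl⟩, ⟨.inr (.inl 8), rfl⟩, ⟨.inr (.inl 9), rfl⟩,
    ⟨.inr (.inl 10), rfl⟩, ⟨.inr (.inr (.inl i)), rfl⟩, ⟨.inr (.inr (.inr i)), rfl⟩]

instance (s r : ℕ) (W : Type) [Finite W] : Finite (StkSym s r W) := by
  let f : (Bool ⊕ Fin 3) ⊕ (Option (Fin r) ⊕ (Fin s ⊕ W)) → StkSym s r W := fun
    | .inl (.inl c) => .bit c
    | .inl (.inr i) => ![.sep, .lend, .rend] i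
    | .inr (.inl o) => .tag o
    | .inr (.inr (.inl a)) => .letter a
    | .inr (.inr (.inr w)) => .ext w
  refine Finite.of_surjective f ?_
  rintro (c | _ | _ | _ | o | a | w)
  exacts [⟨.inl (.inl c), rfl⟩, ⟨.inl (.inr 0), rfl⟩, ⟨.inl (.inr 1), rfl⟩, ⟨.inl (.inr 2), rfl⟩,
    ⟨.inr (.inl o), rfl⟩, ⟨.inr (.inr (.inl a)), rfl⟩, ⟨.inr (.inr (.inr w)), rfl⟩]

/-! ### Polynomial bounds -/

/-- Bounded by a polynomial on the positive integers. -/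
@[fun_prop]
def PolyBounded (f : ℕ → ℕ) : Prop := ∃ D, ∀ x, 1 ≤ x → f x ≤ D * x ^ D

namespace PolyBounded

variable {f g : ℕ → ℕ}

theorem mono (hg : PolyBounded g) (h : ∀ x, 1 ≤ x → f x ≤ g x) : PolyBounded f :=
  let ⟨D, hD⟩ := hg; ⟨D, fun x hx => (h x hx).trans (hD x hx)⟩

@[fun_prop]
theorem const (c : ℕ) : PolyBounded fun _ => c :=
  ⟨c, fun _ hx => Nat.le_mul_of_pos_right _ (Nat.pow_pos hx)⟩

@[fun_prop]
theorem id : PolyBounded fun x => x := ⟨1, fun x _ => by simp⟩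

@[fun_prop]
theorem add (hf : PolyBounded f) (hg : PolyBounded g) : PolyBounded fun x => f x + g x := by
  obtain ⟨D, hD⟩ := hf
  obtain ⟨E, hE⟩ := hg
  refine ⟨D + E, fun x hx => (Nat.add_le_add (hD x hx) (hE x hx)).trans ?_⟩
  rw [Nat.add_mul]
  exact Nat.add_le_add (Nat.mul_le_mul_left _ (Nat.pow_le_pow_right hx (by omega)))
    (Nat.mul_le_mul_left _ (Nat.pow_le_pow_right hx (by omega)))

@[fun_prop]
theorem mul (hf : PolyBounded f) (hg : PolyBounded g) : PolyBounded fun x => f x * g x := by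
  obtain ⟨D, hD⟩ := hf
  obtain ⟨E, hE⟩ := hg
  refine ⟨D * E + (D + E), fun x hx => (Nat.mul_le_mul (hD x hx) (hE x hx)).trans ?_⟩
  calc D * x ^ D * (E * x ^ E) = D * E * x ^ (D + E) := by ring
    _ ≤ _ := Nat.mul_le_mul (Nat.le_add_right _ _) (Nat.pow_le_pow_right hx (by omega))

@[fun_prop]
theorem pow (hf : PolyBounded f) (k : ℕ) : PolyBounded fun x => f x ^ k := by
  induction k with
  | zero => simpa using const 1
  | succ k ih => simpa only [pow_succ] using ih.mul hf

theorem comp (hf : PolyBounded f) (hg : PolyBounded g) (h : ∀ x, 1 ≤ x → 1 ≤ g x) :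
    PolyBounded fun x => f (g x) := by
  obtain ⟨D, hD⟩ := hf
  exact ((const D).mul (hg.pow D)).mono fun x hx => hD _ (h x hx)

end PolyBounded

theorem OpBounds.mono {S : Type*} [LinearOrder S] [Mul S] {M₁ M₂ : OfflineTM (Option Bool) Bool}
    {code : S → List Bool} {ℓ lam b b' : ℕ} (h : OpBounds M₁ M₂ code ℓ lam b) (hb : b ≤ b') :
    OpBounds M₁ M₂ code ℓ lam b' where
  le_lam := h.le_lam
  lam_le := h.lam_le.trans hb
  length_mul := h.length_mul
  mul u v hu hv := (h.mul u v hu hv).mono hb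
  le u v hu hv := (h.le u v hu hv).mono hb

/-- A product is written symbol by symbol, so its length is bounded by the running time. -/
theorem IsEfficientCode.exists_opBounds {S : Type*} [LinearOrder S] [Mul S] {code : S → List Bool}
    (h : IsEfficientCode code) : ∃ (M₁ M₂ : OfflineTM (Option Bool) Bool) (lam b : ℕ → ℕ),
      Monotone b ∧ PolyBounded b ∧ ∀ ℓ, OpBounds M₁ M₂ code ℓ (lam ℓ) (b ℓ) := by
  obtain ⟨M₁, d₁, h₁⟩ := h.mul
  obtain ⟨M₂, d₂, h₂⟩ := h.le
  let t₁ : ℕ → ℕ := fun ℓ => d₁ * (ℓ + ℓ + 1) ^ d₁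
  let lam : ℕ → ℕ := fun ℓ => ℓ + t₁ ℓ
  let t₂ : ℕ → ℕ := fun ℓ => d₂ * (lam ℓ + lam ℓ + 1) ^ d₂
  have ht₁ : ∀ ℓ (u v : S), (code u).length ≤ ℓ → (code v).length ≤ ℓ →
      d₁ * ((code u).length + (code v).length + 1) ^ d₁ ≤ t₁ ℓ := fun ℓ u v hu hv =>
    Nat.mul_le_mul_left _ (Nat.pow_le_pow_left (by omega) _)
  refine ⟨M₁, M₂, lam, fun ℓ => lam ℓ + t₂ ℓ, ?_, ?_, fun ℓ => ⟨Nat.le_add_right _ _,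
    Nat.le_add_right _ _, ?_, ?_, ?_⟩⟩
  · intro ℓ ℓ' hℓ
    have hlam : lam ℓ ≤ lam ℓ' := by simp only [lam, t₁]; gcongr
    simp only [t₂]
    gcongr
  · have hlam : PolyBounded lam := by
      simp only [lam, t₁]
      fun_prop
    simp only [t₂]
    fun_prop
  · exact fun u v hu hv => (h₁ u v).length_le.trans ((ht₁ ℓ u v hu hv).trans (Nat.le_add_left _ _))
  · exact fun u v hu hv => (h₁ u v).mono ((ht₁ ℓ u v hu hv).trans (by simp only [lam]; omega))
  · exact fun u v hu hv => (h₂ u v).mono ((Nat.mul_le_mul_left _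
      (Nat.pow_le_pow_left (by omega) _)).trans (Nat.le_add_left _ _))

theorem progTime_mono (N r l : ℕ) {ℓ ℓ' b b' m m' n n' : ℕ} (h₁ : ℓ ≤ ℓ') (h₂ : b ≤ b') (h₃ : m ≤ m')
    (h₄ : n ≤ n') : progTime N r ℓ b m n l ≤ progTime N r ℓ' b' m' n' l := by
  unfold progTime roundTime passTime colTime nextTime rowTime cellTime stateTime reportTime
    advanceTime memHeight loadTime
  gcongr

theorem polyBounded_progTime (N r l : ℕ) {ℓ b : ℕ → ℕ} (hℓ : PolyBounded ℓ) (hb : PolyBounded b) :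
    PolyBounded fun x => progTime N r (ℓ x) (b x) x x l := by
  unfold progTime roundTime passTime colTime nextTime rowTime cellTime stateTime reportTime
    advanceTime memHeight loadTime
  fun_prop

/-- The part of the height bound that does not depend on the length of the first string. -/
def baseHeight (N r ℓ b l : ℕ) : ℕ :=
  N * (9 * ℓ + 8) + rowTime r b + r + reportTime l b + (37 * b + 58)

theorem polyBounded_baseHeight (N r l : ℕ) {ℓ b : ℕ → ℕ} (hℓ : PolyBounded ℓ) (hb : PolyBounded b) :
    PolyBounded fun x => baseHeight N r (ℓ x) (b x) l := by
  unfold baseHeight rowTime cellTime stateTime reportTime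
  fun_prop

/-- Only the bound `ℓ` for the lengths of code words, and not the time bound `b`, is multiplied by
the length of the first string. -/
theorem progHeight_le (N r l ℓ b m : ℕ) : progHeight N r ℓ b m l ≤
    (19 + 6 * r) * ((m + 1) * (ℓ + 1)) + baseHeight N r ℓ b l := by
  have e : progHeight N r ℓ b m l = 7 * ((m + 1) * (ℓ + 1)) + r * ((m + 1) * (6 * ℓ + 5)) + 12 * m +
      baseHeight N r ℓ b l := by
    unfold progHeight baseHeight roundHeight nextTime advanceTime memHeight loadTime
    ring
  have h1 : m ≤ (m + 1) * (ℓ + 1) := (Nat.le_succ m).trans (Nat.le_mul_of_pos_right _ (by omega))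
  have h2 : (m + 1) * (6 * ℓ + 5) ≤ 6 * ((m + 1) * (ℓ + 1)) := by
    rw [Nat.mul_left_comm]
    exact Nat.mul_le_mul_left _ (by omega)
  have h3 := Nat.mul_le_mul_left r h2
  rw [e, Nat.add_mul 19, Nat.mul_comm 6 r, Nat.mul_assoc r 6]
  omega

/-! ### The resource bounds and the alignment machine -/

theorem log_grid_le {m n : ℕ} (hm : 1 ≤ m) (hn : 1 ≤ n) :
    Nat.log 2 ((m + 1) * (n + 1)) ≤ 2 * (Nat.log 2 (m * n) + 1) := by
  have h : (m + 1) * (n + 1) ≤ m * n * 2 * 2 := by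
    calc (m + 1) * (n + 1) ≤ (m * 2) * (n * 2) := Nat.mul_le_mul (by omega) (by omega)
      _ = m * n * 2 * 2 := by ring
  have hpos : 0 < m * n := Nat.mul_pos hm hn
  have h1 := Nat.log_mono_right (b := 2) h
  rw [Nat.log_mul_base (by omega) (by omega), Nat.log_mul_base (by omega) (by omega)] at h1
  omega

/-- The witness path of a best final vertex is optimal, since its value is the value of that vertex and
`DPDag.pathValue_le` bounds all others. -/
theorem isOptimal_witnessPath {S : Type*} [LinearOrder S] [OrderBot S] [Semigroup S] [MulRightMono S]
    {s r m n : ℕ} {W : ScoringScheme s r S} {tie : TieBreak r} {F : Finset (Fin r)}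
    {A : Fin m → Fin s} {B : Fin n → Fin s} {q : Fin r} (hq : q ∈ F)
    (hmax : ∀ p ∈ F, (alignDag W tie A B).value (sinkVertex m n p) ≤
      (alignDag W tie A B).value (sinkVertex m n q)) :
    IsOptimalAlignment W tie F A B ((alignDag W tie A B).witnessPath (sinkVertex m n q)) := by
  obtain ⟨hcan, hval⟩ :=
    (alignDag W tie A B).canonical_witnessPath gridPreds_nonempty (sinkVertex m n q)
  refine ⟨⟨q, hq, hcan.isSourcePath, hval⟩, fun p hp P' hP' => ?_⟩
  rw [hval]
  exact ((alignDag W tie A B).pathValue_le hP').trans (hmax p hp)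

/-- Time is polynomial in `m * n`, and space is `m * L` up to terms that are polynomial in `L`, where
`L` is the length of the numbers up to `m * n`. -/
theorem exists_resource_bounds {b₀ : ℕ → ℕ} (hmono : Monotone b₀) (hpoly : PolyBounded b₀)
    (N r l K κ : ℕ) : ∃ C c : ℕ, ∀ m n L ℓ b : ℕ, 1 ≤ m → m ≤ n → L = Nat.log 2 (m * n) + 1 →
      ℓ = (2 * κ + 1) * L → b = b₀ ℓ + L →
        progTime N r ℓ b m n l ≤ C * (m * n) ^ c ∧
        K * (progHeight N r ℓ b m l + 1) ≤ C * (m * L + L ^ c) := by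
  have hℓ : PolyBounded fun x => (2 * κ + 1) * x := by fun_prop
  have hb : PolyBounded fun x => b₀ ((2 * κ + 1) * x) + x :=
    (hpoly.comp hℓ fun x hx => Nat.mul_pos (Nat.succ_pos _) hx).add .id
  -- `D` serves the part of the heights without a factor `m`, as a polynomial in `L`; `E` serves the
  -- time, as a polynomial in `m * n`, where all parameters are replaced by bounds in `m * n`.
  obtain ⟨D, hD⟩ := polyBounded_baseHeight N r l hℓ hb
  obtain ⟨E, hE⟩ := polyBounded_progTime N r l hℓ hb
  refine ⟨K * ((19 + 6 * r) * (4 * κ + 4) + 1) + K * D + E, D + E, ?_⟩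
  rintro m n L ℓ b hm hmn hL rfl rfl
  have hmn1 : 1 ≤ m * n := Nat.mul_pos hm (hm.trans hmn)
  have hLx : L ≤ m * n := hL ▸ Nat.log_lt_self 2 (by omega)
  have hL1 : 1 ≤ L := by omega
  have hℓx : (2 * κ + 1) * L ≤ (2 * κ + 1) * (m * n) := Nat.mul_le_mul_left _ hLx
  constructor
  · calc progTime N r ((2 * κ + 1) * L) (b₀ ((2 * κ + 1) * L) + L) m n l
        ≤ progTime N r ((2 * κ + 1) * (m * n)) (b₀ ((2 * κ + 1) * (m * n)) + m * n) (m * n) (m * n) l :=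
          progTime_mono N r l hℓx (Nat.add_le_add (hmono hℓx) hLx)
            (Nat.le_mul_of_pos_right m (by omega)) (Nat.le_mul_of_pos_left n hm)
      _ ≤ E * (m * n) ^ E := hE _ hmn1
      _ ≤ _ := Nat.mul_le_mul (Nat.le_add_left _ _) (Nat.pow_le_pow_right hmn1 (Nat.le_add_left _ _))
  · have hX : (m + 1) * ((2 * κ + 1) * L + 1) ≤ (4 * κ + 4) * (m * L) :=
      calc (m + 1) * ((2 * κ + 1) * L + 1) ≤ (2 * m) * ((2 * κ + 2) * L) :=
            Nat.mul_le_mul (by omega) (by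
              have : (2 * κ + 2) * L = (2 * κ + 1) * L + L := by ring
              omega)
        _ = (4 * κ + 4) * (m * L) := by ring
    have hmL : 1 ≤ m * L := Nat.mul_pos hm hL1
    calc K * (progHeight N r _ _ m l + 1)
        ≤ K * ((19 + 6 * r) * ((4 * κ + 4) * (m * L)) + D * L ^ D + m * L) :=
          Nat.mul_le_mul_left _ (Nat.add_le_add ((progHeight_le _ _ _ _ _ _).trans
            (Nat.add_le_add (Nat.mul_le_mul_left _ hX) (hD L hL1))) hmL)
      _ = K * ((19 + 6 * r) * (4 * κ + 4) + 1) * (m * L) + K * D * L ^ D := by ring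
      _ ≤ (K * ((19 + 6 * r) * (4 * κ + 4) + 1) + K * D + E) * (m * L) +
            (K * ((19 + 6 * r) * (4 * κ + 4) + 1) + K * D + E) * L ^ (D + E) :=
          Nat.add_le_add (Nat.mul_le_mul_right _ (by omega))
            (Nat.mul_le_mul (by omega) (Nat.pow_le_pow_right hL1 (Nat.le_add_right _ _)))
      _ = _ := (Nat.mul_add _ _ _).symm

theorem mainTheorem3 {S : Type*} [LinearOrder S] [OrderBot S] [Semigroup S] [MulLeftMono S]
    [MulRightMono S] (code : S → List Bool) (hcode : IsEfficientCode code)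
    (s r : ℕ) (tie : TieBreak r) (F : Finset (Fin r)) (hF : F.Nonempty) :
    ∃ M : OfflineTM (AlignSym s) (PathSym r), ∀ κ : ℕ, ∃ C c : ℕ,
      ∀ (m n : ℕ), 1 ≤ m → m ≤ n →
      ∀ (A : Fin m → Fin s) (B : Fin n → Fin s) (W : ScoringScheme s r S),
        HasLogSizeValues code κ W tie A B →
        ∃ (P : List (GridVertex m n r)) (t : ℕ),
          IsOptimalAlignment W tie F A B P ∧
          IsCanonicalAlignment W tie F A B P ∧
          M.OutputsWithin (instanceWord code W A B) (pathWord P) t ∧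
          t ≤ C * (m * n) ^ c ∧
          M.spaceWithin (instanceWord code W A B) t ≤
            C * (m * (Nat.log 2 (m * n) + 1) + (Nat.log 2 (m * n) + 1) ^ c) := by
  obtain ⟨M₁, M₂, lam, b₀, hmono, hpoly, hB⟩ := hcode.exists_opBounds
  have := M₁.state_finite
  have := M₁.work_finite
  have := M₂.state_finite
  have := M₂.work_finite
  obtain ⟨M, K, hM⟩ := (alignProg tie F.sort : AProg s r M₁ M₂).exists_machine
  refine ⟨M, fun κ => ?_⟩
  obtain ⟨C, c, hC⟩ := exists_resource_bounds hmono hpoly (TabIdx.list s r).length r F.sort.length K κ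
  refine ⟨C, c, fun m n hm hmn A B W hW => ?_⟩
  -- Since `log₂ ((m + 1) * (n + 1)) ≤ 2 * L`, code words of length `κ * log₂ ((m + 1) * (n + 1))`
  -- fit into `ℓ = (2 * κ + 1) * L` bits; `b` bounds the time of the subroutines on such words and the
  -- length of the counters.
  have hlog := log_grid_le hm (hm.trans hmn)
  have hbits : ∀ i, i ≤ m ∨ i ≤ n → (Nat.bits i).length ≤ Nat.log 2 (m * n) + 1 := by
    intro i hi
    have : i ≤ m * n := by
      rcases hi with hi | hi
      · exact hi.trans (Nat.le_mul_of_pos_right _ (by omega))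
      · exact hi.trans (Nat.le_mul_of_pos_left _ hm)
    exact (length_bits_le_log i).trans (Nat.succ_le_succ (Nat.log_mono_right this))
  obtain ⟨L, hL⟩ : ∃ L, L = Nat.log 2 (m * n) + 1 := ⟨_, rfl⟩
  obtain ⟨ℓ, hℓ⟩ : ∃ ℓ, ℓ = (2 * κ + 1) * L := ⟨_, rfl⟩
  obtain ⟨b, hb⟩ : ∃ b, b = b₀ ℓ + L := ⟨_, rfl⟩
  obtain ⟨hT, hH⟩ := hC m n L ℓ b hm hmn hL hℓ hb
  rw [← hL] at hlog hbits ⊢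
  have hvalid := gridRun_valid (ℓ := ℓ) (b := b) hW
    ((Nat.mul_le_mul_left κ hlog).trans (by
      rw [hℓ, ← Nat.mul_assoc, Nat.mul_comm κ 2]; exact Nat.mul_le_mul_right _ (Nat.le_succ _)))
    fun i hi => (hbits i hi).trans (hb ▸ Nat.le_add_left _ _)
  have hops : OpBounds M₁ M₂ code ℓ (lam ℓ) b := (hB ℓ).mono (hb ▸ Nat.le_add_right _ _)
  obtain ⟨q, hq, hmax, hmin⟩ :=
    exists_first_max hF fun q => (alignDag W tie A B).value (sinkVertex m n q)
  have hgv : ∀ k p, (gridVal W tie A B k m n p).1 =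
      (alignDag W tie A B).value (sinkVertex m n p) := fun k p =>
    congrArg Prod.fst (gridVal_vertex k (sinkVertex m n p))
  have hsel : ∀ k, selectBest (gridVal W tie A B k m n) F.sort = some (gridVal W tie A B k m n q) :=
    fun k => selectBest_eq (F.pairwise_sort _) ((Finset.mem_sort _).2 hq)
      (fun p hp => by rw [hgv, hgv]; exact hmax p ((Finset.mem_sort _).1 hp))
      (fun p hp h => hmin p ((Finset.mem_sort _).1 hp) (by rwa [hgv, hgv] at h))
  obtain ⟨s', hout, t, ht, he⟩ := runs_alignProg (M₁ := M₁) (M₂ := M₂) (a := List.ofFn A)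
    (b' := List.ofFn B) (l := F.sort) (v := fun k => gridVal W tie A B k m n q) hops
    (fun k _ => hvalid k) (fun k _ => by simpa using hsel k) (instanceWord_eq code W A B)
  simp only [List.length_ofFn] at hout ht he
  obtain ⟨h1, h2⟩ := hM _ _ _ _ he
  refine ⟨(alignDag W tie A B).witnessPath (sinkVertex m n q), t, isOptimal_witnessPath hq hmax,
    ⟨q, hq, hmax, hmin, ((alignDag W tie A B).canonical_witnessPath gridPreds_nonempty _).1⟩,
    ?_, ht.trans hT, h2.trans hH⟩
  · rw [← flatMap_tagWord]
    rw [hout] at h1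
    exact h1
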